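/- Let $d\in\{1,2\}$ and let $\Omega\subset\mathbb R^d$ be a bounded domain with $\mathcal H^{d-1}(\partial\Omega)<\infty$ and with an outer unit normal $\mathbf n$ on $\partial\Omega$ in the sense of the Gauss–Green formula (for instance a bounded Lipschitz domain). Let $\emptyset\ne\Gamma_u\subset\partial\Omega$ be measurable and $\Gamma_t=\partial\Omega\setminus\Gamma_u$. Let $\mu,b>0$ and $\epsilon\in\mathbb R$ with $\alpha=\epsilon-2/b>0$, and put $\beta=\mu b/4$, $\beta_o=\mu/(2b)$, $c=1/\beta$, $\eta=16\alpha^3/(27c^2)$. Let $$\mathcal X_a=\{u\in C(\bar\Omega):\ \nabla u\in L^4(\Omega;\mathbb R^d),\ u=0\text{ on }\Gamma_u\},\qquad \Pi_2(u)=\int_\Omega\Big[\tfrac{\beta}{2}\big(|\nabla u|^2-\alpha\big)^2-\beta_o\Big]dx-\int_{\Gamma_t}t\,u\,d\Gamma .$$ Let $\tau\in C(\bar\Omega;\mathbb R^d)$, not identically zero on $\Omega$, satisfy $\operatorname{div}\tau=0$ in $\Omega$ (in the sense of distributions) and $\mathbf n\cdot\tau=t$ almost everywhere on $\Gamma_t$.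 Put $$\Pi_2^d(\zeta)=-\int_\Omega\Big[\frac{|\tau|^2}{4\zeta}+\tfrac c2\zeta^2+\alpha\zeta+\beta_o\Big]dx$$ on $\mathcal S_a=\{\zeta\in L^2(\Omega):|\tau|^2/\zeta\in L^1(\Omega)\}$, where $|\tau|^2/\zeta$ is read as $\infty$ where $\zeta=0\ne\tau$ and as $0$ where $\zeta=0=\tau$, and let $\mathcal S_a^+=\{\zeta\in\mathcal S_a:\zeta\ge0\}$. With principal complex roots, and $\psi$ evaluated at $s=|\tau(x)|$, let $$\psi(s)=\Big(-16\alpha^3+54c^2s^2+6\sqrt3\,s\sqrt{27c^4s^2-16\alpha^3c^2}\Big)^{1/3},$$ $$\bar\zeta_1=-\frac{\alpha}{3c}+\frac{2^{4/3}\alpha^2}{3c\psi}+\frac{\psi}{3\cdot2^{4/3}c},\qquad \bar\zeta_{2}=-\frac{\alpha}{3c}-\frac{2^{1/3}\alpha^2(1-i\sqrt3)}{3c\psi}-\frac{(1+i\sqrt3)\psi}{12\cdot2^{1/3}c},\qquad \bar\zeta_{3}=-\frac{\alpha}{3c}-\frac{2^{1/3}\alpha^2(1+i\sqrt3)}{3c\psi}-\frac{(1-i\sqrt3)\psi}{12\cdot2^{1/3}c}.$$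 We say that $\bar u_i$ exists if $\bar\zeta_i$ is real on $\Omega$ and nonzero almost everywhere and there is a function $\bar u_i\in C(\bar\Omega)$, vanishing on $\Gamma_u$, given by the path-independent line integral $\bar u_i(x)=\int_{x_0}^x(2\bar\zeta_i)^{-1}\tau\cdot dx$ for $x_0\in\Gamma_u$ (the integral formula holding along every $C^1$ path that lies in $\Omega$ except possibly for its starting point in $\bar\Omega$). Critical points of $\Pi_2$ and of $\Pi_2^d$ are points where the directional derivatives vanish along all $v\in\mathcal X_a$, respectively along all $h\in L^2(\Omega)$ with $|h|\le K|\zeta|$ a.e. on $\{\tau\ne0\}$ for some constant $K$. 1. A measurable function $\zeta$ is a critical point of $\Pi_2^d$ if and only if for almost every $x\in\Omega$ the value $\zeta(x)$ is nonzero and equals one of the at most three real numbers among $\bar\zeta_1(x),\bar\zeta_2(x),\bar\zeta_3(x)$. Whenever $\bar u_i$ exists ($i=1,2,3$), it belongs to $\mathcal X_a$ and is a critical point of $\Pi_2$. 2. $\bar\zeta_1$ is real on $\Omega$, and positive wherever $\tau\ne0$; $\bar\zeta_1\in\mathcal S_a^+$ is a global maximizer of $\Pi_2^d$ over $\mathcal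 S_a^+$. If $\bar u_1$ exists, it is a global minimizer of $\Pi_2$ over $\mathcal X_a$, and $$\Pi_2(\bar u_1)=\min_{\mathcal X_a}\Pi_2=\max_{\mathcal S_a^+}\Pi_2^d=\Pi_2^d(\bar\zeta_1).$$ 3. Suppose $|\tau|^2<\eta$ on $\Omega$. Then $\bar\zeta_3$ is real, with $-\alpha\beta\le\bar\zeta_3<-\tfrac23\alpha\beta$ and the first inequality strict where $\tau\ne0$, and it maximizes $\Pi_2^d$ over all $\zeta\in\mathcal S_a$ with $-\alpha\beta\le\zeta<-\tfrac23\alpha\beta$ a.e. If $\bar u_3$ exists, it is a local maximizer of $\Pi_2$: there is a continuous $\rho$ on $\bar\Omega$, positive at every point of $\bar\Omega$ where $|\tau|^2<\eta$, such that $\bar u_3$ maximizes $\Pi_2$ over $\{u\in\mathcal X_a:|\nabla u-\nabla\bar u_3|<\rho\text{ a.e. in }\Omega\}$; and $\Pi_2(\bar u_3)=\Pi_2^d(\bar\zeta_3)$. 4. Suppose $d=1$ and $|\tau|^2<\eta$ on $\Omega$. Then $\bar\zeta_2$ is real, $-\tfrac23\alpha\beta<\bar\zeta_2<0$, and it minimizes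 $\Pi_2^d$ over all $\zeta\in\mathcal S_a$ with $-\tfrac23\alpha\beta<\zeta<0$ a.e. If $\bar u_2$ exists, it is a local minimizer of $\Pi_2$: for some constant $\rho>0$ it minimizes $\Pi_2$ over $\{u\in\mathcal X_a:|u'-\bar u_2'|<\rho\text{ a.e. in }\Omega\}$; and $\Pi_2(\bar u_2)=\Pi_2^d(\bar\zeta_2)$. 5. Suppose $|\tau|^2>\eta$ on $\Omega$. Then $\bar\zeta_1$ is, up to null sets, the unique critical point of $\Pi_2^d$ and the unique maximizer of $\Pi_2^d$ over $\mathcal S_a^+$. If $\bar u_1$ exists, it is the unique global minimizer of $\Pi_2$ over $\mathcal X_a$, and it is smooth: $\bar u_1$ is differentiable in $\Omega$ with gradient continuous up to $\bar\Omega$, and $\bar u_1\in C^{k+1}(\Omega)$ whenever $\tau\in C^k(\Omega)$, $0\le k\le\infty$. -/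

import Mathlib

open MeasureTheory Set
open scoped ContDiff

noncomputable section

namespace AntiPlane

/-- Euclidean space `ℝᵈ` (only `d = 1, 2` are used). -/
abbrev Pt (d : ℕ) : Type := EuclideanSpace ℝ (Fin d)

/-! ### Regions, boundary and weak derivatives -/

/-- Surface measure on sets of dimension `d - 1` in `ℝᵈ`: counting measure for `d = 1` and
arc length for `d = 2`. -/
def surface (d : ℕ) : Measure (Pt d) := Measure.hausdorffMeasure ((d : ℝ) - 1)

/-- Classical divergence of a vector field. -/
def divergence {d : ℕ} (F : Pt d → Pt d) (x : Pt d) : ℝ :=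
  ∑ i, (fderiv ℝ F x (EuclideanSpace.single i 1)) i

/-- A bounded domain with boundary of finite surface measure and with (measure-theoretic)
outer unit normal `n`; every bounded Lipschitz domain is one. The last field is
De Giorgi's definition of the outer normal, which determines `n` almost everywhere on `∂Ω`. -/
structure IsRegion {d : ℕ} (Ω : Set (Pt d)) (n : Pt d → Pt d) : Prop where
  isOpen : IsOpen Ω
  isConnected : IsConnected Ω
  isBounded : Bornology.IsBounded Ω
  finite_boundary : surface d (frontier Ω) < ⊤
  measurable_normal : Measurable n
  unit_normal : ∀ᵐ x ∂(surface d).restrict (frontier Ω), ‖n x‖ = 1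
  outer_normal : ∀ F : Pt d → Pt d, ContDiff ℝ 1 F →
    ∫ x in Ω, divergence F x = ∫ x in frontier Ω, inner ℝ (n x) (F x) ∂(surface d)

/-- Smooth test functions with compact support in `Ω`. -/
def IsTest {d : ℕ} (Ω : Set (Pt d)) (φ : Pt d → ℝ) : Prop :=
  ContDiff ℝ ∞ φ ∧ HasCompactSupport φ ∧ tsupport φ ⊆ Ω

/-- `g` is a weak gradient of `u` on `Ω`. -/
def HasWeakGradient {d : ℕ} (Ω : Set (Pt d)) (u : Pt d → ℝ) (g : Pt d → Pt d) : Prop :=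
  LocallyIntegrableOn g Ω ∧
    ∀ φ : Pt d → ℝ, IsTest Ω φ → ∫ x in Ω, u x • gradient φ x = -∫ x in Ω, φ x • g x

open Classical in
/-- The weak gradient `∇u` on `Ω` (unique up to null sets when it exists). -/
def weakGradient {d : ℕ} (Ω : Set (Pt d)) (u : Pt d → ℝ) : Pt d → Pt d :=
  if h : ∃ g, HasWeakGradient Ω u g then h.choose else 0

/-- `div τ = 0` in `Ω`, in the sense of distributions. -/
def IsDivFree {d : ℕ} (Ω : Set (Pt d)) (τ : Pt d → Pt d) : Prop :=
  ∀ φ : Pt d → ℝ, IsTest Ω φ → ∫ x in Ω, inner ℝ (τ x) (gradient φ x) = 0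

/-! ### Admissible displacements and stresses -/

/-- Kinetically admissible displacements: continuous on the closure, with weak gradient in `L⁴`
(that is, `L^{2p}` with `p = 2`), vanishing on `Γu`. -/
def Displacements {d : ℕ} (Ω Γu : Set (Pt d)) : Set (Pt d → ℝ) :=
  {u | ContinuousOn u (closure Ω) ∧
    (∃ g, HasWeakGradient Ω u g ∧ MemLp g 4 (volume.restrict Ω)) ∧ ∀ x ∈ Γu, u x = 0}

/-- Statically admissible shear stresses: continuous on the closure, divergence free, with
prescribed traction `t` on `Γt = ∂Ω \ Γu`. -/
def Stresses {d : ℕ} (Ω Γu : Set (Pt d)) (n : Pt d → Pt d) (t : Pt d → ℝ) :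
    Set (Pt d → Pt d) :=
  {τ | ContinuousOn τ (closure Ω) ∧ IsDivFree Ω τ ∧
    ∀ᵐ x ∂(surface d).restrict (frontier Ω \ Γu), inner ℝ (n x) (τ x) = t x}

/-! ### The material with `p = 2` -/

/-- `β = μ b / 4`. -/
def beta (μ b : ℝ) : ℝ := μ * b / 4

/-- `α = ε - 2 / b`. -/
def alpha (b ε : ℝ) : ℝ := ε - 2 / b

/-- `β₀ = μ / (2 b)`. -/
def beta0 (μ b : ℝ) : ℝ := μ / (2 * b)

/-- `c = 4 / (μ b)`. -/
def cc (μ b : ℝ) : ℝ := 4 / (μ * b)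

/-- `η = 16 α³ / (27 c²)`. -/
def eta (μ b ε : ℝ) : ℝ := 16 * alpha b ε ^ 3 / (27 * cc μ b ^ 2)

/-- The stored energy density
`(μ / 2b) [(1 + (b/2)(|γ|² - ε))² - 1] = (β/2)(|γ|² - α)² - β₀`. -/
def storedEnergy {d : ℕ} (μ b ε : ℝ) (γ : Pt d) : ℝ :=
  μ / (2 * b) * ((1 + b / 2 * (‖γ‖ ^ 2 - ε)) ^ 2 - 1)

/-- The total potential energy `Π₂`. -/
def potential {d : ℕ} (μ b ε : ℝ) (Ω Γu : Set (Pt d)) (t u : Pt d → ℝ) : ℝ :=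
  (∫ x in Ω, storedEnergy μ b ε (weakGradient Ω u x))
    - ∫ x in frontier Ω \ Γu, t x * u x ∂(surface d)

/-- `u` is a critical point of `Π₂`: an admissible displacement at which all directional
derivatives of `Π₂` along admissible displacements exist and vanish. -/
def IsCriticalPrimal {d : ℕ} (μ b ε : ℝ) (Ω Γu : Set (Pt d)) (t u : Pt d → ℝ) : Prop :=
  u ∈ Displacements Ω Γu ∧ ∀ v ∈ Displacements Ω Γu,
    HasDerivAt (fun s : ℝ => potential μ b ε Ω Γu t (u + s • v)) 0 0

/-! ### The dual problem -/

/-- The pure complementary energy `Π₂ᵈ`. -/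
def dualEnergy {d : ℕ} (μ b ε : ℝ) (Ω : Set (Pt d)) (τ : Pt d → Pt d) (ζ : Pt d → ℝ) : ℝ :=
  -∫ x in Ω, (‖τ x‖ ^ 2 / (4 * ζ x) + 1 / 2 * cc μ b * ζ x ^ 2 + alpha b ε * ζ x + beta0 μ b)

/-- The domain of `Π₂ᵈ`: `ζ ∈ L²` with `|τ|² / ζ ∈ L¹`. The quotient is taken in `[0, ∞]`, so that
`|τ|² / 0 = ∞` where `τ ≠ 0`, and `0 / 0 = 0`. -/
def DualDomain {d : ℕ} (Ω : Set (Pt d)) (τ : Pt d → Pt d) : Set (Pt d → ℝ) :=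
  {ζ | MemLp ζ 2 (volume.restrict Ω) ∧ ∫⁻ x in Ω, ‖τ x‖ₑ ^ 2 / ‖ζ x‖ₑ < ⊤}

/-- The dual feasible set `S_a⁺`: nonnegative elements of the domain. -/
def DualFeasible {d : ℕ} (Ω : Set (Pt d)) (τ : Pt d → Pt d) : Set (Pt d → ℝ) :=
  {ζ ∈ DualDomain Ω τ | ∀ᵐ x ∂volume.restrict Ω, 0 ≤ ζ x}

/-- Elements of the domain whose values lie in `I` almost everywhere. -/
def DualRange {d : ℕ} (Ω : Set (Pt d)) (τ : Pt d → Pt d) (I : Set ℝ) : Set (Pt d → ℝ) :=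
  {ζ ∈ DualDomain Ω τ | ∀ᵐ x ∂volume.restrict Ω, ζ x ∈ I}

/-- Admissible variations of `ζ`: those `h ∈ L²` with `|h| ≤ K |ζ|` wherever `τ ≠ 0`, so that
`ζ + s h` stays in the domain of `Π₂ᵈ` for all small `s`. -/
def IsVariation {d : ℕ} (Ω : Set (Pt d)) (τ : Pt d → Pt d) (ζ h : Pt d → ℝ) : Prop :=
  MemLp h 2 (volume.restrict Ω) ∧
    ∃ K : ℝ, ∀ᵐ x ∂volume.restrict Ω, τ x ≠ 0 → |h x| ≤ K * |ζ x|

/-- `ζ` is a critical point of `Π₂ᵈ`. -/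
def IsCriticalDual {d : ℕ} (μ b ε : ℝ) (Ω : Set (Pt d)) (τ : Pt d → Pt d)
    (ζ : Pt d → ℝ) : Prop :=
  ζ ∈ DualDomain Ω τ ∧ ∀ h, IsVariation Ω τ ζ h →
    HasDerivAt (fun s : ℝ => dualEnergy μ b ε Ω τ (ζ + s • h)) 0 0

/-! ### Cardano's formulas -/

/-- `ψ(s) = (-16 α³ + 54 c² s² + 6 √3 s √(27 c⁴ s² - 16 α³ c²))^{1/3}`, with principal complex
roots. -/
def psi (μ b ε s : ℝ) : ℂ :=
  ((-16 * alpha b ε ^ 3 + 54 * cc μ b ^ 2 * s ^ 2 : ℝ)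
    + (6 * √3 * s : ℝ)
      * ((27 * cc μ b ^ 4 * s ^ 2 - 16 * alpha b ε ^ 3 * cc μ b ^ 2 : ℝ) : ℂ) ^ (1 / 2 : ℂ))
    ^ (1 / 3 : ℂ)

/-- The three candidate roots `ζ̄₁, ζ̄₂, ζ̄₃` (indices `0, 1, 2`) at a point where `|τ| = s`. -/
def cardano (μ b ε : ℝ) (i : Fin 3) (s : ℝ) : ℂ :=
  let α : ℂ := (alpha b ε : ℝ)
  let c : ℂ := (cc μ b : ℝ)
  let ψ : ℂ := psi μ b ε s
  let r : ℂ := ((2 : ℝ) ^ (1 / 3 : ℝ) : ℝ)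
  ![-α / (3 * c) + r ^ 4 * α ^ 2 / (3 * c * ψ) + ψ / (3 * r ^ 4 * c),
    -α / (3 * c) - r * α ^ 2 * (1 - Complex.I * (√3 : ℝ)) / (3 * c * ψ)
      - (1 + Complex.I * (√3 : ℝ)) * ψ / (12 * r * c),
    -α / (3 * c) - r * α ^ 2 * (1 + Complex.I * (√3 : ℝ)) / (3 * c * ψ)
      - (1 - Complex.I * (√3 : ℝ)) * ψ / (12 * r * c)] i

/-- The real function `x ↦ ζ̄ᵢ(x)`; meaningful where the candidate root is real. -/
def zbar {d : ℕ} (μ b ε : ℝ) (τ : Pt d → Pt d) (i : Fin 3) (x : Pt d) : ℝ :=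
  (cardano μ b ε i ‖τ x‖).re

/-- `u` is the path-independent line integral `u(x) = ∫_{x₀}^{x} g · dx`, for all `x₀ ∈ Γu`,
continuous up to the boundary. -/
def IsLineIntegral {d : ℕ} (Ω Γu : Set (Pt d)) (g : Pt d → Pt d) (u : Pt d → ℝ) : Prop :=
  ContinuousOn u (closure Ω) ∧ (∀ x ∈ Γu, u x = 0) ∧
    ∀ p : ℝ → Pt d, ContDiff ℝ 1 p → p 0 ∈ closure Ω → (∀ s ∈ Ioc (0 : ℝ) 1, p s ∈ Ω) →
      u (p 1) = u (p 0) + ∫ s in (0 : ℝ)..1, inner ℝ (g (p s)) (deriv p s)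

/-- `u = ūᵢ`: the root `ζ̄ᵢ` is real throughout `Ω` and nonzero almost everywhere, and `u` is the
line integral of `(2 ζ̄ᵢ)⁻¹ τ`. -/
def IsDualDisplacement {d : ℕ} (μ b ε : ℝ) (Ω Γu : Set (Pt d)) (τ : Pt d → Pt d) (i : Fin 3)
    (u : Pt d → ℝ) : Prop :=
  (∀ x ∈ Ω, (cardano μ b ε i ‖τ x‖).im = 0) ∧
  (∀ᵐ x ∂volume.restrict Ω, zbar μ b ε τ i x ≠ 0) ∧
  IsLineIntegral Ω Γu (fun x => (2 * zbar μ b ε τ i x)⁻¹ • τ x) u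

/-- Neighbourhood of `u` among the admissible displacements: `|∇v - ∇u| < ρ` a.e. in `Ω`. -/
def Nbhd {d : ℕ} (Ω Γu : Set (Pt d)) (u ρ : Pt d → ℝ) : Set (Pt d → ℝ) :=
  {v ∈ Displacements Ω Γu |
    ∀ᵐ x ∂volume.restrict Ω, ‖weakGradient Ω v x - weakGradient Ω u x‖ < ρ x}

/-- `u` is smooth on `Ω`: its gradient exists everywhere in `Ω` and is continuous up to the
boundary, and `u` is one order smoother than `τ` (in particular `C^∞` if `τ` is). -/
def IsSmoothSolution {d : ℕ} (Ω : Set (Pt d)) (τ : Pt d → Pt d) (u : Pt d → ℝ) : Prop :=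
  (∃ G : Pt d → Pt d, ContinuousOn G (closure Ω) ∧ ∀ x ∈ Ω, HasGradientAt u (G x) x) ∧
  ∀ k : ℕ∞, ContDiffOn ℝ k τ Ω → ContDiffOn ℝ ((k : WithTop ℕ∞) + 1) u Ω

end AntiPlane

end

/-!
The proof is canonical duality, carried out pointwise and then integrated.

*Pointwise algebra.* The stationarity condition of the dual density in `ζ` is the cubic
`4 ζ² (c ζ + α) = |τ|²`, whose roots are Cardano's three expressions (`cardano_factorization`).
For `|τ|² ≤ η` the radicand is complex of modulus `16 α³`, and the roots take their trigonometric
form, `α/(3c)` times `2 cos φ - 1`, `2 cos (φ ∓ 2π/3) - 1` (`cardano_of_le`); for `|τ|² ≥ η` all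
radicals are real and `ζ̄₁` is the only real root when the inequality is strict. If `z` is a root,
`γ₀ = τ / (2 z)`, `W` is the stored energy and `q` the dual density, then `|γ₀|² = c z + α` and

* `W(γ) - W(γ₀) - τ · (γ - γ₀) = (β/2) (|γ|² - |γ₀|²)² + z |γ - γ₀|²`  (`primalDensity_sub`),
* `q(ζ) - q(z) = (ζ - z)² / ζ · (α + c (ζ + 2 z) / 2)`  (`dualDensity_sub`),
* `W(γ₀) - τ · γ₀ = -q(z)`  (`primalDensity_eq`).

All extremality statements are sign discussions of the first two right-hand sides. For `z ≥ 0`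
both are nonnegative, the second when `ζ > 0`. If `z` and `ζ` are negative, the bracket in the
second has a fixed sign when they lie on the same side of the double root `-2α/(3c)`. For `z = ζ̄₃`
the first is nonpositive when `(|γ| + |γ₀|)² ≤ -2 c z`, which holds near `γ₀` because
`4 |γ₀|² < -2 c z` as long as `|τ|² < η`. For `z = ζ̄₂` it is nonnegative when `|γ + γ₀|² ≥ -2 c z`,
but only in dimension one, where `(|γ|² - |γ₀|²)² = |γ - γ₀|² |γ + γ₀|²`; there `τ` is constant, so
that one radius serves all of `Ω`.

*Integration.* The traction term of `Π₂` is moved into `Ω` by virtual work (`virtual_work`). This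
needs the Gauss–Green formula for `v τ` with `v` continuous, `∇v` integrable and `τ` merely
continuous and divergence free, while the hypothesis on `Ω` gives it for `C¹` fields only. Since
`ℋ^{d-1}(∂Ω) < ∞`, a covering of `∂Ω` by balls yields cutoff functions, equal to one off a
neighbourhood of `∂Ω`, whose gradients are bounded in `L¹` (`exists_cutoff`). A `C¹` field `G`
uniformly close to `v τ` then has almost the same bulk integral: after multiplication by a cutoff
`φ` the difference is `∫ (G - v τ) · ∇φ`, by `integral_test_divFree` (`IsRegion.gauss_green`).

*Regularity of `ūᵢ`.* The strain `τ / (2 ζ̄ᵢ)` is bounded, as `|τ / (2 ζ̄ᵢ)|² = c ζ̄ᵢ + α`, and is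
continuous where `ζ̄ᵢ ≠ 0`. Its line integral is therefore locally Lipschitz and has the strain as
gradient almost everywhere, hence as weak gradient (`IsDualDisplacement.hasWeakGradient`).

*Critical points of `Π₂ᵈ`.* Stationarity along the admissible variations, tested separately on
`{τ = 0}` and along multiples of `ζ`, gives the cubic almost everywhere (`isCriticalDual_iff`).
-/

namespace AntiPlane

/-! ### Cardano's formulas and the dual cubic -/

section Cubic

variable {μ b ε s : ℝ}

lemma cc_pos (hμ : 0 < μ) (hb : 0 < b) : 0 < cc μ b := by
  unfold cc; positivity

/-- The radicand of the cube root in `psi`. -/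
noncomputable def radicand (μ b ε s : ℝ) : ℂ :=
  (-16 * alpha b ε ^ 3 + 54 * cc μ b ^ 2 * s ^ 2 : ℝ)
    + (6 * √3 * s : ℝ)
      * ((27 * cc μ b ^ 4 * s ^ 2 - 16 * alpha b ε ^ 3 * cc μ b ^ 2 : ℝ) : ℂ) ^ (1 / 2 : ℂ)

lemma psi_eq : psi μ b ε s = radicand μ b ε s ^ (1 / 3 : ℂ) := rfl

lemma psi_cube : psi μ b ε s ^ 3 = radicand μ b ε s := by
  rw [psi_eq]
  rw [one_div]
  exact Complex.cpow_nat_inv_pow (radicand μ b ε s) (n := 3) (by norm_num)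

lemma sqrt_three_sq : (((√3 : ℝ) : ℂ)) ^ 2 = 3 := by
  rw [← Complex.ofReal_pow, Real.sq_sqrt (by norm_num)]; norm_num

/-- With `X = -16 α³ + 54 c² s²` and `Y` the square root term, the radicand `X + Y` satisfies
`(X + Y) (X - Y) = 256 α⁶`; so it is a root of this quadratic. -/
lemma radicand_quadratic :
    radicand μ b ε s ^ 2
      - 2 * (-16 * (alpha b ε : ℂ) ^ 3 + 54 * (cc μ b : ℂ) ^ 2 * (s : ℂ) ^ 2) * radicand μ b ε s
      + 256 * (alpha b ε : ℂ) ^ 6 = 0 := by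
  have h := Complex.cpow_nat_inv_pow
    ((27 * cc μ b ^ 4 * s ^ 2 - 16 * alpha b ε ^ 3 * cc μ b ^ 2 : ℝ) : ℂ) (n := 2) (by norm_num)
  unfold radicand
  rw [one_div]
  simp only [Nat.cast_ofNat] at h
  generalize ((27 * cc μ b ^ 4 * s ^ 2 - 16 * alpha b ε ^ 3 * cc μ b ^ 2 : ℝ) : ℂ) ^ (2⁻¹ : ℂ) = y
    at h ⊢
  have h3 := sqrt_three_sq
  push_cast at h ⊢
  linear_combination (36 * (√3 : ℂ) ^ 2 * s ^ 2) * h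
    + (36 * s ^ 2 * (27 * (cc μ b : ℂ) ^ 4 * s ^ 2 - 16 * (alpha b ε : ℂ) ^ 3 * cc μ b ^ 2)) * h3

lemma psi_ne_zero (hα : 0 < alpha b ε) : psi μ b ε s ≠ 0 := by
  intro h
  have h1 := radicand_quadratic (μ := μ) (b := b) (ε := ε) (s := s)
  rw [← psi_cube, h] at h1
  have h2 : (alpha b ε : ℂ) ≠ 0 := by exact_mod_cast hα.ne'
  apply pow_ne_zero 6 h2
  linear_combination h1 / 256

/-- The real cube root of two. -/
noncomputable def cbrtTwo : ℝ := (2 : ℝ) ^ (1 / 3 : ℝ)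

lemma cbrtTwo_pos : 0 < cbrtTwo := Real.rpow_pos_of_pos two_pos _

lemma cbrtTwo_cube : cbrtTwo ^ 3 = 2 := by
  rw [cbrtTwo, ← Real.rpow_natCast, ← Real.rpow_mul two_pos.le]; norm_num

lemma cbrtTwo_cube_complex : (cbrtTwo : ℂ) ^ 3 = 2 := by exact_mod_cast cbrtTwo_cube

/-- The first of the two cube roots in Cardano's formula, `ψ / (3 · 2^{4/3} c)`. -/
noncomputable def cardanoA (μ b ε s : ℝ) : ℂ := psi μ b ε s / (3 * (cbrtTwo : ℂ) ^ 4 * cc μ b)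

/-- The second of the two cube roots in Cardano's formula, `2^{4/3} α² / (3 c ψ)`. -/
noncomputable def cardanoB (μ b ε s : ℝ) : ℂ :=
  (cbrtTwo : ℂ) ^ 4 * (alpha b ε : ℂ) ^ 2 / (3 * cc μ b * psi μ b ε s)

/-- The primitive cube root of unity `-(1 + i √3) / 2`. -/
noncomputable def omega : ℂ := -(1 + Complex.I * (√3 : ℝ)) / 2

lemma omega_sq : omega ^ 2 = -(1 - Complex.I * (√3 : ℝ)) / 2 := by
  unfold omega
  linear_combination (1 / 4 : ℂ) * (√3 : ℂ) ^ 2 * Complex.I_sq - (1 / 4 : ℂ) * sqrt_three_sq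

lemma omega_sum : omega ^ 2 + omega + 1 = 0 := by
  rw [omega_sq]; unfold omega; ring

lemma cardano_zero_eq : cardano μ b ε 0 s =
    -(alpha b ε : ℂ) / (3 * cc μ b) + cardanoA μ b ε s + cardanoB μ b ε s := by
  change -(alpha b ε : ℂ) / (3 * cc μ b)
    + (cbrtTwo : ℂ) ^ 4 * (alpha b ε : ℂ) ^ 2 / (3 * cc μ b * psi μ b ε s)
    + psi μ b ε s / (3 * (cbrtTwo : ℂ) ^ 4 * cc μ b) = _
  unfold cardanoA cardanoB; ring

lemma cardano_one_eq (hμ : 0 < μ) (hb : 0 < b) (hα : 0 < alpha b ε) : cardano μ b ε 1 s =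
    -(alpha b ε : ℂ) / (3 * cc μ b) + omega * cardanoA μ b ε s
      + omega ^ 2 * cardanoB μ b ε s := by
  change -(alpha b ε : ℂ) / (3 * cc μ b)
    - (cbrtTwo : ℂ) * (alpha b ε : ℂ) ^ 2 * (1 - Complex.I * (√3 : ℝ)) / (3 * cc μ b * psi μ b ε s)
    - (1 + Complex.I * (√3 : ℝ)) * psi μ b ε s / (12 * (cbrtTwo : ℂ) * cc μ b) = _
  rw [omega_sq]
  unfold cardanoA cardanoB omega
  have h1 := cbrtTwo_cube_complex
  have h2 : (cc μ b : ℂ) ≠ 0 := by exact_mod_cast (cc_pos hμ hb).ne'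
  have h3 : (cbrtTwo : ℂ) ≠ 0 := by exact_mod_cast cbrtTwo_pos.ne'
  have h4 := psi_ne_zero (μ := μ) (s := s) hα
  have h5 : (cbrtTwo : ℂ) ^ 4 = 2 * cbrtTwo := by linear_combination (cbrtTwo : ℂ) * h1
  rw [h5]
  field_simp
  ring

lemma cardano_two_eq (hμ : 0 < μ) (hb : 0 < b) (hα : 0 < alpha b ε) : cardano μ b ε 2 s =
    -(alpha b ε : ℂ) / (3 * cc μ b) + omega ^ 2 * cardanoA μ b ε s
      + omega * cardanoB μ b ε s := by
  change -(alpha b ε : ℂ) / (3 * cc μ b)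
    - (cbrtTwo : ℂ) * (alpha b ε : ℂ) ^ 2 * (1 + Complex.I * (√3 : ℝ)) / (3 * cc μ b * psi μ b ε s)
    - (1 - Complex.I * (√3 : ℝ)) * psi μ b ε s / (12 * (cbrtTwo : ℂ) * cc μ b) = _
  rw [omega_sq]
  unfold cardanoA cardanoB omega
  have h1 := cbrtTwo_cube_complex
  have h2 : (cc μ b : ℂ) ≠ 0 := by exact_mod_cast (cc_pos hμ hb).ne'
  have h3 : (cbrtTwo : ℂ) ≠ 0 := by exact_mod_cast cbrtTwo_pos.ne'
  have h4 := psi_ne_zero (μ := μ) (s := s) hα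
  have h5 : (cbrtTwo : ℂ) ^ 4 = 2 * cbrtTwo := by linear_combination (cbrtTwo : ℂ) * h1
  rw [h5]
  field_simp
  ring

lemma cardanoA_mul_cardanoB (hμ : 0 < μ) (hb : 0 < b) (hα : 0 < alpha b ε) :
    cardanoA μ b ε s * cardanoB μ b ε s = (alpha b ε : ℂ) ^ 2 / (9 * (cc μ b : ℂ) ^ 2) := by
  have h2 : (cc μ b : ℂ) ≠ 0 := by exact_mod_cast (cc_pos hμ hb).ne'
  have h3 : (cbrtTwo : ℂ) ≠ 0 := by exact_mod_cast cbrtTwo_pos.ne'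
  have h4 := psi_ne_zero (μ := μ) (s := s) hα
  unfold cardanoA cardanoB
  field_simp
  ring

lemma cardanoA_cube_add (hμ : 0 < μ) (hb : 0 < b) (hα : 0 < alpha b ε) :
    cardanoA μ b ε s ^ 3 + cardanoB μ b ε s ^ 3 =
      (s : ℂ) ^ 2 / (4 * cc μ b) - 2 * (alpha b ε : ℂ) ^ 3 / (27 * (cc μ b : ℂ) ^ 3) := by
  have h2 : (cc μ b : ℂ) ≠ 0 := by exact_mod_cast (cc_pos hμ hb).ne'
  have h4 := psi_ne_zero (μ := μ) (s := s) hα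
  have h6 : (cbrtTwo : ℂ) ^ 12 = 16 := by
    have h1 := cbrtTwo_cube_complex
    calc (cbrtTwo : ℂ) ^ 12 = (cbrtTwo ^ 3) ^ 4 := by ring
      _ = 16 := by rw [h1]; norm_num
  have h7 := radicand_quadratic (μ := μ) (b := b) (ε := ε) (s := s)
  rw [← psi_cube] at h7
  unfold cardanoA cardanoB
  rw [div_pow, div_pow, mul_pow, mul_pow, mul_pow, mul_pow, mul_pow, ← pow_mul]
  norm_num only
  rw [h6]
  field_simp
  linear_combination 4 * h7

/-- Cardano's three expressions are the roots of `z³ + (α/c) z² - s²/(4c)`. -/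
lemma cardano_factorization (hμ : 0 < μ) (hb : 0 < b) (hα : 0 < alpha b ε) (z : ℂ) :
    (z - cardano μ b ε 0 s) * (z - cardano μ b ε 1 s) * (z - cardano μ b ε 2 s) =
      z ^ 3 + alpha b ε / cc μ b * z ^ 2 - (s : ℂ) ^ 2 / (4 * cc μ b) := by
  rw [cardano_zero_eq, cardano_one_eq hμ hb hα, cardano_two_eq hμ hb hα]
  have hc : (cc μ b : ℂ) ≠ 0 := by exact_mod_cast (cc_pos hμ hb).ne'
  have h1 := cardanoA_mul_cardanoB (s := s) hμ hb hα
  have h2 := cardanoA_cube_add (s := s) hμ hb hα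
  have h3 := omega_sum
  have h4 : omega ^ 3 = 1 := by linear_combination (omega - 1) * h3
  set A := cardanoA μ b ε s
  set B := cardanoB μ b ε s
  set y : ℂ := z + alpha b ε / (3 * cc μ b) with hy
  have key : (y - (A + B)) * (y - (omega * A + omega ^ 2 * B)) * (y - (omega ^ 2 * A + omega * B))
      = y ^ 3 - 3 * (A * B) * y - (A ^ 3 + B ^ 3) := by
    generalize omega = w at *
    have hw : w ^ 2 = -w - 1 := by linear_combination h3
    rw [hw]
    ring_nf
    simp only [hw]
    ring
  have e : (z - (-(alpha b ε : ℂ) / (3 * cc μ b) + A + B))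
      * (z - (-(alpha b ε : ℂ) / (3 * cc μ b) + omega * A + omega ^ 2 * B))
      * (z - (-(alpha b ε : ℂ) / (3 * cc μ b) + omega ^ 2 * A + omega * B))
      = (y - (A + B)) * (y - (omega * A + omega ^ 2 * B))
        * (y - (omega ^ 2 * A + omega * B)) := by
    rw [hy]; ring
  rw [e, key, h1, h2, hy]
  field_simp
  ring

/-- A real number is one of Cardano's three roots exactly when it solves the dual algebraic
equation `4 ζ² (c ζ + α) = s²`. -/
lemma eq_cardano_iff (hμ : 0 < μ) (hb : 0 < b) (hα : 0 < alpha b ε) (z : ℝ) :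
    (∃ i, (z : ℂ) = cardano μ b ε i s) ↔ 4 * z ^ 2 * (cc μ b * z + alpha b ε) = s ^ 2 := by
  have hc := cc_pos hμ hb
  have hc' : (cc μ b : ℂ) ≠ 0 := by exact_mod_cast hc.ne'
  have h := cardano_factorization (s := s) hμ hb hα z
  have h1 : (4 * z ^ 2 * (cc μ b * z + alpha b ε) = s ^ 2) ↔
      (z : ℂ) ^ 3 + alpha b ε / cc μ b * (z : ℂ) ^ 2 - (s : ℂ) ^ 2 / (4 * cc μ b) = 0 := by
    rw [← Complex.ofReal_inj]
    push_cast
    constructor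
    · intro h
      field_simp
      linear_combination h
    · intro h
      field_simp at h
      linear_combination h
  rw [h1, ← h, mul_eq_zero, mul_eq_zero, sub_eq_zero, sub_eq_zero, sub_eq_zero]
  simp [Fin.exists_fin_succ, or_assoc]

/-- Where a root is real, its real part solves the dual algebraic equation. -/
lemma cardano_re_root (hμ : 0 < μ) (hb : 0 < b) (hα : 0 < alpha b ε) {i : Fin 3}
    (h : (cardano μ b ε i s).im = 0) :
    4 * (cardano μ b ε i s).re ^ 2 * (cc μ b * (cardano μ b ε i s).re + alpha b ε) = s ^ 2 :=
  (eq_cardano_iff hμ hb hα _).1 ⟨i, Complex.ext (by simp) (by simp [h])⟩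

lemma eta_mul (hμ : 0 < μ) (hb : 0 < b) :
    27 * cc μ b ^ 2 * eta μ b ε = 16 * alpha b ε ^ 3 := by
  have := cc_pos hμ hb
  unfold eta; field_simp

lemma eta_pos (hμ : 0 < μ) (hb : 0 < b) (hα : 0 < alpha b ε) : 0 < eta μ b ε := by
  have := cc_pos hμ hb
  unfold eta; positivity

/-- The angle `φ ∈ [0, π/3]` of the cube root `ψ` when `s² ≤ η`. -/
noncomputable def cardanoAngle (μ b ε s : ℝ) : ℝ :=
  Real.arccos ((-16 * alpha b ε ^ 3 + 54 * cc μ b ^ 2 * s ^ 2) / (16 * alpha b ε ^ 3)) / 3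

lemma cpow_half_of_nonneg {x : ℝ} (hx : 0 ≤ x) : (x : ℂ) ^ (1 / 2 : ℂ) = (√x : ℝ) := by
  rw [Real.sqrt_eq_rpow, Complex.ofReal_cpow hx]; norm_num

lemma cpow_half_neg {x : ℝ} (hx : 0 ≤ x) : ((-x : ℝ) : ℂ) ^ (1 / 2 : ℂ) = Complex.I * (√x : ℝ) := by
  rw [Complex.ofReal_cpow_of_nonpos (by linarith)]
  push_cast
  rw [neg_neg, cpow_half_of_nonneg hx, mul_comm]
  congr 1
  rw [show (Real.pi : ℂ) * Complex.I * (1 / 2) = Real.pi / 2 * Complex.I by ring,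
    Complex.exp_pi_div_two_mul_I]

lemma radicand_of_le (hμ : 0 < μ) (hb : 0 < b) (hs2 : s ^ 2 ≤ eta μ b ε) :
    radicand μ b ε s = (-16 * alpha b ε ^ 3 + 54 * cc μ b ^ 2 * s ^ 2 : ℝ)
      + (6 * √3 * s * √(16 * alpha b ε ^ 3 * cc μ b ^ 2 - 27 * cc μ b ^ 4 * s ^ 2) : ℝ)
        * Complex.I := by
  have h := eta_mul (ε := ε) hμ hb
  have hx : 0 ≤ 16 * alpha b ε ^ 3 * cc μ b ^ 2 - 27 * cc μ b ^ 4 * s ^ 2 := by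
    have : 27 * cc μ b ^ 4 * s ^ 2 ≤ 27 * cc μ b ^ 4 * eta μ b ε := by gcongr
    nlinarith [sq_nonneg (cc μ b)]
  have e : 27 * cc μ b ^ 4 * s ^ 2 - 16 * alpha b ε ^ 3 * cc μ b ^ 2 =
    -(16 * alpha b ε ^ 3 * cc μ b ^ 2 - 27 * cc μ b ^ 4 * s ^ 2) := by ring
  unfold radicand
  rw [e, cpow_half_neg hx]
  push_cast; ring

lemma norm_radicand_of_le (hμ : 0 < μ) (hb : 0 < b) (hα : 0 < alpha b ε)
    (hs2 : s ^ 2 ≤ eta μ b ε) : ‖radicand μ b ε s‖ = 16 * alpha b ε ^ 3 := by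
  have h := eta_mul (ε := ε) hμ hb
  have hx : 0 ≤ 16 * alpha b ε ^ 3 * cc μ b ^ 2 - 27 * cc μ b ^ 4 * s ^ 2 := by
    have : 27 * cc μ b ^ 4 * s ^ 2 ≤ 27 * cc μ b ^ 4 * eta μ b ε := by gcongr
    nlinarith [sq_nonneg (cc μ b)]
  rw [radicand_of_le hμ hb hs2, Complex.norm_add_mul_I, Real.sqrt_eq_iff_mul_self_eq
    (by positivity) (by positivity)]
  rw [mul_pow, mul_pow, mul_pow, Real.sq_sqrt hx, Real.sq_sqrt (by norm_num)]
  ring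

lemma cardanoA_of_le (hμ : 0 < μ) (hb : 0 < b) (hα : 0 < alpha b ε) (hs : 0 ≤ s)
    (hs2 : s ^ 2 ≤ eta μ b ε) :
    cardanoA μ b ε s = (alpha b ε / (3 * cc μ b) : ℝ) *
      (Real.cos (cardanoAngle μ b ε s) + Real.sin (cardanoAngle μ b ε s) * Complex.I) := by
  have hc := cc_pos hμ hb
  have hn := norm_radicand_of_le hμ hb hα hs2
  have hne : radicand μ b ε s ≠ 0 := by
    rw [← norm_pos_iff, hn]; positivity
  have him : 0 ≤ (radicand μ b ε s).im := by
    rw [radicand_of_le hμ hb hs2, Complex.add_im, Complex.ofReal_im, Complex.im_ofReal_mul]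
    simp only [Complex.I_im, zero_add, mul_one]
    positivity
  have hre : (radicand μ b ε s).re = -16 * alpha b ε ^ 3 + 54 * cc μ b ^ 2 * s ^ 2 := by
    rw [radicand_of_le hμ hb hs2, Complex.add_re, Complex.ofReal_re, Complex.re_ofReal_mul]
    simp
  have harg : Complex.arg (radicand μ b ε s) = 3 * cardanoAngle μ b ε s := by
    rw [Complex.arg_of_im_nonneg_of_ne_zero him hne, hre, hn, cardanoAngle]; ring
  have hψ : psi μ b ε s = ((cbrtTwo ^ 4 * alpha b ε : ℝ) : ℂ) *
      (Real.cos (cardanoAngle μ b ε s) + Real.sin (cardanoAngle μ b ε s) * Complex.I) := by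
    rw [psi_eq, Complex.cpow_def_of_ne_zero hne, Complex.log, harg, hn]
    have e1 : ((Real.log (16 * alpha b ε ^ 3) : ℝ) + ((3 * cardanoAngle μ b ε s : ℝ) : ℂ)
        * Complex.I) * (1 / 3 : ℂ)
        = ((Real.log (16 * alpha b ε ^ 3) / 3 : ℝ) : ℂ) + (cardanoAngle μ b ε s : ℝ)
          * Complex.I := by
      push_cast; ring
    have e2 : Real.exp (Real.log (16 * alpha b ε ^ 3) / 3) = cbrtTwo ^ 4 * alpha b ε := by
      have h16 : 16 * alpha b ε ^ 3 = (cbrtTwo ^ 4 * alpha b ε) ^ 3 := by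
        rw [mul_pow, ← pow_mul, show 4 * 3 = 3 * 4 by norm_num, pow_mul, cbrtTwo_cube]; norm_num
      have := cbrtTwo_pos
      rw [h16, Real.log_pow]
      push_cast
      rw [mul_div_cancel_left₀ _ (by norm_num), Real.exp_log (by positivity)]
    rw [e1, Complex.exp_add, ← Complex.ofReal_exp, e2, Complex.exp_mul_I, Complex.ofReal_cos,
      Complex.ofReal_sin]
  have h3 : (cbrtTwo : ℂ) ≠ 0 := by exact_mod_cast cbrtTwo_pos.ne'
  have h2 : (cc μ b : ℂ) ≠ 0 := by exact_mod_cast hc.ne'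
  rw [cardanoA, hψ]
  push_cast
  field_simp

lemma cardanoB_of_le (hμ : 0 < μ) (hb : 0 < b) (hα : 0 < alpha b ε) (hs : 0 ≤ s)
    (hs2 : s ^ 2 ≤ eta μ b ε) :
    cardanoB μ b ε s = (alpha b ε / (3 * cc μ b) : ℝ) *
      (Real.cos (cardanoAngle μ b ε s) - Real.sin (cardanoAngle μ b ε s) * Complex.I) := by
  have h := cardanoA_mul_cardanoB (s := s) hμ hb hα
  have hA := cardanoA_of_le hμ hb hα hs hs2
  have hA0 : cardanoA μ b ε s ≠ 0 := by
    intro h0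
    rw [h0, zero_mul] at h
    have hc := cc_pos hμ hb
    have : (alpha b ε : ℂ) ^ 2 / (9 * (cc μ b : ℂ) ^ 2) ≠ 0 := by
      have h2 : (cc μ b : ℂ) ≠ 0 := by exact_mod_cast hc.ne'
      have h3 : (alpha b ε : ℂ) ≠ 0 := by exact_mod_cast hα.ne'
      exact div_ne_zero (pow_ne_zero 2 h3) (mul_ne_zero (by norm_num) (pow_ne_zero 2 h2))
    exact this h.symm
  apply mul_left_cancel₀ hA0
  have hcs : (Real.cos (cardanoAngle μ b ε s) : ℂ) ^ 2 + (Real.sin (cardanoAngle μ b ε s)) ^ 2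
      = 1 := by
    exact_mod_cast Real.cos_sq_add_sin_sq _
  rw [h, hA]
  push_cast
  push_cast at hcs
  linear_combination (-(alpha b ε : ℂ) ^ 2 / (9 * (cc μ b : ℂ) ^ 2)) * hcs
    + (alpha b ε : ℂ) ^ 2 / (9 * (cc μ b : ℂ) ^ 2)
      * Complex.sin (cardanoAngle μ b ε s) ^ 2 * Complex.I_sq

/-- The trigonometric factors of the three roots when `s² ≤ η`. -/
noncomputable def cardanoTrig (i : Fin 3) (φ : ℝ) : ℝ :=
  ![2 * Real.cos φ, -Real.cos φ + √3 * Real.sin φ, -Real.cos φ - √3 * Real.sin φ] i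

/-- The trigonometric solution of the cubic: for `s² ≤ η` all three roots are real. -/
lemma cardano_of_le (hμ : 0 < μ) (hb : 0 < b) (hα : 0 < alpha b ε) (hs : 0 ≤ s)
    (hs2 : s ^ 2 ≤ eta μ b ε) (i : Fin 3) :
    cardano μ b ε i s =
      (alpha b ε / (3 * cc μ b) * (cardanoTrig i (cardanoAngle μ b ε s) - 1) : ℝ) := by
  have hA := cardanoA_of_le hμ hb hα hs hs2
  have hB := cardanoB_of_le hμ hb hα hs hs2
  have h2 : (cc μ b : ℂ) ≠ 0 := by exact_mod_cast (cc_pos hμ hb).ne'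
  fin_cases i
  · simp only [Fin.zero_eta, cardano_zero_eq, hA, hB, cardanoTrig]
    simp only [Matrix.cons_val_zero]
    push_cast; ring
  · simp only [Fin.mk_one, cardano_one_eq hμ hb hα, hA, hB, cardanoTrig, omega_sq]
    simp only [Matrix.cons_val_one, Matrix.cons_val_zero, omega]
    push_cast
    linear_combination (-(alpha b ε : ℂ) / (3 * cc μ b) * (√3 : ℂ)
      * Complex.sin (cardanoAngle μ b ε s)) * Complex.I_sq
  · simp only [Fin.reduceFinMk, cardano_two_eq hμ hb hα, hA, hB, cardanoTrig, omega_sq]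
    simp only [Matrix.cons_val, omega]
    push_cast
    linear_combination ((alpha b ε : ℂ) / (3 * cc μ b) * (√3 : ℂ)
      * Complex.sin (cardanoAngle μ b ε s)) * Complex.I_sq

lemma cardanoAngle_bounds :
    1 / 2 ≤ Real.cos (cardanoAngle μ b ε s) ∧ 0 ≤ Real.sin (cardanoAngle μ b ε s) := by
  have h0 : 0 ≤ cardanoAngle μ b ε s := div_nonneg (Real.arccos_nonneg _) (by norm_num)
  have h1 : cardanoAngle μ b ε s ≤ Real.pi / 3 :=
    div_le_div_of_nonneg_right (Real.arccos_le_pi _) (by norm_num)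
  have := Real.pi_pos
  refine ⟨?_, Real.sin_nonneg_of_nonneg_of_le_pi h0 (by linarith)⟩
  rw [← Real.cos_pi_div_three]
  exact Real.cos_le_cos_of_nonneg_of_le_pi h0 (by linarith) h1

/-- The angle lies in `[0, π/3]`, which locates the three roots in `[0, ∞)`, `[-2α/(3c), 0]` and
`[-α/c, -2α/(3c)]`. -/
lemma cardanoTrig_bounds :
    1 ≤ cardanoTrig 0 (cardanoAngle μ b ε s) ∧
    (-1 ≤ cardanoTrig 1 (cardanoAngle μ b ε s) ∧ cardanoTrig 1 (cardanoAngle μ b ε s) ≤ 1) ∧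
    (-2 ≤ cardanoTrig 2 (cardanoAngle μ b ε s) ∧ cardanoTrig 2 (cardanoAngle μ b ε s) ≤ -1) := by
  obtain ⟨hC, hS⟩ := cardanoAngle_bounds (μ := μ) (b := b) (ε := ε) (s := s)
  have hcs := Real.cos_sq_add_sin_sq (cardanoAngle μ b ε s)
  have hC1 := Real.cos_le_one (cardanoAngle μ b ε s)
  simp only [cardanoTrig, Matrix.cons_val]
  generalize Real.cos (cardanoAngle μ b ε s) = C at *
  generalize Real.sin (cardanoAngle μ b ε s) = S at *
  have h3 : √3 ^ 2 = (3 : ℝ) := Real.sq_sqrt (by norm_num)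
  have h30 : 0 ≤ √(3 : ℝ) := Real.sqrt_nonneg _
  have hT0 : 0 ≤ √3 * S := mul_nonneg h30 hS
  have hT : (√3 * S) ^ 2 = 3 * (1 - C ^ 2) := by rw [mul_pow, h3]; linarith
  generalize √3 * S = t at *
  refine ⟨by linarith, ⟨by linarith, ?_⟩, ?_, ?_⟩
  · have : t ≤ 1 + C := abs_le_of_sq_le_sq' (by nlinarith) (by linarith) |>.2
    linarith
  · have : t ≤ 2 - C := abs_le_of_sq_le_sq' (by nlinarith [sq_nonneg (2 * C - 1)]) (by linarith) |>.2
    linarith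
  · have : 1 - C ≤ t := abs_le_of_sq_le_sq' (by nlinarith) hT0 |>.2
    linarith

lemma cardano_im_of_le (hμ : 0 < μ) (hb : 0 < b) (hα : 0 < alpha b ε) (hs : 0 ≤ s)
    (hs2 : s ^ 2 ≤ eta μ b ε) (i : Fin 3) : (cardano μ b ε i s).im = 0 := by
  rw [cardano_of_le hμ hb hα hs hs2, Complex.ofReal_im]

lemma radicand_of_ge (hμ : 0 < μ) (hb : 0 < b) (hs2 : eta μ b ε ≤ s ^ 2) :
    radicand μ b ε s = (-16 * alpha b ε ^ 3 + 54 * cc μ b ^ 2 * s ^ 2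
      + 6 * √3 * s * √(27 * cc μ b ^ 4 * s ^ 2 - 16 * alpha b ε ^ 3 * cc μ b ^ 2) : ℝ) := by
  have h := eta_mul (ε := ε) hμ hb
  have hx : 0 ≤ 27 * cc μ b ^ 4 * s ^ 2 - 16 * alpha b ε ^ 3 * cc μ b ^ 2 := by
    have : 27 * cc μ b ^ 4 * eta μ b ε ≤ 27 * cc μ b ^ 4 * s ^ 2 := by gcongr
    nlinarith [sq_nonneg (cc μ b)]
  unfold radicand
  rw [cpow_half_of_nonneg hx]
  push_cast; ring

/-- The real cube root `ψ` for `s² ≥ η`. -/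
noncomputable def psiReal (μ b ε s : ℝ) : ℝ :=
  (-16 * alpha b ε ^ 3 + 54 * cc μ b ^ 2 * s ^ 2
    + 6 * √3 * s * √(27 * cc μ b ^ 4 * s ^ 2 - 16 * alpha b ε ^ 3 * cc μ b ^ 2)) ^ (1 / 3 : ℝ)

lemma radicand_real_pos (hμ : 0 < μ) (hb : 0 < b) (hα : 0 < alpha b ε) (hs : 0 ≤ s)
    (hs2 : eta μ b ε ≤ s ^ 2) :
    0 < -16 * alpha b ε ^ 3 + 54 * cc μ b ^ 2 * s ^ 2
      + 6 * √3 * s * √(27 * cc μ b ^ 4 * s ^ 2 - 16 * alpha b ε ^ 3 * cc μ b ^ 2) := by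
  have h := eta_mul (ε := ε) hμ hb
  have h1 : 54 * cc μ b ^ 2 * eta μ b ε ≤ 54 * cc μ b ^ 2 * s ^ 2 := by gcongr
  have h2 : 0 ≤ 6 * √3 * s * √(27 * cc μ b ^ 4 * s ^ 2 - 16 * alpha b ε ^ 3 * cc μ b ^ 2) := by
    positivity
  have h3 := pow_pos hα 3
  linarith

lemma psi_of_ge (hμ : 0 < μ) (hb : 0 < b) (hα : 0 < alpha b ε) (hs : 0 ≤ s)
    (hs2 : eta μ b ε ≤ s ^ 2) : psi μ b ε s = psiReal μ b ε s := by
  rw [psi_eq, radicand_of_ge hμ hb hs2, psiReal,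
    Complex.ofReal_cpow (radicand_real_pos hμ hb hα hs hs2).le]
  norm_num

lemma psiReal_pos (hμ : 0 < μ) (hb : 0 < b) (hα : 0 < alpha b ε) (hs : 0 ≤ s)
    (hs2 : eta μ b ε ≤ s ^ 2) : 0 < psiReal μ b ε s :=
  Real.rpow_pos_of_pos (radicand_real_pos hμ hb hα hs hs2) _

/-- The first root for `s² ≥ η`, by radicals of positive reals. -/
noncomputable def firstRoot (μ b ε s : ℝ) : ℝ :=
  -alpha b ε / (3 * cc μ b) + psiReal μ b ε s / (3 * cbrtTwo ^ 4 * cc μ b)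
    + cbrtTwo ^ 4 * alpha b ε ^ 2 / (3 * cc μ b * psiReal μ b ε s)

lemma cardano_zero_of_ge (hμ : 0 < μ) (hb : 0 < b) (hα : 0 < alpha b ε) (hs : 0 ≤ s)
    (hs2 : eta μ b ε ≤ s ^ 2) : cardano μ b ε 0 s = firstRoot μ b ε s := by
  rw [cardano_zero_eq, cardanoA, cardanoB, psi_of_ge hμ hb hα hs hs2, firstRoot]
  push_cast; rfl

lemma cardano_zero_im (hμ : 0 < μ) (hb : 0 < b) (hα : 0 < alpha b ε) (hs : 0 ≤ s) :
    (cardano μ b ε 0 s).im = 0 := by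
  rcases le_total (s ^ 2) (eta μ b ε) with h | h
  · exact cardano_im_of_le hμ hb hα hs h 0
  · rw [cardano_zero_of_ge hμ hb hα hs h, Complex.ofReal_im]

/-- Nonpositive arguments `z` give `4 z² (c z + α) ≤ η`, with the maximum at `z = -2α/(3c)`. -/
lemma cubic_le_eta (hμ : 0 < μ) (hb : 0 < b) (hα : 0 < alpha b ε) {z : ℝ} (hz : z ≤ 0) :
    4 * z ^ 2 * (cc μ b * z + alpha b ε) ≤ eta μ b ε := by
  have hc := cc_pos hμ hb
  have h := eta_mul (ε := ε) hμ hb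
  rw [← mul_le_mul_iff_right₀ (show 0 < 27 * cc μ b ^ 2 by positivity), h]
  have h1 : 0 ≤ (3 * cc μ b * z + 2 * alpha b ε) ^ 2 * (alpha b ε - 3 * cc μ b * z) := by
    have : 0 ≤ cc μ b * -z := by nlinarith
    exact mul_nonneg (sq_nonneg _) (by nlinarith)
  nlinarith

/-- Nonnegativity of `A + B - α/(3c)`, where `A B = (α/(3c))²`, by the arithmetic–geometric mean
inequality. -/
lemma firstRoot_nonneg (hμ : 0 < μ) (hb : 0 < b) (hα : 0 < alpha b ε) (hs : 0 ≤ s)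
    (hs2 : eta μ b ε ≤ s ^ 2) : 0 ≤ firstRoot μ b ε s := by
  have hc := cc_pos hμ hb
  have hp := psiReal_pos hμ hb hα hs hs2
  have hr := cbrtTwo_pos
  have hA : 0 < psiReal μ b ε s / (3 * cbrtTwo ^ 4 * cc μ b) := by positivity
  have hB : 0 < cbrtTwo ^ 4 * alpha b ε ^ 2 / (3 * cc μ b * psiReal μ b ε s) := by positivity
  have hAB : psiReal μ b ε s / (3 * cbrtTwo ^ 4 * cc μ b)
      * (cbrtTwo ^ 4 * alpha b ε ^ 2 / (3 * cc μ b * psiReal μ b ε s))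
      = (alpha b ε / (3 * cc μ b)) ^ 2 := by
    field_simp
  have hk : 0 < alpha b ε / (3 * cc μ b) := by positivity
  unfold firstRoot
  generalize psiReal μ b ε s / (3 * cbrtTwo ^ 4 * cc μ b) = A at *
  generalize cbrtTwo ^ 4 * alpha b ε ^ 2 / (3 * cc μ b * psiReal μ b ε s) = B at *
  rw [neg_div]
  generalize alpha b ε / (3 * cc μ b) = k at *
  have : k ≤ A + B := abs_le_of_sq_le_sq' (by nlinarith) (by linarith) |>.2
  linarith

lemma cardano_zero_nonneg (hμ : 0 < μ) (hb : 0 < b) (hα : 0 < alpha b ε) (hs : 0 ≤ s) :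
    0 ≤ (cardano μ b ε 0 s).re := by
  rcases le_total (s ^ 2) (eta μ b ε) with h | h
  · rw [cardano_of_le hμ hb hα hs h, Complex.ofReal_re]
    have hc := cc_pos hμ hb
    have := (cardanoTrig_bounds (μ := μ) (b := b) (ε := ε) (s := s)).1
    exact mul_nonneg (by positivity) (by linarith)
  · rw [cardano_zero_of_ge hμ hb hα hs h, Complex.ofReal_re]
    exact firstRoot_nonneg hμ hb hα hs h

lemma cardano_one_mem (hμ : 0 < μ) (hb : 0 < b) (hα : 0 < alpha b ε) (hs : 0 ≤ s)
    (hs2 : s ^ 2 ≤ eta μ b ε) :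
    (cardano μ b ε 1 s).re ∈ Icc (-(2 * alpha b ε / (3 * cc μ b))) 0 := by
  have hc := cc_pos hμ hb
  obtain ⟨-, ⟨h1, h2⟩, -⟩ := cardanoTrig_bounds (μ := μ) (b := b) (ε := ε) (s := s)
  rw [cardano_of_le hμ hb hα hs hs2, Complex.ofReal_re, mul_div_assoc]
  have hk : 0 < alpha b ε / (3 * cc μ b) := by positivity
  constructor <;> nlinarith

lemma cardano_two_mem (hμ : 0 < μ) (hb : 0 < b) (hα : 0 < alpha b ε) (hs : 0 ≤ s)
    (hs2 : s ^ 2 ≤ eta μ b ε) :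
    (cardano μ b ε 2 s).re ∈ Icc (-(alpha b ε / cc μ b)) (-(2 * alpha b ε / (3 * cc μ b))) := by
  have hc := cc_pos hμ hb
  obtain ⟨-, -, h1, h2⟩ := cardanoTrig_bounds (μ := μ) (b := b) (ε := ε) (s := s)
  rw [cardano_of_le hμ hb hα hs hs2, Complex.ofReal_re, mul_div_assoc,
    show alpha b ε / cc μ b = 3 * (alpha b ε / (3 * cc μ b)) by field_simp]
  have hk : 0 < alpha b ε / (3 * cc μ b) := by positivity
  constructor <;> nlinarith

/-- Where `s² > η`, the second and third roots are not real. -/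
lemma le_eta_of_cardano_im (hμ : 0 < μ) (hb : 0 < b) (hα : 0 < alpha b ε) (hs : 0 ≤ s) {i : Fin 3}
    (hi : i ≠ 0) (him : (cardano μ b ε i s).im = 0) : s ^ 2 ≤ eta μ b ε := by
  by_contra! hlt
  have hc := cc_pos hμ hb
  have h1 := cardanoA_mul_cardanoB (s := s) hμ hb hα
  have h2 := cardanoA_cube_add (s := s) hμ hb hα
  have e1 := cardano_one_eq (s := s) hμ hb hα
  have e2 := cardano_two_eq (s := s) hμ hb hα
  obtain ⟨A, hA⟩ : ∃ A : ℝ, cardanoA μ b ε s = A :=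
    ⟨psiReal μ b ε s / (3 * cbrtTwo ^ 4 * cc μ b), by
      rw [cardanoA, psi_of_ge hμ hb hα hs hlt.le]; push_cast; rfl⟩
  obtain ⟨B, hB⟩ : ∃ B : ℝ, cardanoB μ b ε s = B :=
    ⟨cbrtTwo ^ 4 * alpha b ε ^ 2 / (3 * cc μ b * psiReal μ b ε s), by
      rw [cardanoB, psi_of_ge hμ hb hα hs hlt.le]; push_cast; rfl⟩
  rw [hA, hB] at h1 h2 e1 e2
  norm_cast at h1 h2
  have hkey : A = B := by
    have i1 : (cardano μ b ε 1 s).im = √3 / 2 * (B - A) := by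
      have : cardano μ b ε 1 s = ((-alpha b ε / (3 * cc μ b) - A / 2 - B / 2 : ℝ) : ℂ)
          + ((√3 / 2 * (B - A) : ℝ) : ℂ) * Complex.I := by
        rw [e1, omega_sq, omega]; push_cast; ring
      rw [this, Complex.add_im, Complex.ofReal_im, Complex.im_ofReal_mul, Complex.I_im]; ring
    have i2 : (cardano μ b ε 2 s).im = √3 / 2 * (A - B) := by
      have : cardano μ b ε 2 s = ((-alpha b ε / (3 * cc μ b) - A / 2 - B / 2 : ℝ) : ℂ)
          + ((√3 / 2 * (A - B) : ℝ) : ℂ) * Complex.I := by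
        rw [e2, omega_sq, omega]; push_cast; ring
      rw [this, Complex.add_im, Complex.ofReal_im, Complex.im_ofReal_mul, Complex.I_im]; ring
    have h3 : √(3 : ℝ) / 2 ≠ 0 := by positivity
    fin_cases i
    · exact absurd rfl hi
    · simp only [Fin.mk_one, i1] at him
      linarith [(mul_eq_zero.1 him).resolve_left h3]
    · simp only [Fin.reduceFinMk, i2] at him
      linarith [(mul_eq_zero.1 him).resolve_left h3]
  subst hkey
  -- A double root: `A = B` forces `A = ± α/(3c)`, hence `s² ≤ η`.
  have hη := eta_mul (ε := ε) hμ hb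
  have hk : 0 < alpha b ε / (3 * cc μ b) := by positivity
  have hs4 : s ^ 2 = 4 * cc μ b * (2 * A ^ 3 + 2 * (alpha b ε / (3 * cc μ b)) ^ 3) := by
    field_simp at h2 ⊢
    linarith
  have hη' : eta μ b ε = 16 * cc μ b * (alpha b ε / (3 * cc μ b)) ^ 3 := by
    unfold eta; field_simp; ring
  have h1' : A * A = (alpha b ε / (3 * cc μ b)) ^ 2 := by rw [h1]; field_simp; ring
  generalize alpha b ε / (3 * cc μ b) = k at *
  have hAk : A ≤ k := abs_le_of_sq_le_sq' (by nlinarith) hk.le |>.2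
  have hAk3 : A ^ 3 ≤ k ^ 3 := by
    have : A ^ 3 = A * k ^ 2 := by rw [← h1']; ring
    rw [this, pow_succ' k 2]
    exact mul_le_mul_of_nonneg_right hAk (sq_nonneg k)
  have : 4 * cc μ b * (2 * A ^ 3 + 2 * k ^ 3) ≤ 4 * cc μ b * (2 * k ^ 3 + 2 * k ^ 3) := by gcongr
  linarith

lemma continuous_cardanoAngle : Continuous (cardanoAngle μ b ε) := by
  unfold cardanoAngle
  fun_prop

lemma continuous_cardanoTrig (i : Fin 3) : Continuous (cardanoTrig i) := by
  unfold cardanoTrig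
  fin_cases i <;> simp <;> fun_prop

lemma continuousOn_cardano_of_le (hμ : 0 < μ) (hb : 0 < b) (hα : 0 < alpha b ε) (i : Fin 3) :
    ContinuousOn (fun s => (cardano μ b ε i s).re) {s | 0 ≤ s ∧ s ^ 2 ≤ eta μ b ε} := by
  have : Continuous fun s =>
      alpha b ε / (3 * cc μ b) * (cardanoTrig i (cardanoAngle μ b ε s) - 1) :=
    (((continuous_cardanoTrig i).comp continuous_cardanoAngle).sub continuous_const).const_mul _
  refine this.continuousOn.congr fun s hs => ?_
  rw [cardano_of_le hμ hb hα hs.1 hs.2, Complex.ofReal_re]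

lemma continuousOn_cardano_zero (hμ : 0 < μ) (hb : 0 < b) (hα : 0 < alpha b ε) :
    ContinuousOn (fun s => (cardano μ b ε 0 s).re) (Ici 0) := by
  have hc := cc_pos hμ hb
  have h1 : ContinuousOn (fun s => (cardano μ b ε 0 s).re) {s | 0 ≤ s ∧ eta μ b ε ≤ s ^ 2} := by
    have hpsi : ContinuousOn (psiReal μ b ε) {s | 0 ≤ s ∧ eta μ b ε ≤ s ^ 2} := by
      unfold psiReal
      refine ContinuousOn.rpow_const (by fun_prop) fun s hs => Or.inl ?_
      exact (radicand_real_pos hμ hb hα hs.1 hs.2).ne'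
    have : ContinuousOn (firstRoot μ b ε) {s | 0 ≤ s ∧ eta μ b ε ≤ s ^ 2} := by
      unfold firstRoot
      refine (continuousOn_const.add (hpsi.div_const _)).add
        (continuousOn_const.div (continuousOn_const.mul hpsi) fun s hs => ?_)
      have := psiReal_pos hμ hb hα hs.1 hs.2
      positivity
    refine this.congr fun s hs => ?_
    rw [cardano_zero_of_ge hμ hb hα hs.1 hs.2, Complex.ofReal_re]
  have hcl1 : IsClosed {s : ℝ | 0 ≤ s ∧ s ^ 2 ≤ eta μ b ε} :=
    (isClosed_le continuous_const continuous_id).inter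
      (isClosed_le (continuous_pow 2) continuous_const)
  have hcl2 : IsClosed {s : ℝ | 0 ≤ s ∧ eta μ b ε ≤ s ^ 2} :=
    (isClosed_le continuous_const continuous_id).inter
      (isClosed_le continuous_const (continuous_pow 2))
  refine ((continuousOn_cardano_of_le hμ hb hα 0).union_of_isClosed h1 hcl1 hcl2).mono ?_
  intro s hs
  rcases le_total (s ^ 2) (eta μ b ε) with h | h
  · exact Or.inl ⟨hs, h⟩
  · exact Or.inr ⟨hs, h⟩

lemma contDiffAt_cardano_zero (hμ : 0 < μ) (hb : 0 < b) (hα : 0 < alpha b ε) (hs : 0 < s)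
    (hs2 : eta μ b ε < s ^ 2) : ContDiffAt ℝ ∞ (fun s => (cardano μ b ε 0 s).re) s := by
  have hc := cc_pos hμ hb
  have hη := eta_mul (ε := ε) hμ hb
  have hx : 0 < 27 * cc μ b ^ 4 * s ^ 2 - 16 * alpha b ε ^ 3 * cc μ b ^ 2 := by
    have : 27 * cc μ b ^ 4 * eta μ b ε < 27 * cc μ b ^ 4 * s ^ 2 := by gcongr
    nlinarith [sq_nonneg (cc μ b)]
  have hpsi : ContDiffAt ℝ ∞ (psiReal μ b ε) s := by
    unfold psiReal
    refine ContDiffAt.rpow_const_of_ne ?_ (radicand_real_pos hμ hb hα hs.le hs2.le).ne'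
    refine ContDiffAt.add (by fun_prop) (ContDiffAt.mul (by fun_prop) (ContDiffAt.sqrt ?_ hx.ne'))
    fun_prop
  have hp := psiReal_pos hμ hb hα hs.le hs2.le
  have : ContDiffAt ℝ ∞ (firstRoot μ b ε) s := by
    unfold firstRoot
    refine (contDiffAt_const.add (hpsi.div_const _)).add
      (contDiffAt_const.div (contDiffAt_const.mul hpsi) ?_)
    positivity
  refine this.congr_of_eventuallyEq ?_
  have h1 : ∀ᶠ r : ℝ in nhds s, 0 < r := lt_mem_nhds hs
  have h2 : ∀ᶠ r : ℝ in nhds s, eta μ b ε < r ^ 2 :=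
    (continuous_pow 2).continuousAt.eventually (lt_mem_nhds hs2)
  filter_upwards [h1, h2] with r hr1 hr2
  rw [cardano_zero_of_ge hμ hb hα hr1.le hr2.le, Complex.ofReal_re]

lemma measurable_cardano (i : Fin 3) : Measurable fun s => (cardano μ b ε i s).re := by
  have hψ : Measurable fun s => psi μ b ε s := by
    unfold psi
    fun_prop
  apply Complex.measurable_re.comp
  unfold cardano
  fin_cases i <;> simp <;> fun_prop

end Cubic

/-! ### Cutoff functions near a boundary of finite surface measure -/

section Cutoff

variable {d : ℕ}

open Metric in
/-- A compact set of finite `(d-1)`-dimensional Hausdorff measure has finite coverings by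
arbitrarily small balls with `∑ rᵢ^{d-1}` bounded by a fixed constant. -/
lemma exists_ball_covering (hd : 1 ≤ d) {K : Set (Pt d)} (hK : IsCompact K)
    (hfin : surface d K < ⊤) :
    ∃ C : ℝ, 0 ≤ C ∧ ∀ δ > 0, ∃ (I : Finset ℕ) (c : ℕ → Pt d) (r : ℕ → ℝ),
      (∀ i ∈ I, 0 < r i ∧ r i < δ ∧ c i ∈ K) ∧ K ⊆ ⋃ i ∈ I, ball (c i) (2 * r i) ∧
        ∑ i ∈ I, r i ^ (d - 1) ≤ C := by
  set M : ENNReal := surface d K + 1 + 1 with hM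
  have hMtop : M < ⊤ := by
    simp only [hM, ENNReal.add_lt_top]; exact ⟨⟨hfin, ENNReal.one_lt_top⟩, ENNReal.one_lt_top⟩
  refine ⟨M.toReal, ENNReal.toReal_nonneg, fun δ hδ => ?_⟩
  have h1 : (⨅ (t : ℕ → Set (Pt d)) (_ : K ⊆ ⋃ n, t n)
      (_ : ∀ n, ediam (t n) ≤ ENNReal.ofReal (δ / 2)),
      ∑' n, ⨆ _ : (t n).Nonempty, ediam (t n) ^ ((d : ℝ) - 1)) < surface d K + 1 := by
    refine lt_of_le_of_lt ?_ (ENNReal.lt_add_right hfin.ne one_ne_zero)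
    rw [surface, Measure.hausdorffMeasure_apply]
    exact le_iSup₂_of_le (ENNReal.ofReal (δ / 2)) (by simpa using hδ) le_rfl
  simp only [iInf_lt_iff] at h1
  obtain ⟨t, hcov, hdiam, hsum⟩ := h1
  -- Covering sets may have diameter zero, and `0 ^ 0 = 1` when `d = 1`; each is put into a ball of a
  -- slightly larger positive radius, at a total cost of at most one.
  obtain ⟨e, he, hesum⟩ := ENNReal.exists_pos_sum_of_countable (one_ne_zero (α := ENNReal)) ℕ
  have hex : ∀ n, ∃ (x : Pt d) (r : ℝ), (t n ∩ K).Nonempty → (x ∈ t n ∩ K ∧ 0 < r ∧ r < δ ∧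
      t n ⊆ ball x (2 * r) ∧ ENNReal.ofReal (r ^ (d - 1)) ≤
        (⨆ _ : (t n).Nonempty, ediam (t n) ^ ((d : ℝ) - 1)) + e n) := by
    intro n
    by_cases hn : (t n ∩ K).Nonempty
    swap
    · exact ⟨0, 0, fun h => absurd h hn⟩
    obtain ⟨x, hx⟩ := hn
    have hDt : ediam (t n) ≠ ⊤ := ((hdiam n).trans_lt ENNReal.ofReal_lt_top).ne
    set D := (ediam (t n)).toReal with hD
    have hD0 : 0 ≤ D := ENNReal.toReal_nonneg
    have hDδ : D < δ := by
      have := ENNReal.toReal_mono ENNReal.ofReal_ne_top (hdiam n)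
      rw [ENNReal.toReal_ofReal (by positivity)] at this
      linarith
    have hcont : ∀ᶠ r in nhds D, r ^ (d - 1) < D ^ (d - 1) + e n :=
      (continuous_pow (d - 1)).continuousAt.eventually
        (gt_mem_nhds (by have := he n; simpa using this))
    obtain ⟨r, ⟨hr1, hr2⟩, hr3⟩ :=
      (((hcont.and (gt_mem_nhds hDδ)).filter_mono nhdsWithin_le_nhds).and
        (self_mem_nhdsWithin (s := Ioi D))).exists
    have hr3 : D < r := hr3
    have hr0 : 0 < r := hD0.trans_lt hr3
    refine ⟨x, r, fun _ => ⟨hx, hr0, hr2, fun y hy => ?_, ?_⟩⟩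
    · have h2 := edist_le_ediam_of_mem hy hx.1
      rw [mem_ball, dist_edist]
      have := ENNReal.toReal_mono hDt h2
      linarith
    · rw [iSup_pos ⟨x, hx.1⟩]
      have e1 : ediam (t n) = ENNReal.ofReal D := (ENNReal.ofReal_toReal hDt).symm
      have e2 : ((d : ℝ) - 1) = ((d - 1 : ℕ) : ℝ) := by push_cast [hd]; ring
      rw [e2, ENNReal.rpow_natCast, e1, ← ENNReal.ofReal_pow hD0, ← ENNReal.ofReal_coe_nnreal,
        ← ENNReal.ofReal_add (by positivity) (e n).coe_nonneg]
      exact ENNReal.ofReal_le_ofReal hr1.le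
  choose c r hcr using hex
  obtain ⟨I, hI⟩ := hK.elim_finite_subcover
    (fun n : {n // (t n ∩ K).Nonempty} => ball (c n) (2 * r n)) (fun _ => isOpen_ball) (by
      intro y hy
      obtain ⟨n, hn⟩ := mem_iUnion.1 (hcov hy)
      exact mem_iUnion.2 ⟨⟨n, y, hn, hy⟩, (hcr n ⟨y, hn, hy⟩).2.2.2.1 hn⟩)
  refine ⟨I.map (Function.Embedding.subtype _), c, r, ?_, ?_, ?_⟩
  · intro i hi
    simp only [Finset.mem_map, Function.Embedding.subtype_apply] at hi
    obtain ⟨j, -, rfl⟩ := hi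
    have := hcr j j.2
    exact ⟨this.2.1, this.2.2.1, this.1.2⟩
  · intro y hy
    obtain ⟨j, hj, hyj⟩ := mem_iUnion₂.1 (hI hy)
    exact mem_iUnion₂.2 ⟨j, Finset.mem_map_of_mem (Function.Embedding.subtype _) hj, hyj⟩
  · rw [← ENNReal.ofReal_le_ofReal_iff ENNReal.toReal_nonneg, ENNReal.ofReal_toReal hMtop.ne,
      ENNReal.ofReal_sum_of_nonneg]
    · calc ∑ i ∈ I.map (Function.Embedding.subtype _), ENNReal.ofReal (r i ^ (d - 1))
          ≤ ∑ i ∈ I.map (Function.Embedding.subtype _),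
            ((⨆ _ : (t i).Nonempty, ediam (t i) ^ ((d : ℝ) - 1)) + e i) := by
            refine Finset.sum_le_sum fun i hi => ?_
            simp only [Finset.mem_map, Function.Embedding.subtype_apply] at hi
            obtain ⟨j, -, rfl⟩ := hi
            exact (hcr j j.2).2.2.2.2
        _ ≤ ∑' i, ((⨆ _ : (t i).Nonempty, ediam (t i) ^ ((d : ℝ) - 1)) + e i) :=
            ENNReal.sum_le_tsum _
        _ = (∑' i, ⨆ _ : (t i).Nonempty, ediam (t i) ^ ((d : ℝ) - 1)) + ∑' i, (e i : ENNReal) :=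
            ENNReal.tsum_add
        _ ≤ M := add_le_add hsum.le hesum.le
    · intro i hi
      simp only [Finset.mem_map, Function.Embedding.subtype_apply] at hi
      obtain ⟨j, -, rfl⟩ := hi
      exact pow_nonneg (hcr j j.2).2.1.le _

lemma norm_gradient (f : Pt d → ℝ) (x : Pt d) : ‖gradient f x‖ = ‖fderiv ℝ f x‖ := by
  unfold gradient
  exact LinearIsometryEquiv.norm_map _ _

/-- The standard bump function, equal to one on the ball of radius `2` and supported in that of
radius `3`. -/
noncomputable def stdBump (d : ℕ) : ContDiffBump (0 : Pt d) := ⟨2, 3, by norm_num, by norm_num⟩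

/-- The function `1 - bump((x - c)/r)`, which vanishes on the ball of radius `2r` about `c`. -/
noncomputable def hole (c : Pt d) (r : ℝ) (x : Pt d) : ℝ := 1 - stdBump d (r⁻¹ • (x - c))

lemma hole_contDiff (c : Pt d) (r : ℝ) : ContDiff ℝ ∞ (hole c r) := by
  unfold hole
  exact contDiff_const.sub ((stdBump d).contDiff.comp (by fun_prop))

lemma hole_mem (c : Pt d) (r : ℝ) (x : Pt d) : 0 ≤ hole c r x ∧ hole c r x ≤ 1 := by
  have h1 := (stdBump d).nonneg (x := r⁻¹ • (x - c))
  have h2 := (stdBump d).le_one (x := r⁻¹ • (x - c))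
  unfold hole
  constructor <;> linarith

lemma hole_eq_zero {c : Pt d} {r : ℝ} (hr : 0 < r) {x : Pt d} (hx : x ∈ Metric.ball c (2 * r)) :
    hole c r x = 0 := by
  unfold hole
  rw [(stdBump d).one_of_mem_closedBall, sub_self]
  rw [mem_closedBall_zero_iff, norm_smul, norm_inv, Real.norm_of_nonneg hr.le,
    inv_mul_le_iff₀ hr, ← dist_eq_norm]
  have := (Metric.mem_ball.1 hx).le
  change dist x c ≤ r * 2
  linarith

lemma hole_eq_one {c : Pt d} {r : ℝ} (hr : 0 < r) {x : Pt d} (hx : 3 * r ≤ dist x c) :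
    hole c r x = 1 := by
  unfold hole
  rw [(stdBump d).zero_of_le_dist, sub_zero]
  rw [dist_zero_right, norm_smul, norm_inv, Real.norm_of_nonneg hr.le,
    le_inv_mul_iff₀ hr, ← dist_eq_norm]
  change r * 3 ≤ dist x c
  linarith

/-- By scaling, the gradient of `hole c r` is of order `1 / r`, on a set of measure of order `r ^ d`. -/
lemma exists_hole_fderiv_bound (d : ℕ) : ∃ L : ℝ, 0 ≤ L ∧ ∀ (c : Pt d) (r : ℝ), 0 < r →
    ∀ x, ‖fderiv ℝ (hole c r) x‖ ≤ (Metric.closedBall c (3 * r)).indicator (fun _ => L / r) x := by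
  have hcs : HasCompactSupport (fderiv ℝ (stdBump d)) :=
    (stdBump d).hasCompactSupport.fderiv ℝ
  have hcont : Continuous (fderiv ℝ (stdBump d)) :=
    ((stdBump d).contDiff (n := 1)).continuous_fderiv (by norm_num)
  obtain ⟨L, hL⟩ := hcs.exists_bound_of_continuous hcont
  have hL0 : 0 ≤ L := (norm_nonneg _).trans (hL 0)
  refine ⟨L, hL0, fun c r hr x => ?_⟩
  by_cases hx : x ∈ Metric.closedBall c (3 * r)
  · rw [indicator_of_mem hx]
    have h1 : HasFDerivAt (fun x : Pt d => r⁻¹ • (x - c)) (r⁻¹ • ContinuousLinearMap.id ℝ (Pt d))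
        x := ((hasFDerivAt_id x).sub_const c).const_smul r⁻¹
    have h2 : HasFDerivAt (stdBump d) (fderiv ℝ (stdBump d) (r⁻¹ • (x - c))) (r⁻¹ • (x - c)) :=
      (((stdBump d).contDiff (n := 1)).differentiable (by norm_num) _).hasFDerivAt
    have h3 : HasFDerivAt (hole c r) _ x := (h2.comp x h1).const_sub 1
    rw [h3.fderiv, norm_neg, ContinuousLinearMap.comp_smul, ContinuousLinearMap.comp_id, norm_smul,
      norm_inv, Real.norm_of_nonneg hr.le, div_eq_inv_mul]
    exact mul_le_mul_of_nonneg_left (hL _) (by positivity)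
  · rw [indicator_of_notMem hx]
    have : hole c r =ᶠ[nhds x] fun _ => 1 := by
      filter_upwards [Metric.isClosed_closedBall.isOpen_compl.mem_nhds hx] with y hy
      apply hole_eq_one hr
      rw [mem_compl_iff, Metric.mem_closedBall, not_le] at hy
      exact hy.le
    rw [this.fderiv_eq]
    simp

/-- The gradients of a product of functions with values in `[0, 1]` add up, whatever the number of
factors. -/
lemma norm_fderiv_prod_le {ι : Type*} (I : Finset ι) (f : ι → Pt d → ℝ)
    (hf : ∀ i, ContDiff ℝ ∞ (f i)) (h01 : ∀ i x, 0 ≤ f i x ∧ f i x ≤ 1) (x : Pt d) :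
    ‖fderiv ℝ (fun x => ∏ i ∈ I, f i x) x‖ ≤ ∑ i ∈ I, ‖fderiv ℝ (f i) x‖ := by
  classical
  rw [fderiv_finsetProd fun i _ => ((hf i).differentiable (by norm_num)).differentiableAt]
  refine (norm_sum_le _ _).trans (Finset.sum_le_sum fun i _ => ?_)
  rw [norm_smul, Real.norm_of_nonneg (Finset.prod_nonneg fun j _ => (h01 j x).1)]
  exact mul_le_of_le_one_left (norm_nonneg _)
    (Finset.prod_le_one (fun j _ => (h01 j x).1) fun j _ => (h01 j x).2)

/-- Cutoff functions: test functions on `Ω` which equal one away from `∂Ω` and whose gradients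
are bounded in `L¹`, because `∂Ω` has finite surface measure. -/
lemma exists_cutoff (hd : 1 ≤ d) {Ω : Set (Pt d)} (hΩ : IsOpen Ω) (hb : Bornology.IsBounded Ω)
    (hfin : surface d (frontier Ω) < ⊤) :
    ∃ C : ℝ, 0 ≤ C ∧ ∀ δ > 0, ∃ φ : Pt d → ℝ, IsTest Ω φ ∧ (∀ x, 0 ≤ φ x ∧ φ x ≤ 1) ∧
      (∀ x ∈ Ω, (∀ y ∈ frontier Ω, δ ≤ dist x y) → φ x = 1) ∧
      ∫ x in Ω, ‖gradient φ x‖ ≤ C := by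
  have hcl : IsCompact (closure Ω) := hb.isCompact_closure
  have hK : IsCompact (frontier Ω) :=
    hcl.of_isClosed_subset isClosed_frontier frontier_subset_closure
  obtain ⟨C, hC, hcover⟩ := exists_ball_covering hd hK hfin
  obtain ⟨L, hL, hhole⟩ := exists_hole_fderiv_bound d
  set V : ℝ := volume.real (Metric.ball (0 : Pt d) 1)
  have hV : 0 ≤ V := measureReal_nonneg
  refine ⟨L * 3 ^ d * V * C, by positivity, fun δ hδ => ?_⟩
  obtain ⟨I, c, r, hr, hcov, hsum⟩ := hcover (δ / 3) (by positivity)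
  set χ : Pt d → ℝ := fun x => ∏ i ∈ I, hole (c i) (r i) x with hχ
  have hχs : ContDiff ℝ ∞ χ := contDiff_prod fun i _ => hole_contDiff _ _
  set U : Set (Pt d) := ⋃ i ∈ I, Metric.ball (c i) (2 * r i) with hU
  have hUo : IsOpen U := isOpen_biUnion fun _ _ => Metric.isOpen_ball
  have hχ0 : ∀ x ∈ U, χ x = 0 := by
    intro x hx
    obtain ⟨i, hi, hxi⟩ := mem_iUnion₂.1 hx
    exact Finset.prod_eq_zero hi (hole_eq_zero (hr i hi).1 hxi)
  have hin : ∀ x ∈ Ω, Ω.indicator χ =ᶠ[nhds x] χ := fun x hx => by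
    filter_upwards [hΩ.mem_nhds hx] with y hy using indicator_of_mem hy _
  have hout : ∀ x ∉ closure Ω, Ω.indicator χ =ᶠ[nhds x] fun _ => 0 := fun x hx => by
    filter_upwards [isClosed_closure.isOpen_compl.mem_nhds hx] with y hy
    exact indicator_of_notMem (fun h => hy (subset_closure h)) _
  have hsub : closure Ω \ U ⊆ Ω := by
    rintro x ⟨hx, hxU⟩
    by_contra hxΩ
    exact hxU (hcov ⟨hx, fun h => hxΩ (interior_subset h)⟩)
  have hts : tsupport (Ω.indicator χ) ⊆ closure Ω \ U := by
    refine closure_minimal ?_ (isClosed_closure.sdiff hUo)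
    intro x hx
    have hxΩ : x ∈ Ω := by
      by_contra h; exact hx (indicator_of_notMem h _)
    refine ⟨subset_closure hxΩ, fun hxU => hx ?_⟩
    rw [indicator_of_mem hxΩ, hχ0 x hxU]
  refine ⟨Ω.indicator χ, ⟨?_, ?_, hts.trans hsub⟩, ?_, ?_, ?_⟩
  · rw [contDiff_iff_contDiffAt]
    intro x
    by_cases hx : x ∈ Ω
    · exact hχs.contDiffAt.congr_of_eventuallyEq (hin x hx)
    by_cases hx' : x ∈ closure Ω
    · have hxU : x ∈ U := hcov ⟨hx', fun h => hx (interior_subset h)⟩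
      refine (contDiffAt_const (c := (0 : ℝ))).congr_of_eventuallyEq ?_
      filter_upwards [hUo.mem_nhds hxU] with y hy
      by_cases hyΩ : y ∈ Ω
      · rw [indicator_of_mem hyΩ, hχ0 y hy]
      · rw [indicator_of_notMem hyΩ]
    · exact contDiffAt_const.congr_of_eventuallyEq (hout x hx')
  · exact (hcl.diff hUo).of_isClosed_subset (isClosed_tsupport _) hts
  · intro x
    have h0 : 0 ≤ χ x := Finset.prod_nonneg fun j _ => (hole_mem _ _ x).1
    have h1 : χ x ≤ 1 := Finset.prod_le_one (fun j _ => (hole_mem _ _ x).1) fun j _ =>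
      (hole_mem _ _ x).2
    by_cases hx : x ∈ Ω
    · rw [indicator_of_mem hx]; exact ⟨h0, h1⟩
    · rw [indicator_of_notMem hx]; norm_num
  · intro x hx hdist
    rw [indicator_of_mem hx]
    refine Finset.prod_eq_one fun i hi => hole_eq_one (hr i hi).1 ?_
    have := hdist (c i) (hr i hi).2.2
    linarith [(hr i hi).2.1]
  · have hint : ∀ i, Integrable
        ((Metric.closedBall (c i) (3 * r i)).indicator (fun _ => L / r i)) volume := fun i =>
      (integrable_indicator_iff measurableSet_closedBall).2
        (integrableOn_const (isCompact_closedBall _ _).measure_lt_top.ne)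
    have hbound : ∀ x ∈ Ω, ‖gradient (Ω.indicator χ) x‖ ≤
        ∑ i ∈ I, (Metric.closedBall (c i) (3 * r i)).indicator (fun _ => L / r i) x := by
      intro x hx
      rw [norm_gradient, (hin x hx).fderiv_eq]
      refine (norm_fderiv_prod_le I _ (fun i => hole_contDiff _ _)
        (fun i x => hole_mem _ _ x) x).trans (Finset.sum_le_sum fun i hi => ?_)
      exact hhole _ _ (hr i hi).1 x
    calc ∫ x in Ω, ‖gradient (Ω.indicator χ) x‖
        ≤ ∫ x in Ω, ∑ i ∈ I,
          (Metric.closedBall (c i) (3 * r i)).indicator (fun _ => L / r i) x := by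
          refine integral_mono_of_nonneg (ae_of_all _ fun _ => norm_nonneg _)
            (integrable_finsetSum _ fun i _ => (hint i).restrict) ?_
          exact ae_restrict_of_forall_mem hΩ.measurableSet hbound
      _ ≤ ∫ x, ∑ i ∈ I, (Metric.closedBall (c i) (3 * r i)).indicator (fun _ => L / r i) x := by
          refine setIntegral_le_integral (integrable_finsetSum _ fun i _ => hint i)
            (ae_of_all _ fun x => Finset.sum_nonneg fun i hi => indicator_nonneg (fun _ _ => ?_) _)
          have := (hr i hi).1
          positivity
      _ = ∑ i ∈ I, L * 3 ^ d * V * r i ^ (d - 1) := by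
          rw [integral_finsetSum _ fun i _ => hint i]
          refine Finset.sum_congr rfl fun i hi => ?_
          have hri := (hr i hi).1
          rw [integral_indicator_const _ measurableSet_closedBall, Measure.real,
            Measure.addHaar_closedBall _ _ (by positivity), finrank_euclideanSpace_fin,
            ENNReal.toReal_mul, ENNReal.toReal_ofReal (by positivity), smul_eq_mul, mul_pow]
          obtain ⟨k, rfl⟩ : ∃ k, d = k + 1 := ⟨d - 1, by omega⟩
          rw [Nat.add_sub_cancel, pow_succ (r i)]
          change 3 ^ (k + 1) * (r i ^ k * r i) * V * (L / r i) = _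
          field_simp
      _ = L * 3 ^ d * V * ∑ i ∈ I, r i ^ (d - 1) := by rw [Finset.mul_sum]
      _ ≤ L * 3 ^ d * V * C := by gcongr

end Cutoff

/-! ### Weak gradients and mollification -/

section Weak

variable {d : ℕ} {Ω : Set (Pt d)}

/-- Tietze's extension theorem for functions continuous on a closed set. -/
lemma exists_continuous_extension {Y : Type*} [TopologicalSpace Y] [TietzeExtension.{0} Y]
    {S : Set (Pt d)} (hS : IsClosed S) {f : Pt d → Y} (hf : ContinuousOn f S) :
    ∃ F : Pt d → Y, Continuous F ∧ EqOn F f S := by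
  obtain ⟨g, hg⟩ := ContinuousMap.exists_restrict_eq hS ⟨S.domRestrict f, hf.domRestrict⟩
  exact ⟨g, g.continuous, fun x hx => congrArg (fun h => h ⟨x, hx⟩) hg⟩

lemma IsTest.contDiff {φ : Pt d → ℝ} (h : IsTest Ω φ) : ContDiff ℝ ∞ φ := h.1

lemma IsTest.hasCompactSupport {φ : Pt d → ℝ} (h : IsTest Ω φ) : HasCompactSupport φ := h.2.1

lemma IsTest.mul {φ ψ : Pt d → ℝ} (h : IsTest Ω φ) (hψ : ContDiff ℝ ∞ ψ) :
    IsTest Ω (fun x => φ x * ψ x) :=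
  ⟨h.1.mul hψ, h.2.1.mul_right, (tsupport_mul_subset_left (f := φ) (g := ψ)).trans h.2.2⟩

lemma IsTest.eq_zero {φ : Pt d → ℝ} (h : IsTest Ω φ) {x : Pt d} (hx : x ∉ Ω) : φ x = 0 :=
  image_eq_zero_of_notMem_tsupport fun h' => hx (h.2.2 h')

lemma IsTest.fderiv_eq_zero {φ : Pt d → ℝ} (h : IsTest Ω φ) {x : Pt d} (hx : x ∉ Ω) :
    fderiv ℝ φ x = 0 :=
  image_eq_zero_of_notMem_tsupport fun h' => hx (h.2.2 (tsupport_fderiv_subset ℝ h'))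

lemma IsTest.continuous_fderiv {φ : Pt d → ℝ} (h : IsTest Ω φ) : Continuous (fderiv ℝ φ) :=
  h.1.continuous_fderiv (by norm_num)

lemma IsTest.continuous_gradient {φ : Pt d → ℝ} (h : IsTest Ω φ) : Continuous (gradient φ) :=
  (LinearIsometryEquiv.continuous _).comp h.continuous_fderiv

lemma IsTest.hasCompactSupport_gradient {φ : Pt d → ℝ} (h : IsTest Ω φ) :
    HasCompactSupport (gradient φ) :=
  (h.2.1.fderiv ℝ).comp_left (map_zero _)

/-- The product of a test function with a locally integrable function is integrable. -/
lemma IsTest.integrable_smul {E : Type*} [NormedAddCommGroup E] [NormedSpace ℝ E]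
    {φ : Pt d → ℝ} (h : IsTest Ω φ) {g : Pt d → E} (hg : LocallyIntegrableOn g Ω) :
    Integrable (fun x => φ x • g x) := by
  have h1 : IntegrableOn g (tsupport φ) := hg.integrableOn_compact_subset h.2.2 h.2.1
  obtain ⟨C, hC⟩ := h.2.1.exists_bound_of_continuous h.1.continuous
  have h2 : IntegrableOn (fun x => φ x • g x) (tsupport φ) :=
    h1.bdd_smul C h.1.continuous.aestronglyMeasurable (ae_of_all _ hC)
  rw [integrableOn_iff_integrable_of_support_subset] at h2
  · exact h2
  · intro x hx
    by_contra hx'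
    exact hx (by simp [image_eq_zero_of_notMem_tsupport hx'])

lemma integrable_on_of_continuousOn_closure {E : Type*} [NormedAddCommGroup E]
    (hΩb : Bornology.IsBounded Ω) {f : Pt d → E} (hf : ContinuousOn f (closure Ω)) :
    IntegrableOn f Ω :=
  (hf.integrableOn_compact hΩb.isCompact_closure).mono_set subset_closure

/-- The weak gradient, tested componentwise. -/
lemma HasWeakGradient.component (hΩb : Bornology.IsBounded Ω) {v : Pt d → ℝ} {g : Pt d → Pt d}
    (hv : ContinuousOn v (closure Ω)) (h : HasWeakGradient Ω v g) {φ : Pt d → ℝ}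
    (hφ : IsTest Ω φ) (i : Fin d) :
    ∫ x in Ω, v x * fderiv ℝ φ x (EuclideanSpace.single i 1) = -∫ x in Ω, φ x * g x i := by
  have h1 := congrArg (fun w : Pt d => EuclideanSpace.proj (𝕜 := ℝ) i w) (h.2 φ hφ)
  have i1 : IntegrableOn (fun x => v x • gradient φ x) Ω :=
    integrable_on_of_continuousOn_closure hΩb (hv.smul hφ.continuous_gradient.continuousOn)
  have i2 : IntegrableOn (fun x => φ x • g x) Ω := (hφ.integrable_smul h.1).integrableOn
  rw [map_neg, ← ContinuousLinearMap.integral_comp_comm _ i1,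
    ← ContinuousLinearMap.integral_comp_comm _ i2] at h1
  refine Eq.trans ?_ h1
  congr 1
  ext x
  rw [map_smul, smul_eq_mul, ← inner_gradient_left, EuclideanSpace.inner_single_right]
  simp

/-- Pairing a weak gradient with a smooth vector field. -/
lemma HasWeakGradient.integral_divergence (hΩb : Bornology.IsBounded Ω) {v : Pt d → ℝ}
    {g : Pt d → Pt d} (hv : ContinuousOn v (closure Ω)) (h : HasWeakGradient Ω v g)
    {φ : Pt d → ℝ} (hφ : IsTest Ω φ) {F : Pt d → Pt d} (hF : ContDiff ℝ ∞ F) :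
    ∫ x in Ω, v x * (inner ℝ (F x) (gradient φ x) + φ x * divergence F x) =
      -∫ x in Ω, φ x * inner ℝ (F x) (g x) := by
  have hFi : ∀ i, ContDiff ℝ ∞ (fun x => F x i) := fun i =>
    (EuclideanSpace.proj (𝕜 := ℝ) i).contDiff.comp hF
  have hdF : Continuous (fderiv ℝ F) := hF.continuous_fderiv (by norm_num)
  have hψ : ∀ i, IsTest Ω (fun x => φ x * F x i) := fun i => hφ.mul (hFi i)
  have h1 := fun i => h.component hΩb hv (hψ i) i
  have h2 : ∀ i x, fderiv ℝ (fun x => φ x * F x i) x (EuclideanSpace.single i 1) =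
      F x i * (gradient φ x) i + φ x * (fderiv ℝ F x (EuclideanSpace.single i 1)) i := by
    intro i x
    have e1 : HasFDerivAt F (fderiv ℝ F x) x := (hF.differentiable (by norm_num) x).hasFDerivAt
    have e2 : HasFDerivAt (fun x => F x i)
        ((EuclideanSpace.proj (𝕜 := ℝ) i).comp (fderiv ℝ F x)) x :=
      (EuclideanSpace.proj (𝕜 := ℝ) i).hasFDerivAt.comp x e1
    have e3 : HasFDerivAt φ (fderiv ℝ φ x) x :=
      (hφ.1.differentiable (by norm_num) x).hasFDerivAt
    have e4 : (gradient φ x) i = fderiv ℝ φ x (EuclideanSpace.single i 1) := by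
      rw [← inner_gradient_left, EuclideanSpace.inner_single_right]; simp
    have e5 : HasFDerivAt (fun x => φ x * F x i) _ x := e3.mul e2
    rw [e5.fderiv, e4]
    change φ x * (fderiv ℝ F x (EuclideanSpace.single i 1)) i
      + F x i * fderiv ℝ φ x (EuclideanSpace.single i 1) = _
    ring
  have h3 : ∀ i, IntegrableOn (fun x => v x * fderiv ℝ (fun x => φ x * F x i) x
      (EuclideanSpace.single i 1)) Ω := fun i =>
    integrable_on_of_continuousOn_closure hΩb
      (hv.mul ((hψ i).continuous_fderiv.clm_apply continuous_const).continuousOn)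
  have h4 : ∀ i, IntegrableOn (fun x => φ x * F x i * g x i) Ω := fun i => by
    have := ((EuclideanSpace.proj (𝕜 := ℝ) i).integrable_comp ((hψ i).integrable_smul h.1))
    simpa using! this.integrableOn
  calc ∫ x in Ω, v x * (inner ℝ (F x) (gradient φ x) + φ x * divergence F x)
      = ∫ x in Ω, ∑ i, v x * fderiv ℝ (fun x => φ x * F x i) x (EuclideanSpace.single i 1) := by
        congr 1; ext x
        rw [← Finset.mul_sum, divergence, PiLp.inner_apply, Finset.mul_sum,
          ← Finset.sum_add_distrib]
        congr 1
        refine Finset.sum_congr rfl fun i _ => ?_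
        rw [h2]; simp [mul_comm]
    _ = ∑ i, ∫ x in Ω, v x * fderiv ℝ (fun x => φ x * F x i) x (EuclideanSpace.single i 1) :=
        integral_finsetSum _ fun i _ => h3 i
    _ = ∑ i, -∫ x in Ω, φ x * F x i * g x i := Finset.sum_congr rfl fun i _ => h1 i
    _ = -∫ x in Ω, ∑ i, φ x * F x i * g x i := by
        rw [Finset.sum_neg_distrib, integral_finsetSum _ fun i _ => h4 i]
    _ = -∫ x in Ω, φ x * inner ℝ (F x) (g x) := by
        congr 2; ext x
        rw [PiLp.inner_apply, Finset.mul_sum]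
        refine Finset.sum_congr rfl fun i _ => ?_
        simp; ring

open ContinuousLinearMap in
/-- The derivative of a mollification, moved onto the kernel. -/
lemma fderiv_mollify_apply (k : ContDiffBump (0 : Pt d)) {f : Pt d → ℝ} (hf : Continuous f)
    (x w : Pt d) :
    fderiv ℝ (convolution (k.normed volume) f (lsmul ℝ ℝ) volume) x w =
      -∫ y, f y * fderiv ℝ (fun y => k.normed volume (x - y)) y w := by
  have hk : ContDiff ℝ 1 (k.normed volume) := k.contDiff_normed
  have h1 := (k.hasCompactSupport_normed (μ := volume)).hasFDerivAt_convolution_left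
    (lsmul ℝ ℝ) hk (hf.locallyIntegrable (μ := volume)) x
  have hcd : Continuous (fderiv ℝ (k.normed volume)) := hk.continuous_fderiv (by norm_num)
  have hcs : HasCompactSupport (fderiv ℝ (k.normed volume)) :=
    (k.hasCompactSupport_normed (μ := volume)).fderiv ℝ
  have hint : Integrable (fun y => (precompL (Pt d) (lsmul ℝ ℝ : ℝ →L[ℝ] ℝ →L[ℝ] ℝ)
      (fderiv ℝ (k.normed volume) y)) (f (x - y))) := by
    apply Continuous.integrable_of_hasCompactSupport
    · exact ((precompL (Pt d) (lsmul ℝ ℝ : ℝ →L[ℝ] ℝ →L[ℝ] ℝ)).continuous.comp hcd).clm_apply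
        (hf.comp (by fun_prop))
    · refine hcs.mono fun y hy => ?_
      contrapose hy
      simp only [Function.mem_support, not_not] at hy ⊢
      rw [hy]; simp
  rw [h1.fderiv, convolution_def, ContinuousLinearMap.integral_apply hint]
  rw [← integral_sub_left_eq_self _ volume x, ← integral_neg]
  refine integral_congr_ae (ae_of_all _ fun y => ?_)
  have e1 : HasFDerivAt (fun y => k.normed volume (x - y))
      ((fderiv ℝ (k.normed volume) (x - y)).comp (-ContinuousLinearMap.id ℝ (Pt d))) y :=
    ((hk.differentiable (by norm_num) (x - y)).hasFDerivAt).comp y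
      ((hasFDerivAt_id y).const_sub x)
  simp only [precompL_apply, lsmul_apply, sub_sub_cancel]
  rw [e1.fderiv]
  simp [mul_comm]

/-- Translated mollifiers are test functions. -/
lemma isTest_mollifier (k : ContDiffBump (0 : Pt d)) {x : Pt d}
    (hx : Metric.closedBall x k.rOut ⊆ Ω) : IsTest Ω (fun y => k.normed volume (x - y)) := by
  have hts : tsupport (fun y => k.normed volume (x - y)) ⊆ Metric.closedBall x k.rOut := by
    refine closure_minimal (fun y hy => ?_) Metric.isClosed_closedBall
    have : x - y ∈ tsupport (k.normed volume) := subset_tsupport _ hy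
    rw [k.tsupport_normed_eq, mem_closedBall_zero_iff] at this
    rwa [Metric.mem_closedBall, dist_comm, dist_eq_norm]
  exact ⟨k.contDiff_normed.comp (by fun_prop),
    (isCompact_closedBall x k.rOut).of_isClosed_subset (isClosed_tsupport _) hts, hts.trans hx⟩

/-- A mollifier supported in the closed ball of radius `δ`. -/
noncomputable def mollifier (d : ℕ) {δ : ℝ} (hδ : 0 < δ) : ContDiffBump (0 : Pt d) :=
  ⟨δ / 2, δ, half_pos hδ, half_lt_self hδ⟩

/-- A continuous function with vanishing distributional gradient on a domain is constant. -/
lemma exists_const_of_weak_gradient_zero (hΩ : IsOpen Ω) (hΩc : IsConnected Ω)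
    {f : Pt d → ℝ} (hf : Continuous f)
    (h : ∀ φ, IsTest Ω φ → ∀ i, ∫ x in Ω, f x * fderiv ℝ φ x (EuclideanSpace.single i 1) = 0) :
    ∃ c, ∀ x ∈ Ω, f x = c := by
  have hloc : ∀ x ∈ Ω, ∃ r > 0, ∀ y ∈ Metric.ball x r, f y = f x := by
    intro x hx
    obtain ⟨r, hr, hrΩ⟩ := Metric.isOpen_iff.1 hΩ x hx
    refine ⟨r / 2, by positivity, fun y hy => ?_⟩
    have key : ∀ δ (hδ : 0 < δ), δ < r / 2 →
        convolution ((mollifier d hδ).normed volume) f (ContinuousLinearMap.lsmul ℝ ℝ) volume y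
        = convolution ((mollifier d hδ).normed volume) f
          (ContinuousLinearMap.lsmul ℝ ℝ) volume x := by
      intro δ hδ hδr
      have hdiff : ContDiff ℝ 1 (convolution ((mollifier d hδ).normed volume) f
          (ContinuousLinearMap.lsmul ℝ ℝ) volume) :=
        (mollifier d hδ).hasCompactSupport_normed.contDiff_convolution_left _
          (mollifier d hδ).contDiff_normed hf.locallyIntegrable
      refine Metric.isOpen_ball.is_const_of_fderiv_eq_zero
        (convex_ball x (r / 2)).isPreconnected
        (hdiff.differentiable (by norm_num)).differentiableOn ?_ hy
        (Metric.mem_ball_self (by positivity))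
      intro z hz
      have htest : IsTest Ω (fun y => (mollifier d hδ).normed volume (z - y)) := by
        apply isTest_mollifier
        refine (Metric.closedBall_subset_ball' ?_).trans hrΩ
        change δ + dist z x < r
        rw [Metric.mem_ball] at hz
        linarith
      have hzero : ∀ i, fderiv ℝ (convolution ((mollifier d hδ).normed volume) f
          (ContinuousLinearMap.lsmul ℝ ℝ) volume) z (EuclideanSpace.single i 1) = 0 := by
        intro i
        rw [fderiv_mollify_apply _ hf, neg_eq_zero, ← h _ htest i]
        refine (setIntegral_eq_integral_of_forall_compl_eq_zero fun y hy => ?_).symm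
        rw [htest.fderiv_eq_zero hy]; simp
      ext w
      have hw : w = ∑ i, w i • EuclideanSpace.single i (1 : ℝ) := by
        ext j; simp [Finset.sum_apply, Pi.single_apply]
      rw [hw, map_sum]
      simp [hzero]
    refine eq_of_forall_dist_le fun e he => ?_
    have hx1 := Metric.continuousAt_iff.1 (hf.continuousAt (x := x)) (e / 2) (by positivity)
    have hy1 := Metric.continuousAt_iff.1 (hf.continuousAt (x := y)) (e / 2) (by positivity)
    obtain ⟨a, ha, hxa⟩ := hx1
    obtain ⟨b, hb, hyb⟩ := hy1
    have hδ : 0 < min (min a b) (r / 4) := by positivity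
    have hδr : min (min a b) (r / 4) < r / 2 := (min_le_right _ _).trans_lt (by linarith)
    have dx := (mollifier d hδ).dist_normed_convolution_le (μ := volume) (x₀ := x) (ε := e / 2)
      hf.aestronglyMeasurable fun z hz =>
        (hxa ((Metric.mem_ball.1 hz).trans_le ((min_le_left _ _).trans (min_le_left _ _)))).le
    have dy := (mollifier d hδ).dist_normed_convolution_le (μ := volume) (x₀ := y) (ε := e / 2)
      hf.aestronglyMeasurable fun z hz =>
        (hyb ((Metric.mem_ball.1 hz).trans_le ((min_le_left _ _).trans (min_le_right _ _)))).le
    rw [key _ hδ hδr] at dy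
    calc dist (f y) (f x) ≤ _ := dist_triangle_left _ _ _
      _ ≤ e / 2 + e / 2 := add_le_add dy dx
      _ = e := by ring
  obtain ⟨x₀, hx₀⟩ := hΩc.nonempty
  refine ⟨f x₀, fun x hx => ?_⟩
  have hd : ∀ x ∈ Ω, f =ᶠ[nhds x] fun _ => f x := fun x hx => by
    obtain ⟨r, hr, h⟩ := hloc x hx
    filter_upwards [Metric.ball_mem_nhds x hr] with y hy using h y hy
  refine hΩ.is_const_of_fderiv_eq_zero (𝕜 := ℝ) hΩc.isPreconnected
    (fun x hx => ((differentiableAt_const (f x)).congr_of_eventuallyEq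
      (hd x hx)).differentiableWithinAt)
    (fun x hx => ?_) hx hx₀
  rw [(hd x hx).fderiv_eq]; simp

/-- Mollifications of a divergence-free field are divergence free away from `∂Ω`. -/
lemma divergence_mollify {τ T : Pt d → Pt d} (hT : Continuous T)
    (hTτ : EqOn T τ Ω) (hΩm : MeasurableSet Ω) (hdiv : IsDivFree Ω τ) (k : ContDiffBump (0 : Pt d))
    {x : Pt d} (hx : Metric.closedBall x k.rOut ⊆ Ω) :
    divergence (convolution (k.normed volume) T (ContinuousLinearMap.lsmul ℝ ℝ) volume) x = 0 := by
  have htest := isTest_mollifier k hx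
  have hTi : ∀ i, Continuous fun y => T y i := fun i =>
    (EuclideanSpace.proj (𝕜 := ℝ) i).continuous.comp hT
  have hkc : Continuous (k.normed volume) := k.continuous_normed
  have hcomp : ∀ i z, (convolution (k.normed volume) T (ContinuousLinearMap.lsmul ℝ ℝ) volume z) i
      = convolution (k.normed volume) (fun y => T y i) (ContinuousLinearMap.lsmul ℝ ℝ)
        volume z := by
    intro i z
    have hint : Integrable fun y => (ContinuousLinearMap.lsmul ℝ ℝ (k.normed volume y))
        (T (z - y)) := by
      apply Continuous.integrable_of_hasCompactSupport
      · simp only [ContinuousLinearMap.lsmul_apply]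
        exact hkc.smul (hT.comp (by fun_prop))
      · refine (k.hasCompactSupport_normed (μ := volume)).mono fun y hy => ?_
        contrapose hy
        simp only [Function.mem_support, not_not] at hy ⊢
        rw [hy]; simp
    rw [convolution_def, convolution_def]
    have := ContinuousLinearMap.integral_comp_comm (EuclideanSpace.proj (𝕜 := ℝ) i) hint
    simpa using! this.symm
  have hsm : ContDiff ℝ 1 (convolution (k.normed volume) T (ContinuousLinearMap.lsmul ℝ ℝ)
      volume) :=
    k.hasCompactSupport_normed.contDiff_convolution_left _ k.contDiff_normed hT.locallyIntegrable
  have hgi : ∀ i, IntegrableOn (fun y => T y i * fderiv ℝ (fun y => k.normed volume (x - y)) y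
      (EuclideanSpace.single i 1)) Ω := fun i => by
    apply Integrable.integrableOn
    apply Continuous.integrable_of_hasCompactSupport
    · exact (hTi i).mul (htest.continuous_fderiv.clm_apply continuous_const)
    · refine (htest.hasCompactSupport.fderiv ℝ).mono fun y hy => ?_
      contrapose hy
      simp only [Function.mem_support, not_not] at hy ⊢
      rw [hy]; simp
  have h1 : ∀ i, (fderiv ℝ (convolution (k.normed volume) T (ContinuousLinearMap.lsmul ℝ ℝ)
      volume) x (EuclideanSpace.single i 1)) i =
      -∫ y in Ω, T y i * fderiv ℝ (fun y => k.normed volume (x - y)) y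
        (EuclideanSpace.single i 1) := by
    intro i
    have e1 := (EuclideanSpace.proj (𝕜 := ℝ) i).hasFDerivAt.comp x
      ((hsm.differentiable (by norm_num)) x).hasFDerivAt
    have e2 : (⇑(EuclideanSpace.proj (𝕜 := ℝ) i) ∘ convolution (k.normed volume) T
        (ContinuousLinearMap.lsmul ℝ ℝ) volume) = convolution (k.normed volume) (fun y => T y i)
        (ContinuousLinearMap.lsmul ℝ ℝ) volume := by
      ext z; exact hcomp i z
    rw [e2] at e1
    have e3 := congrArg (fun l => l (EuclideanSpace.single i (1 : ℝ))) e1.fderiv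
    rw [fderiv_mollify_apply _ (hTi i)] at e3
    rw [setIntegral_eq_integral_of_forall_compl_eq_zero, e3]
    · rfl
    · intro y hy
      rw [htest.fderiv_eq_zero hy]; simp
  unfold divergence
  rw [Finset.sum_congr rfl fun i _ => h1 i, Finset.sum_neg_distrib, neg_eq_zero,
    ← integral_finsetSum _ fun i _ => hgi i, ← hdiv _ htest]
  refine setIntegral_congr_fun hΩm fun y hy => ?_
  simp only
  rw [← hTτ hy, PiLp.inner_apply]
  refine Finset.sum_congr rfl fun i _ => ?_
  have e4 : (gradient (fun y => k.normed volume (x - y)) y) i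
      = fderiv ℝ (fun y => k.normed volume (x - y)) y (EuclideanSpace.single i 1) := by
    rw [← inner_gradient_left, EuclideanSpace.inner_single_right]; simp
  rw [e4]; simp [mul_comm]

/-- Integration by parts against a test function for a continuous divergence-free field:
`div (v τ) = τ · ∇v` in the sense of distributions. The field is mollified; its mollifications
are divergence free on the support of the test function and converge uniformly. -/
lemma integral_test_divFree (hΩ : IsOpen Ω) (hΩb : Bornology.IsBounded Ω) {τ T : Pt d → Pt d}
    (hT : Continuous T) (hTτ : EqOn T τ Ω) (hdiv : IsDivFree Ω τ) {v : Pt d → ℝ}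
    {g : Pt d → Pt d} (hv : ContinuousOn v (closure Ω)) (h : HasWeakGradient Ω v g)
    {φ : Pt d → ℝ} (hφ : IsTest Ω φ) :
    ∫ x in Ω, φ x * inner ℝ (T x) (g x) = -∫ x in Ω, v x * inner ℝ (T x) (gradient φ x) := by
  have hcl : IsCompact (closure Ω) := hΩb.isCompact_closure
  obtain ⟨δ₀, hδ₀, hthick⟩ := hφ.hasCompactSupport.isCompact.exists_cthickening_subset_open hΩ hφ.2.2
  have hgφ : IntegrableOn (fun x => φ x • g x) Ω := (hφ.integrable_smul h.1).integrableOn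
  have hvφ : IntegrableOn (fun x => v x • gradient φ x) Ω :=
    integrable_on_of_continuousOn_closure hΩb (hv.smul hφ.continuous_gradient.continuousOn)
  have hbdd : ∀ {F : Pt d → Pt d} {w : Pt d → Pt d}, Continuous F → IntegrableOn w Ω →
      IntegrableOn (fun x => inner ℝ (F x) (w x)) Ω := by
    intro F w hF hw
    obtain ⟨C, hC⟩ := hcl.exists_bound_of_continuousOn hF.continuousOn
    refine (hw.norm.const_mul C).mono (hF.aestronglyMeasurable.inner hw.1) ?_
    refine ae_restrict_of_forall_mem hΩ.measurableSet fun x hx => ?_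
    have h1 := hC x (subset_closure hx)
    rw [Real.norm_of_nonneg (mul_nonneg ((norm_nonneg _).trans h1) (norm_nonneg _))]
    exact (norm_inner_le_norm _ _).trans (mul_le_mul_of_nonneg_right h1 (norm_nonneg _))
  have e1 : ∀ F : Pt d → Pt d, (fun x => φ x * inner ℝ (F x) (g x)) =
      fun x => inner ℝ (F x) (φ x • g x) := fun F => by ext x; rw [inner_smul_right]
  have e2 : ∀ F : Pt d → Pt d, (fun x => v x * inner ℝ (F x) (gradient φ x)) =
      fun x => inner ℝ (F x) (v x • gradient φ x) := fun F => by ext x; rw [inner_smul_right]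
  set N : ℝ := (∫ x in Ω, ‖φ x • g x‖) + ∫ x in Ω, ‖v x • gradient φ x‖ with hN
  have hN0 : 0 ≤ N := add_nonneg (integral_nonneg fun _ => norm_nonneg _)
    (integral_nonneg fun _ => norm_nonneg _)
  refine eq_of_forall_dist_le fun e he => ?_
  obtain ⟨a, ha, huc⟩ := Metric.uniformContinuousOn_iff.1
    ((hcl.cthickening (r := 1)).uniformContinuousOn_of_continuous hT.continuousOn)
    (e / (N + 1)) (by positivity)
  have hδ : 0 < min (min a δ₀) 1 := by positivity
  set k := mollifier d hδ
  set F := convolution (k.normed volume) T (ContinuousLinearMap.lsmul ℝ ℝ) volume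
  have hFs : ContDiff ℝ ∞ F :=
    k.hasCompactSupport_normed.contDiff_convolution_left _ k.contDiff_normed hT.locallyIntegrable
  have hclose : ∀ x ∈ Ω, ‖F x - T x‖ ≤ e / (N + 1) := by
    intro x hx
    rw [← dist_eq_norm]
    refine k.dist_normed_convolution_le hT.aestronglyMeasurable fun y hy => ?_
    have hy' : dist y x < min (min a δ₀) 1 := hy
    refine (huc y ?_ x ?_ ?_).le
    · exact Metric.mem_cthickening_of_dist_le _ x _ _ (subset_closure hx)
        (hy'.le.trans (min_le_right _ _))
    · exact Metric.self_subset_cthickening _ (subset_closure hx)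
    · exact hy'.trans_le ((min_le_left _ _).trans (min_le_left _ _))
  have hF := h.integral_divergence hΩb hv hφ hFs
  have hF' : ∫ x in Ω, v x * inner ℝ (F x) (gradient φ x) =
      -∫ x in Ω, φ x * inner ℝ (F x) (g x) := by
    rw [← hF]
    refine setIntegral_congr_fun hΩ.measurableSet fun x _ => ?_
    by_cases hx : x ∈ tsupport φ
    · have hdiv0 : divergence F x = 0 := by
        refine divergence_mollify hT hTτ hΩ.measurableSet hdiv k (Subset.trans ?_ hthick)
        intro y hy
        refine Metric.mem_cthickening_of_dist_le y x _ _ hx ?_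
        exact (Metric.mem_closedBall.1 hy).trans ((min_le_left _ _).trans (min_le_right _ _))
      simp [hdiv0]
    · simp [image_eq_zero_of_notMem_tsupport hx]
  have hFc := hFs.continuous
  have d1 : |(∫ x in Ω, φ x * inner ℝ (T x) (g x)) - ∫ x in Ω, φ x * inner ℝ (F x) (g x)| ≤
      e / (N + 1) * ∫ x in Ω, ‖φ x • g x‖ := by
    rw [e1, e1, ← integral_sub (hbdd hT hgφ) (hbdd hFc hgφ), ← integral_const_mul,
      ← Real.norm_eq_abs]
    refine norm_integral_le_of_norm_le (hgφ.norm.const_mul _) ?_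
    refine ae_restrict_of_forall_mem hΩ.measurableSet fun x hx => ?_
    rw [← inner_sub_left]
    refine (norm_inner_le_norm _ _).trans (mul_le_mul_of_nonneg_right ?_ (norm_nonneg _))
    rw [norm_sub_rev]; exact hclose x hx
  have d2 : |(∫ x in Ω, v x * inner ℝ (F x) (gradient φ x)) -
      ∫ x in Ω, v x * inner ℝ (T x) (gradient φ x)| ≤
      e / (N + 1) * ∫ x in Ω, ‖v x • gradient φ x‖ := by
    rw [e2, e2, ← integral_sub (hbdd hFc hvφ) (hbdd hT hvφ), ← integral_const_mul,
      ← Real.norm_eq_abs]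
    refine norm_integral_le_of_norm_le (hvφ.norm.const_mul _) ?_
    refine ae_restrict_of_forall_mem hΩ.measurableSet fun x hx => ?_
    rw [← inner_sub_left]
    exact (norm_inner_le_norm _ _).trans
      (mul_le_mul_of_nonneg_right (hclose x hx) (norm_nonneg _))
  have hfin : e / (N + 1) * N ≤ e := by
    rw [div_mul_eq_mul_div, div_le_iff₀ (by positivity)]
    nlinarith
  rw [Real.dist_eq]
  rw [hF'] at d2
  calc _ = |((∫ x in Ω, φ x * inner ℝ (T x) (g x)) - ∫ x in Ω, φ x * inner ℝ (F x) (g x)) -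
        ((-∫ x in Ω, φ x * inner ℝ (F x) (g x)) - ∫ x in Ω, v x * inner ℝ (T x) (gradient φ x))|
        := by congr 1; ring
    _ ≤ _ := abs_sub _ _
    _ ≤ e / (N + 1) * N := by rw [hN, mul_add]; exact add_le_add d1 d2
    _ ≤ e := hfin

end Weak

/-! ### The Gauss–Green formula and virtual work -/

section GaussGreen

variable {d : ℕ} {Ω Γu : Set (Pt d)} {n : Pt d → Pt d}

lemma IsRegion.finite_volume (hΩ : IsRegion Ω n) : IsFiniteMeasure (volume.restrict Ω) :=
  ⟨by rw [Measure.restrict_apply_univ]; exact hΩ.isBounded.measure_lt_top⟩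

lemma IsRegion.isCompact_closure (hΩ : IsRegion Ω n) : IsCompact (closure Ω) :=
  hΩ.isBounded.isCompact_closure

lemma IsRegion.finite_surface (hΩ : IsRegion Ω n) :
    IsFiniteMeasure ((surface d).restrict (frontier Ω)) :=
  ⟨by rw [Measure.restrict_apply_univ]; exact hΩ.finite_boundary⟩

/-- The flux density of a continuous field through the boundary is integrable. -/
lemma IsRegion.integrable_flux (hΩ : IsRegion Ω n) {F : Pt d → Pt d}
    (hF : ContinuousOn F (closure Ω)) :
    IntegrableOn (fun x => inner ℝ (n x) (F x)) (frontier Ω) (surface d) := by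
  have := hΩ.finite_surface
  obtain ⟨C, hC⟩ := hΩ.isCompact_closure.exists_bound_of_continuousOn hF
  have hFm : AEStronglyMeasurable F ((surface d).restrict (frontier Ω)) :=
    (hF.mono frontier_subset_closure).aestronglyMeasurable isClosed_frontier.measurableSet
  refine Integrable.of_bound (hΩ.measurable_normal.aestronglyMeasurable.inner hFm) C ?_
  filter_upwards [hΩ.unit_normal, ae_restrict_mem isClosed_frontier.measurableSet] with x h1 h2
  refine (norm_inner_le_norm _ _).trans ?_
  rw [h1, one_mul]
  exact hC x (frontier_subset_closure h2)

/-- Integration by parts for a test function and a `C¹` field; there are no boundary terms. -/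
lemma integral_cutoff_divergence {φ : Pt d → ℝ} (hφ : IsTest Ω φ) {G : Pt d → Pt d}
    (hG : ContDiff ℝ 1 G) :
    ∫ x in Ω, φ x * divergence G x = -∫ x in Ω, inner ℝ (G x) (gradient φ x) := by
  have hGi : ∀ i, ContDiff ℝ 1 fun x => G x i := fun i =>
    (EuclideanSpace.proj (𝕜 := ℝ) i).contDiff.comp hG
  have hGd : ∀ i x w, fderiv ℝ (fun x => G x i) x w = (fderiv ℝ G x w) i := fun i x w => by
    have := ((EuclideanSpace.proj (𝕜 := ℝ) i).hasFDerivAt.comp x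
      (hG.differentiable (by norm_num) x).hasFDerivAt).fderiv
    exact congrArg (fun l => l w) this
  have hφc := hφ.1.continuous
  have i1 : ∀ i, Integrable fun x => φ x * fderiv ℝ (fun x => G x i) x
      (EuclideanSpace.single i 1) := fun i =>
    (hφc.mul (((hGi i).continuous_fderiv (by norm_num)).clm_apply
      continuous_const)).integrable_of_hasCompactSupport hφ.2.1.mul_right
  have i2 : ∀ i, Integrable fun x => fderiv ℝ φ x (EuclideanSpace.single i 1) * G x i := fun i => by
    refine ((hφ.continuous_fderiv.clm_apply continuous_const).mul
      (hGi i).continuous).integrable_of_hasCompactSupport ?_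
    refine (hφ.hasCompactSupport.fderiv ℝ).mono fun y hy => ?_
    contrapose hy
    simp only [Function.mem_support, not_not, Pi.mul_apply] at hy ⊢
    rw [hy]; simp
  have i3 : ∀ i, Integrable fun x => φ x * G x i := fun i =>
    (hφc.mul (hGi i).continuous).integrable_of_hasCompactSupport hφ.2.1.mul_right
  rw [setIntegral_eq_integral_of_forall_compl_eq_zero (fun x hx => by rw [hφ.eq_zero hx, zero_mul]),
    setIntegral_eq_integral_of_forall_compl_eq_zero (fun x hx => by
      rw [real_inner_comm, inner_gradient_left, hφ.fderiv_eq_zero hx]; rfl)]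
  calc ∫ x, φ x * divergence G x
      = ∫ x, ∑ i, φ x * fderiv ℝ (fun x => G x i) x (EuclideanSpace.single i 1) := by
        congr 1; ext x
        rw [divergence, Finset.mul_sum]
        simp_rw [hGd]
    _ = ∑ i, ∫ x, φ x * fderiv ℝ (fun x => G x i) x (EuclideanSpace.single i 1) :=
        integral_finsetSum _ fun i _ => i1 i
    _ = ∑ i, -∫ x, fderiv ℝ φ x (EuclideanSpace.single i 1) * G x i := by
        refine Finset.sum_congr rfl fun i _ => ?_
        exact integral_mul_fderiv_eq_neg_fderiv_mul_of_integrable (i2 i) (i1 i) (i3 i)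
          (fun x _ => hφ.1.differentiable (by norm_num) x)
          (fun x _ => (hGi i).differentiable (by norm_num) x)
    _ = -∫ x, ∑ i, fderiv ℝ φ x (EuclideanSpace.single i 1) * G x i := by
        rw [Finset.sum_neg_distrib, integral_finsetSum _ fun i _ => i2 i]
    _ = -∫ x, inner ℝ (G x) (gradient φ x) := by
        congr 2; ext x
        rw [PiLp.inner_apply]
        refine Finset.sum_congr rfl fun i _ => ?_
        have e4 : (gradient φ x) i = fderiv ℝ φ x (EuclideanSpace.single i 1) := by
          rw [← inner_gradient_left, EuclideanSpace.inner_single_right]; simp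
        rw [e4]; simp

/-- The Gauss–Green formula for `v τ`, with `τ` a continuous divergence-free field and `v`
continuous with weak gradient `g`. The field `v τ` is uniformly approximated by smooth fields;
the error is controlled by cutoff functions with gradients bounded in `L¹`. -/
theorem IsRegion.gauss_green (hd : 1 ≤ d) (hΩ : IsRegion Ω n) {τ : Pt d → Pt d}
    (hτ : ContinuousOn τ (closure Ω)) (hdiv : IsDivFree Ω τ) {v : Pt d → ℝ} {g : Pt d → Pt d}
    (hv : ContinuousOn v (closure Ω)) (h : HasWeakGradient Ω v g)
    (hg : IntegrableOn g Ω) :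
    ∫ x in Ω, inner ℝ (τ x) (g x) =
      ∫ x in frontier Ω, inner ℝ (n x) (v x • τ x) ∂(surface d) := by
  have hfinv := hΩ.finite_volume
  have hfins := hΩ.finite_surface
  have hm : MeasurableSet Ω := hΩ.isOpen.measurableSet
  obtain ⟨T, hT, hTτ⟩ := exists_continuous_extension isClosed_closure hτ
  obtain ⟨V, hV, hVv⟩ := exists_continuous_extension isClosed_closure hv
  obtain ⟨C, hC, hcut⟩ := exists_cutoff hd hΩ.isOpen hΩ.isBounded hΩ.finite_boundary
  obtain ⟨Cτ, hCτ⟩ := hΩ.isCompact_closure.exists_bound_of_continuousOn hτ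
  have hτg : IntegrableOn (fun x => inner ℝ (τ x) (g x)) Ω := by
    refine (hg.norm.const_mul Cτ).mono
      (((hτ.mono subset_closure).aestronglyMeasurable hm).inner hg.1) ?_
    refine ae_restrict_of_forall_mem hm fun x hx => ?_
    have h1 := hCτ x (subset_closure hx)
    rw [Real.norm_of_nonneg (mul_nonneg ((norm_nonneg _).trans h1) (norm_nonneg _))]
    exact (norm_inner_le_norm _ _).trans (mul_le_mul_of_nonneg_right h1 (norm_nonneg _))
  set S : ℝ := (surface d).real (frontier Ω)
  have hS : 0 ≤ S := measureReal_nonneg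
  refine eq_of_forall_dist_le fun e he => ?_
  set e' : ℝ := e / (C + S + 1) with he'
  have he'0 : 0 < e' := by positivity
  obtain ⟨G, hGs, hGF, -⟩ := (hV.smul hT).exists_contDiff_approx 1 (ε := fun _ => e')
    continuous_const (fun _ => he'0)
  have hGs : ContDiff ℝ 1 G := hGs
  have hGc := hGs.continuous
  have hclose : ∀ x ∈ closure Ω, ‖G x - v x • τ x‖ ≤ e' := fun x hx => by
    rw [← hTτ hx, ← hVv hx, ← dist_eq_norm]; exact (hGF x).le
  have hdG : IntegrableOn (divergence G) Ω := by
    refine integrable_on_of_continuousOn_closure hΩ.isBounded (Continuous.continuousOn ?_)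
    unfold divergence
    refine continuous_finsetSum _ fun i _ => ?_
    exact (EuclideanSpace.proj (𝕜 := ℝ) i).continuous.comp
      ((hGs.continuous_fderiv (by norm_num)).clm_apply continuous_const)
  have hbulk : |(∫ x in Ω, inner ℝ (τ x) (g x)) - ∫ x in Ω, divergence G x| ≤ e' * C := by
    choose φ hφ using fun k : ℕ => hcut (1 / ((k : ℝ) + 1)) (by positivity)
    have hstep : ∀ k, |∫ x in Ω, φ k x * (inner ℝ (τ x) (g x) - divergence G x)| ≤ e' * C := by
      intro k
      obtain ⟨ht, h01, -, hgr⟩ := hφ k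
      have hgi : IntegrableOn (fun x => gradient (φ k) x) Ω :=
        (ht.continuous_gradient.integrable_of_hasCompactSupport
          ht.hasCompactSupport_gradient).integrableOn
      have h1 := integral_test_divFree hΩ.isOpen hΩ.isBounded hT
        (hTτ.mono subset_closure) hdiv hv h ht
      have h2 := integral_cutoff_divergence ht hGs
      have ib : ∀ {w : Pt d → ℝ}, IntegrableOn w Ω → IntegrableOn (fun x => φ k x * w x) Ω :=
        fun {w} hw => hw.bdd_mul (c := 1) ht.1.continuous.aestronglyMeasurable
          (ae_of_all _ fun x => by
            rw [Real.norm_of_nonneg (h01 x).1]; exact (h01 x).2)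
      have i3 : IntegrableOn (fun x => inner ℝ (G x) (gradient (φ k) x)) Ω :=
        integrable_on_of_continuousOn_closure hΩ.isBounded
          (hGc.inner ht.continuous_gradient).continuousOn
      have i4 : IntegrableOn (fun x => v x * inner ℝ (T x) (gradient (φ k) x)) Ω :=
        integrable_on_of_continuousOn_closure hΩ.isBounded
          (hv.mul (hT.inner ht.continuous_gradient).continuousOn)
      have e1 : ∫ x in Ω, φ k x * (inner ℝ (τ x) (g x) - divergence G x) =
          ∫ x in Ω, (inner ℝ (G x) (gradient (φ k) x)
            - v x * inner ℝ (T x) (gradient (φ k) x)) := by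
        rw [integral_sub i3 i4]
        simp_rw [mul_sub]
        rw [integral_sub (ib hτg) (ib hdG), h2]
        have : ∫ x in Ω, φ k x * inner ℝ (τ x) (g x) = ∫ x in Ω, φ k x * inner ℝ (T x) (g x) :=
          setIntegral_congr_fun hm fun x hx => by simp only [hTτ (subset_closure hx)]
        rw [this, h1]; ring
      rw [e1, ← Real.norm_eq_abs]
      calc _ ≤ ∫ x in Ω, e' * ‖gradient (φ k) x‖ := by
            refine norm_integral_le_of_norm_le (hgi.norm.const_mul _) ?_
            refine ae_restrict_of_forall_mem hm fun x hx => ?_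
            rw [← real_inner_smul_left, ← inner_sub_left, hTτ (subset_closure hx)]
            exact (norm_inner_le_norm _ _).trans
              (mul_le_mul_of_nonneg_right (hclose x (subset_closure hx)) (norm_nonneg _))
        _ = e' * ∫ x in Ω, ‖gradient (φ k) x‖ := integral_const_mul _ _
        _ ≤ e' * C := by gcongr
    have hlim : Filter.Tendsto (fun k => ∫ x in Ω, φ k x * (inner ℝ (τ x) (g x) - divergence G x))
        Filter.atTop (nhds (∫ x in Ω, (inner ℝ (τ x) (g x) - divergence G x))) := by
      refine tendsto_integral_of_dominated_convergence
        (fun x => ‖inner ℝ (τ x) (g x) - divergence G x‖) ?_ (hτg.sub hdG).norm ?_ ?_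
      · exact fun k => ((hφ k).1.1.continuous.aestronglyMeasurable).mul (hτg.sub hdG).1
      · intro k
        refine ae_of_all _ fun x => ?_
        rw [norm_mul, Real.norm_of_nonneg ((hφ k).2.1 x).1]
        exact mul_le_of_le_one_left (norm_nonneg _) ((hφ k).2.1 x).2
      · refine ae_restrict_of_forall_mem hm fun x hx => ?_
        obtain ⟨r, hr, hrΩ⟩ := Metric.isOpen_iff.1 hΩ.isOpen x hx
        obtain ⟨N, hN⟩ := exists_nat_one_div_lt hr
        refine tendsto_const_nhds.congr' ?_
        filter_upwards [Filter.eventually_ge_atTop N] with k hk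
        have : φ k x = 1 := by
          refine (hφ k).2.2.1 x hx fun y hy => ?_
          by_contra! hlt
          have hkN : 1 / ((k : ℝ) + 1) ≤ 1 / ((N : ℝ) + 1) := by gcongr
          have hy' : y ∈ Ω := hrΩ (by rw [Metric.mem_ball, dist_comm]; linarith)
          rw [hΩ.isOpen.frontier_eq] at hy
          exact hy.2 hy'
        rw [this, one_mul]
    rw [← integral_sub hτg hdG]
    exact le_of_tendsto hlim.abs (Filter.Eventually.of_forall hstep)
  have hbdry : |(∫ x in Ω, divergence G x) -
      ∫ x in frontier Ω, inner ℝ (n x) (v x • τ x) ∂(surface d)| ≤ e' * S := by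
    have hflux : IntegrableOn (fun x => inner ℝ (n x) (v x • τ x)) (frontier Ω) (surface d) :=
      hΩ.integrable_flux (hv.smul hτ)
    rw [hΩ.outer_normal G hGs, ← integral_sub (hΩ.integrable_flux hGc.continuousOn) hflux,
      ← Real.norm_eq_abs]
    have := norm_integral_le_of_norm_le_const (μ := (surface d).restrict (frontier Ω))
      (f := fun x => inner ℝ (n x) (G x) - inner ℝ (n x) (v x • τ x)) (C := e') (by
        filter_upwards [hΩ.unit_normal, ae_restrict_mem isClosed_frontier.measurableSet]
          with x h1 h2
        rw [← inner_sub_right]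
        refine (norm_inner_le_norm _ _).trans ?_
        rw [h1, one_mul]
        exact hclose x (frontier_subset_closure h2))
    rwa [measureReal_restrict_apply_univ] at this
  have hfin : e' * (C + S) ≤ e := by
    rw [he', div_mul_eq_mul_div, div_le_iff₀ (by positivity)]
    nlinarith
  rw [Real.dist_eq]
  calc _ ≤ _ := abs_sub_le _ (∫ x in Ω, divergence G x) _
    _ ≤ e' * C + e' * S := add_le_add hbulk hbdry
    _ ≤ e := by rw [← mul_add]; exact hfin

/-- The principle of virtual work: the interior work of a statically admissible stress on an
admissible displacement equals the work of the traction on the boundary. -/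
theorem virtual_work (hd : 1 ≤ d) (hΩ : IsRegion Ω n) {t : Pt d → ℝ} {τ : Pt d → Pt d}
    (hτ : τ ∈ Stresses Ω Γu n t) {v : Pt d → ℝ} {g : Pt d → Pt d}
    (hv : ContinuousOn v (closure Ω)) (hv0 : ∀ x ∈ Γu, v x = 0) (h : HasWeakGradient Ω v g)
    (hg : IntegrableOn g Ω) :
    IntegrableOn (fun x => t x * v x) (frontier Ω \ Γu) (surface d) ∧
    ∫ x in Ω, inner ℝ (τ x) (g x) = ∫ x in frontier Ω \ Γu, t x * v x ∂(surface d) := by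
  obtain ⟨hτc, hdiv, ht⟩ := hτ
  have hcongr : (fun x => inner ℝ (n x) (v x • τ x))
      =ᵐ[(surface d).restrict (frontier Ω \ Γu)] fun x => t x * v x := by
    filter_upwards [ht] with x hx
    rw [inner_smul_right, hx, mul_comm]
  have hint := (hΩ.integrable_flux (hv.smul hτc)).mono_set (sdiff_subset (s := frontier Ω) (t := Γu))
  refine ⟨hint.congr hcongr, ?_⟩
  rw [hΩ.gauss_green hd hτc hdiv hv h hg, ← integral_congr_ae hcongr]
  refine setIntegral_eq_of_subset_of_forall_sdiff_eq_zero isClosed_frontier.measurableSet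
    sdiff_subset fun x hx => ?_
  have hxu : x ∈ Γu := by
    by_contra hxu; exact hx.2 ⟨hx.1, hxu⟩
  rw [hv0 x hxu, zero_smul, inner_zero_right]

end GaussGreen

/-! ### The space of admissible displacements -/

section WeakGradient

variable {d : ℕ} {Ω Γu : Set (Pt d)} {n : Pt d → Pt d}

lemma HasWeakGradient.ae_eq (hΩ : IsOpen Ω) {u : Pt d → ℝ} {g g' : Pt d → Pt d}
    (h : HasWeakGradient Ω u g) (h' : HasWeakGradient Ω u g') : g =ᵐ[volume.restrict Ω] g' := by
  have key := hΩ.ae_eq_zero_of_integral_contDiff_smul_eq_zero (μ := volume)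
    (f := fun x => g x - g' x) (h.1.sub h'.1) (by
      intro φ h1 h2 h3
      have hφ : IsTest Ω φ := ⟨h1, h2, h3⟩
      have i1 := (hφ.integrable_smul h.1).integrableOn (s := Ω)
      have i2 := (hφ.integrable_smul h'.1).integrableOn (s := Ω)
      rw [← setIntegral_eq_integral_of_forall_compl_eq_zero (s := Ω)
        (fun x hx => by rw [hφ.eq_zero hx, zero_smul])]
      simp_rw [smul_sub]
      rw [integral_sub i1 i2, sub_eq_zero, ← neg_inj, ← h.2 φ hφ, ← h'.2 φ hφ])
  rw [Filter.EventuallyEq, ae_restrict_iff' hΩ.measurableSet]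
  filter_upwards [key] with x hx hxΩ using sub_eq_zero.1 (hx hxΩ)

lemma HasWeakGradient.weakGradient {u : Pt d → ℝ} {g : Pt d → Pt d}
    (h : HasWeakGradient Ω u g) : HasWeakGradient Ω u (weakGradient Ω u) := by
  have hex : ∃ g, HasWeakGradient Ω u g := ⟨g, h⟩
  unfold AntiPlane.weakGradient
  rw [dif_pos hex]
  exact hex.choose_spec

lemma hasWeakGradient_of_mem {u : Pt d → ℝ} (hu : u ∈ Displacements Ω Γu) :
    HasWeakGradient Ω u (weakGradient Ω u) := by
  obtain ⟨-, ⟨g, hg, -⟩, -⟩ := hu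
  exact hg.weakGradient

lemma memLp_weakGradient (hΩ : IsOpen Ω) {u : Pt d → ℝ} (hu : u ∈ Displacements Ω Γu) :
    MemLp (weakGradient Ω u) 4 (volume.restrict Ω) := by
  obtain ⟨-, ⟨g, hg, hgL⟩, -⟩ := hu
  exact (memLp_congr_ae (hg.ae_eq hΩ hg.weakGradient)).1 hgL

lemma HasWeakGradient.add_smul (hΩb : Bornology.IsBounded Ω) {u v : Pt d → ℝ}
    {g g' : Pt d → Pt d}
    (hu : ContinuousOn u (closure Ω)) (hv : ContinuousOn v (closure Ω))
    (h : HasWeakGradient Ω u g) (h' : HasWeakGradient Ω v g') (s : ℝ) :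
    HasWeakGradient Ω (u + s • v) (fun x => g x + s • g' x) := by
  refine ⟨h.1.add (h'.1.smul s), fun φ hφ => ?_⟩
  have i1 : IntegrableOn (fun x => u x • gradient φ x) Ω :=
    integrable_on_of_continuousOn_closure hΩb (hu.smul hφ.continuous_gradient.continuousOn)
  have i2 : IntegrableOn (fun x => v x • gradient φ x) Ω :=
    integrable_on_of_continuousOn_closure hΩb (hv.smul hφ.continuous_gradient.continuousOn)
  have i3 := (hφ.integrable_smul h.1).integrableOn (s := Ω)
  have i4 := (hφ.integrable_smul h'.1).integrableOn (s := Ω)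
  have i2s : IntegrableOn (fun x => s • (v x • gradient φ x)) Ω := i2.smul s
  have i4s : IntegrableOn (fun x => s • (φ x • g' x)) Ω := i4.smul s
  calc ∫ x in Ω, (u + s • v) x • gradient φ x
      = ∫ x in Ω, (u x • gradient φ x + s • (v x • gradient φ x)) := by
        congr 1; ext1 x
        simp only [Pi.add_apply, Pi.smul_apply, smul_eq_mul, _root_.add_smul, mul_smul]
    _ = (∫ x in Ω, u x • gradient φ x) + s • ∫ x in Ω, v x • gradient φ x := by
        rw [integral_add i1 i2s, integral_smul]
    _ = -∫ x in Ω, (φ x • g x + s • (φ x • g' x)) := by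
        rw [h.2 φ hφ, h'.2 φ hφ, integral_add i3 i4s, integral_smul, smul_neg, neg_add]
    _ = _ := by
        congr 2; ext1 x
        rw [smul_add, smul_comm s]

lemma add_smul_mem_displacements (hΩ : IsRegion Ω n) {u v : Pt d → ℝ}
    (hu : u ∈ Displacements Ω Γu) (hv : v ∈ Displacements Ω Γu) (s : ℝ) :
    u + s • v ∈ Displacements Ω Γu := by
  obtain ⟨huc, ⟨g, hg, hgL⟩, hu0⟩ := hu
  obtain ⟨hvc, ⟨g', hg', hgL'⟩, hv0⟩ := hv
  refine ⟨huc.add (hvc.const_smul s), ⟨_, hg.add_smul hΩ.isBounded huc hvc hg' s,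
    hgL.add (hgL'.const_smul s)⟩, fun x hx => ?_⟩
  simp [hu0 x hx, hv0 x hx]

lemma weakGradient_add_smul (hΩ : IsRegion Ω n) {u v : Pt d → ℝ}
    (hu : u ∈ Displacements Ω Γu) (hv : v ∈ Displacements Ω Γu) (s : ℝ) :
    weakGradient Ω (u + s • v) =ᵐ[volume.restrict Ω]
      fun x => weakGradient Ω u x + s • weakGradient Ω v x :=
  (hasWeakGradient_of_mem (add_smul_mem_displacements hΩ hu hv s)).ae_eq hΩ.isOpen
    ((hasWeakGradient_of_mem hu).add_smul hΩ.isBounded hu.1 hv.1 (hasWeakGradient_of_mem hv) s)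

end WeakGradient

/-! ### Line integrals and their gradients -/

section LineIntegral

variable {d : ℕ} {Ω Γu : Set (Pt d)} {g : Pt d → Pt d} {u : Pt d → ℝ}

/-- The line integral along a segment contained in `Ω`. -/
lemma IsLineIntegral.segment (h : IsLineIntegral Ω Γu g u) {x y : Pt d}
    (hxy : ∀ s ∈ Icc (0 : ℝ) 1, x + s • (y - x) ∈ Ω) :
    u y = u x + ∫ s in (0 : ℝ)..1, inner ℝ (g (x + s • (y - x))) (y - x) := by
  have hp : ContDiff ℝ 1 fun s : ℝ => x + s • (y - x) := by fun_prop
  have hx : x ∈ Ω := by simpa using hxy 0 (by simp)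
  have h1 := h.2.2 _ hp (by simpa using subset_closure hx)
    fun s hs => hxy s ⟨hs.1.le, hs.2⟩
  have hd : ∀ s : ℝ, deriv (fun s : ℝ => x + s • (y - x)) s = y - x := fun s => by
    have : HasDerivAt (fun s : ℝ => x + s • (y - x)) ((1 : ℝ) • (y - x)) s :=
      ((hasDerivAt_id s).smul_const (y - x)).const_add x
    rw [this.deriv, one_smul]
  simp only [hd, one_smul, zero_smul, add_zero, add_sub_cancel] at h1
  exact h1

lemma add_smul_sub_mem_ball {x₀ x y : Pt d} {r : ℝ} (hx : x ∈ Metric.ball x₀ r)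
    (hy : y ∈ Metric.ball x₀ r) {s : ℝ} (hs : s ∈ Icc (0 : ℝ) 1) :
    x + s • (y - x) ∈ Metric.ball x₀ r :=
  (convex_ball x₀ r).add_smul_sub_mem hx hy hs

lemma IsLineIntegral.lipschitzOnWith (h : IsLineIntegral Ω Γu g u) {M : NNReal}
    (hM : ∀ x ∈ Ω, ‖g x‖ ≤ M) {x₀ : Pt d} {r : ℝ} (hr : Metric.ball x₀ r ⊆ Ω) :
    LipschitzOnWith M u (Metric.ball x₀ r) := by
  refine LipschitzOnWith.of_dist_le_mul fun y hy x hx => ?_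
  rw [Real.dist_eq, h.segment fun s hs => hr (add_smul_sub_mem_ball hx hy hs), add_sub_cancel_left,
    ← Real.norm_eq_abs, dist_eq_norm]
  have := intervalIntegral.norm_integral_le_of_norm_le_const (a := (0 : ℝ)) (b := 1)
    (f := fun s => inner ℝ (g (x + s • (y - x))) (y - x)) (C := M * ‖y - x‖) (by
      intro s hs
      rw [uIoc_of_le zero_le_one] at hs
      exact (norm_inner_le_norm _ _).trans (mul_le_mul_of_nonneg_right
        (hM _ (hr (add_smul_sub_mem_ball hx hy ⟨hs.1.le, hs.2⟩))) (norm_nonneg _)))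
  simpa using this

/-- Near points of continuity of the integrand, the line integral is differentiable. -/
lemma IsLineIntegral.hasGradientAt (h : IsLineIntegral Ω Γu g u) {W : Set (Pt d)}
    (hW : IsOpen W) (hWΩ : W ⊆ Ω) (hg : ContinuousOn g W) {x : Pt d} (hx : x ∈ W) :
    HasGradientAt u (g x) x := by
  rw [hasGradientAt_iff_hasFDerivAt, hasFDerivAt_iff_isLittleO, Asymptotics.isLittleO_iff]
  intro e he
  obtain ⟨r, hr, hrW⟩ := Metric.isOpen_iff.1 hW x hx
  obtain ⟨δ, hδ, hcont⟩ := Metric.continuousAt_iff.1 (hg.continuousAt (hW.mem_nhds hx)) e he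
  have hpos : 0 < min r δ := lt_min hr hδ
  filter_upwards [Metric.ball_mem_nhds x hpos] with y hy
  have hseg : ∀ s ∈ Icc (0 : ℝ) 1, x + s • (y - x) ∈ Metric.ball x (min r δ) := fun s hs =>
    add_smul_sub_mem_ball (Metric.mem_ball_self hpos) hy hs
  have hsegW : ∀ s ∈ Icc (0 : ℝ) 1, x + s • (y - x) ∈ W := fun s hs =>
    hrW (Metric.ball_subset_ball (min_le_left _ _) (hseg s hs))
  rw [h.segment fun s hs => hWΩ (hsegW s hs)]
  have hint : IntervalIntegrable (fun s : ℝ => inner ℝ (g (x + s • (y - x))) (y - x)) volume 0 1 := by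
    apply ContinuousOn.intervalIntegrable
    rw [uIcc_of_le zero_le_one]
    exact ContinuousOn.inner (hg.comp (by fun_prop) hsegW) continuousOn_const
  have e1 : u x + (∫ s in (0 : ℝ)..1, inner ℝ (g (x + s • (y - x))) (y - x)) - u x
      - (InnerProductSpace.toDual ℝ (Pt d)) (g x) (y - x)
      = ∫ s in (0 : ℝ)..1, (inner ℝ (g (x + s • (y - x))) (y - x) - inner ℝ (g x) (y - x)) := by
    rw [intervalIntegral.integral_sub hint intervalIntegrable_const, add_sub_cancel_left,
      InnerProductSpace.toDual_apply_apply]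
    simp
  rw [e1]
  have := intervalIntegral.norm_integral_le_of_norm_le_const (a := (0 : ℝ)) (b := 1)
    (f := fun s => inner ℝ (g (x + s • (y - x))) (y - x) - inner ℝ (g x) (y - x))
    (C := e * ‖y - x‖) (by
      intro s hs
      rw [uIoc_of_le zero_le_one] at hs
      rw [← inner_sub_left]
      refine (norm_inner_le_norm _ _).trans (mul_le_mul_of_nonneg_right ?_ (norm_nonneg _))
      rw [← dist_eq_norm]
      exact (hcont ((Metric.mem_ball.1 (hseg s ⟨hs.1.le, hs.2⟩)).trans_le (min_le_right _ _))).le)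
  simpa using this

/-- A continuous function which is locally Lipschitz in `Ω` has its almost everywhere gradient as
weak gradient. -/
lemma hasWeakGradient_of_lipschitz (hΩ : IsOpen Ω)
    (hlip : ∀ x ∈ Ω, ∃ r > 0, ∃ M, Metric.ball x r ⊆ Ω ∧ LipschitzOnWith M u (Metric.ball x r))
    (hg : IntegrableOn g Ω) (hgrad : ∀ᵐ x ∂volume.restrict Ω, HasGradientAt u (g x) x) :
    HasWeakGradient Ω u g := by
  refine ⟨hg.locallyIntegrableOn, fun φ hφ => ?_⟩
  obtain ⟨δ, hδ, hthick⟩ := hφ.hasCompactSupport.isCompact.exists_cthickening_subset_open hΩ hφ.2.2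
  have hK' : IsCompact (Metric.cthickening δ (tsupport φ)) :=
    hφ.hasCompactSupport.isCompact.cthickening
  have hloc : LocallyLipschitzOn (Metric.cthickening δ (tsupport φ)) u := by
    intro x hx
    obtain ⟨r, hr, M, -, hM⟩ := hlip x (hthick hx)
    exact ⟨M, _, mem_nhdsWithin_of_mem_nhds (Metric.ball_mem_nhds x hr), hM⟩
  obtain ⟨M, hM⟩ := hloc.exists_lipschitzOnWith_of_compact hK'
  obtain ⟨f, hf, hfu⟩ := hM.extend_real
  have hnear : ∀ x ∈ tsupport φ, f =ᶠ[nhds x] u := fun x hx => by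
    filter_upwards [Metric.ball_mem_nhds x hδ] with y hy
    exact (hfu (Metric.mem_cthickening_of_dist_le y x _ _ hx (Metric.mem_ball.1 hy).le)).symm
  obtain ⟨D, hD⟩ := ContDiff.lipschitzWith_of_hasCompactSupport hφ.hasCompactSupport
    hφ.contDiff (by norm_num)
  have hdφ : ∀ x, DifferentiableAt ℝ φ x := fun x => hφ.1.differentiable (by norm_num) x
  have i1 : IntegrableOn (fun x => u x • gradient φ x) Ω := by
    have hc : Continuous fun x => f x • gradient φ x := hf.continuous.smul hφ.continuous_gradient
    have hcs : HasCompactSupport fun x => f x • gradient φ x := by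
      refine hφ.hasCompactSupport_gradient.mono fun y hy => ?_
      contrapose hy
      simp only [Function.mem_support, not_not] at hy ⊢
      rw [hy, smul_zero]
    have hi : Integrable (fun x => f x • gradient φ x) volume :=
      hc.integrable_of_hasCompactSupport hcs
    refine hi.integrableOn.congr (ae_of_all _ fun x => ?_)
    by_cases hx : x ∈ tsupport φ
    · simp only [(hnear x hx).eq_of_nhds]
    · have h0 : gradient φ x = 0 := by
        have : fderiv ℝ φ x = 0 :=
          image_eq_zero_of_notMem_tsupport fun h' => hx (tsupport_fderiv_subset ℝ h')
        unfold gradient; rw [this, map_zero]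
      simp [h0]
  have i2 : IntegrableOn (fun x => φ x • g x) Ω :=
    (hφ.integrable_smul hg.locallyIntegrableOn).integrableOn
  refine ext_inner_right ℝ fun w => ?_
  rw [inner_neg_left, real_inner_comm, ← integral_inner i1, real_inner_comm,
    ← integral_inner i2]
  have hmain := hf.integral_lineDeriv_mul_eq (μ := volume) hD hφ.hasCompactSupport w
  have e1 : ∫ x in Ω, inner ℝ w (u x • gradient φ x) =
      -∫ x, lineDeriv ℝ φ x (-w) * f x := by
    rw [← integral_neg, setIntegral_eq_integral_of_forall_compl_eq_zero]
    · congr 1; ext x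
      rw [inner_smul_right, real_inner_comm, inner_gradient_left, (hdφ x).lineDeriv_eq_fderiv,
        map_neg]
      by_cases hx : x ∈ tsupport φ
      · rw [(hnear x hx).eq_of_nhds]; ring
      · have : fderiv ℝ φ x = 0 :=
          image_eq_zero_of_notMem_tsupport fun h' => hx (tsupport_fderiv_subset ℝ h')
        simp [this]
    · intro x hx
      rw [inner_smul_right, real_inner_comm, inner_gradient_left, hφ.fderiv_eq_zero hx]; simp
  have e2 : ∫ x in Ω, inner ℝ w (φ x • g x) = ∫ x, lineDeriv ℝ f x w * φ x := by
    have e0 : ∫ x in Ω, lineDeriv ℝ f x w * φ x = ∫ x, lineDeriv ℝ f x w * φ x :=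
      setIntegral_eq_integral_of_forall_compl_eq_zero
        (fun x hx => by rw [hφ.eq_zero hx, mul_zero])
    rw [← e0]
    refine integral_congr_ae ?_
    filter_upwards [hgrad] with x hx
    rw [inner_smul_right]
    by_cases hxs : x ∈ tsupport φ
    · have h1 : HasFDerivAt f _ x := (hx.hasFDerivAt).congr_of_eventuallyEq (hnear x hxs)
      rw [h1.differentiableAt.lineDeriv_eq_fderiv, h1.fderiv, InnerProductSpace.toDual_apply_apply,
        real_inner_comm]
      ring
    · rw [image_eq_zero_of_notMem_tsupport hxs]; simp
  rw [e1, e2, hmain]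

end LineIntegral

/-! ### The dual problem -/

section Dual

variable {d : ℕ} {μ b ε : ℝ} {Ω : Set (Pt d)} {n : Pt d → Pt d} {τ : Pt d → Pt d}

/-- The dual algebraic equation `4 ζ² (c ζ + α) = |τ|²` at a point where `ζ = z` and `|τ| = s`. -/
def IsDualRoot (μ b ε s z : ℝ) : Prop := 4 * z ^ 2 * (cc μ b * z + alpha b ε) = s ^ 2

/-- The density of `-Π₂ᵈ` at a point where `ζ = z` and `|τ| = s`. -/
noncomputable def dualDensity (μ b ε s z : ℝ) : ℝ :=
  s ^ 2 / (4 * z) + 1 / 2 * cc μ b * z ^ 2 + alpha b ε * z + beta0 μ b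

lemma dualEnergy_eq (ζ : Pt d → ℝ) :
    dualEnergy μ b ε Ω τ ζ = -∫ x in Ω, dualDensity μ b ε ‖τ x‖ (ζ x) := rfl

lemma zbar_root (hμ : 0 < μ) (hb : 0 < b) (hα : 0 < alpha b ε) {i : Fin 3} {x : Pt d}
    (h : (cardano μ b ε i ‖τ x‖).im = 0) : IsDualRoot μ b ε ‖τ x‖ (zbar μ b ε τ i x) :=
  cardano_re_root hμ hb hα h

lemma IsDualRoot.bounds (hμ : 0 < μ) (hb : 0 < b) (hα : 0 < alpha b ε) {s z : ℝ}
    (h : IsDualRoot μ b ε s z) :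
    0 ≤ cc μ b * z + alpha b ε ∧ z ≤ 1 + s ^ 2 / (4 * cc μ b) := by
  have hc := cc_pos hμ hb
  unfold IsDualRoot at h
  constructor
  · by_contra! hneg
    have hz : z ≠ 0 := by
      rintro rfl; linarith
    have : 0 < z ^ 2 := by positivity
    nlinarith [sq_nonneg s]
  · by_cases hz : z ≤ 1
    · have : 0 ≤ s ^ 2 / (4 * cc μ b) := by positivity
      linarith
    · push Not at hz
      have h1 : z ≤ s ^ 2 / (4 * cc μ b) := by
        rw [le_div_iff₀ (by positivity), ← h]
        have h2 : 1 ≤ z ^ 2 := by nlinarith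
        have h3 : 0 < cc μ b * z := by positivity
        nlinarith [mul_le_mul h2 (le_refl (cc μ b * z)) h3.le (by positivity)]
      linarith

lemma IsDualRoot.eq_zero_of_zero {s : ℝ} (h : IsDualRoot μ b ε s 0) : s = 0 := by
  unfold IsDualRoot at h
  have : s ^ 2 = 0 := by rw [← h]; ring
  exact pow_eq_zero_iff (two_ne_zero) |>.1 this

/-- Comparison of the dual density at `ζ` with its value at a root `z` of the dual algebraic
equation. -/
lemma dualDensity_sub {s z ζ : ℝ} (h : IsDualRoot μ b ε s z) (hζ : ζ ≠ 0) :
    dualDensity μ b ε s ζ - dualDensity μ b ε s z =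
      (ζ - z) ^ 2 / ζ * (alpha b ε + cc μ b * (ζ + 2 * z) / 2) := by
  unfold dualDensity
  unfold IsDualRoot at h
  rw [← h]
  by_cases hz : z = 0
  · subst hz; field_simp; ring
  · field_simp; ring

lemma mem_dualDomain_iff {ζ : Pt d → ℝ} (hτ : AEStronglyMeasurable τ (volume.restrict Ω)) :
    ζ ∈ DualDomain Ω τ ↔ MemLp ζ 2 (volume.restrict Ω) ∧
      (∀ᵐ x ∂volume.restrict Ω, τ x ≠ 0 → ζ x ≠ 0) ∧
      IntegrableOn (fun x => ‖τ x‖ ^ 2 / ζ x) Ω := by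
  have hen : ∀ x, ζ x ≠ 0 → ‖‖τ x‖ ^ 2 / ζ x‖ₑ = ‖τ x‖ₑ ^ 2 / ‖ζ x‖ₑ := fun x hx => by
    rw [div_eq_mul_inv, enorm_mul, enorm_inv hx, enorm_pow, enorm_norm, ENNReal.div_eq_inv_mul,
      mul_comm]
  have hz : ∀ x, (τ x ≠ 0 → ζ x ≠ 0) → ‖‖τ x‖ ^ 2 / ζ x‖ₑ = ‖τ x‖ₑ ^ 2 / ‖ζ x‖ₑ := fun x hx => by
    by_cases h0 : ζ x = 0
    · have : τ x = 0 := by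
        by_contra h; exact hx h h0
      simp [h0, this]
    · exact hen x h0
  have hmeas : MemLp ζ 2 (volume.restrict Ω) →
      AEStronglyMeasurable (fun x => ‖τ x‖ ^ 2 / ζ x) (volume.restrict Ω) := fun h =>
    (hτ.norm.pow 2).div₀ h.1
  constructor
  · rintro ⟨h1, h2⟩
    have hm : AEMeasurable (fun x => ‖τ x‖ₑ ^ 2 / ‖ζ x‖ₑ) (volume.restrict Ω) :=
      (hτ.enorm.pow_const 2).div h1.1.enorm
    have hne : ∀ᵐ x ∂volume.restrict Ω, τ x ≠ 0 → ζ x ≠ 0 := by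
      filter_upwards [ae_lt_top' hm h2.ne] with x hx hτx h0
      rw [h0, enorm_zero, ENNReal.div_zero (by simpa using hτx)] at hx
      exact lt_irrefl _ hx
    refine ⟨h1, hne, hmeas h1, ?_⟩
    rw [hasFiniteIntegral_iff_enorm, lintegral_congr_ae (hne.mono fun x hx => hz x hx)]
    exact h2
  · rintro ⟨h1, h2, h3⟩
    refine ⟨h1, ?_⟩
    rw [← lintegral_congr_ae (h2.mono fun x hx => hz x hx)]
    exact h3.2

lemma integrable_dualDensity [IsFiniteMeasure (volume.restrict Ω)]
    (hτ : AEStronglyMeasurable τ (volume.restrict Ω)) {ζ : Pt d → ℝ} (hζ : ζ ∈ DualDomain Ω τ) :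
    IntegrableOn (fun x => dualDensity μ b ε ‖τ x‖ (ζ x)) Ω := by
  obtain ⟨h1, -, h3⟩ := (mem_dualDomain_iff hτ).1 hζ
  have i1 : IntegrableOn (fun x => ‖τ x‖ ^ 2 / (4 * ζ x)) Ω := by
    refine (h3.const_mul (1 / 4)).congr (ae_of_all _ fun x => ?_)
    simp only
    rw [mul_comm 4, ← div_div]; ring
  have i2 : IntegrableOn (fun x => 1 / 2 * cc μ b * ζ x ^ 2) Ω := h1.integrable_sq.const_mul _
  have i3 : IntegrableOn (fun x => alpha b ε * ζ x) Ω := (h1.integrable (by norm_num)).const_mul _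
  exact ((i1.add i2).add i3).add (integrable_const _)

lemma IsRegion.aestronglyMeasurable (hΩ : IsRegion Ω n) (hτ : ContinuousOn τ (closure Ω)) :
    AEStronglyMeasurable τ (volume.restrict Ω) :=
  (hτ.mono subset_closure).aestronglyMeasurable hΩ.isOpen.measurableSet

lemma IsRegion.exists_bound (hΩ : IsRegion Ω n) (hτ : ContinuousOn τ (closure Ω)) :
    ∃ S : ℝ, 0 ≤ S ∧ ∀ x ∈ closure Ω, ‖τ x‖ ≤ S := by
  obtain ⟨C, hC⟩ := hΩ.isCompact_closure.exists_bound_of_continuousOn hτ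
  exact ⟨max C 0, le_max_right _ _, fun x hx => (hC x hx).trans (le_max_left _ _)⟩

lemma aestronglyMeasurable_zbar (hτ : AEStronglyMeasurable τ (volume.restrict Ω)) (i : Fin 3) :
    AEStronglyMeasurable (zbar μ b ε τ i) (volume.restrict Ω) :=
  ((measurable_cardano i).comp_aemeasurable hτ.norm.aemeasurable).aestronglyMeasurable

/-- Solutions of the dual algebraic equation are bounded and lie in the domain of `Π₂ᵈ`. -/
lemma mem_dualDomain_of_root (hμ : 0 < μ) (hb : 0 < b) (hα : 0 < alpha b ε)
    (hΩ : IsRegion Ω n) (hτ : ContinuousOn τ (closure Ω)) {ζ : Pt d → ℝ}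
    (hζ : AEStronglyMeasurable ζ (volume.restrict Ω))
    (hroot : ∀ᵐ x ∂volume.restrict Ω, IsDualRoot μ b ε ‖τ x‖ (ζ x)) :
    ζ ∈ DualDomain Ω τ := by
  have hc := cc_pos hμ hb
  have := hΩ.finite_volume
  have hτm := hΩ.aestronglyMeasurable hτ
  obtain ⟨S, hS0, hS⟩ := hΩ.exists_bound hτ
  set B : ℝ := 1 + S ^ 2 / (4 * cc μ b) + alpha b ε / cc μ b with hB
  have hB0 : 0 ≤ B := by positivity
  have hbd : ∀ᵐ x ∂volume.restrict Ω, |ζ x| ≤ B := by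
    filter_upwards [hroot, ae_restrict_mem hΩ.isOpen.measurableSet] with x hx hxΩ
    obtain ⟨h1, h2⟩ := hx.bounds hμ hb hα
    have h3 : ‖τ x‖ ^ 2 / (4 * cc μ b) ≤ S ^ 2 / (4 * cc μ b) := by
      gcongr; exact hS x (subset_closure hxΩ)
    have h4 : -(alpha b ε / cc μ b) ≤ ζ x := by
      rw [← neg_div, div_le_iff₀ hc]; linarith
    have h5 : 0 ≤ alpha b ε / cc μ b := by positivity
    have h6 : 0 ≤ S ^ 2 / (4 * cc μ b) := by positivity
    exact abs_le.2 ⟨by linarith, by linarith⟩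
  rw [mem_dualDomain_iff hτm]
  refine ⟨MemLp.of_bound hζ B (by simpa using hbd), ?_, ?_⟩
  · filter_upwards [hroot] with x hx hτx h0
    rw [h0] at hx
    exact hτx (norm_eq_zero.1 hx.eq_zero_of_zero)
  · refine Integrable.of_bound ((hτm.norm.pow 2).div₀ hζ) (4 * B * (cc μ b * B + alpha b ε)) ?_
    filter_upwards [hroot, hbd] with x hx hxB
    have hpos := (hx.bounds hμ hb hα).1
    have e : ‖τ x‖ ^ 2 / ζ x = 4 * ζ x * (cc μ b * ζ x + alpha b ε) := by
      by_cases h0 : ζ x = 0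
      · simp [h0]
      · rw [← hx]; field_simp
    rw [e, Real.norm_eq_abs, abs_mul, abs_mul, abs_of_pos (four_pos), abs_of_nonneg hpos]
    gcongr
    exact (le_abs_self _).trans hxB

lemma zbar_mem_dualDomain (hμ : 0 < μ) (hb : 0 < b) (hα : 0 < alpha b ε)
    (hΩ : IsRegion Ω n) (hτ : ContinuousOn τ (closure Ω)) {i : Fin 3}
    (him : ∀ x ∈ Ω, (cardano μ b ε i ‖τ x‖).im = 0) : zbar μ b ε τ i ∈ DualDomain Ω τ :=
  mem_dualDomain_of_root hμ hb hα hΩ hτ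
    (aestronglyMeasurable_zbar (hΩ.aestronglyMeasurable hτ) i)
    (ae_restrict_of_forall_mem hΩ.isOpen.measurableSet fun x hx => zbar_root hμ hb hα (him x hx))

/-- Pointwise comparison of densities gives comparison of dual energies. -/
lemma dualEnergy_le_of_density_le (hΩ : IsRegion Ω n) (hτ : ContinuousOn τ (closure Ω))
    {ζ ξ : Pt d → ℝ} (hζ : ζ ∈ DualDomain Ω τ) (hξ : ξ ∈ DualDomain Ω τ)
    (h : ∀ᵐ x ∂volume.restrict Ω,
      dualDensity μ b ε ‖τ x‖ (ζ x) ≤ dualDensity μ b ε ‖τ x‖ (ξ x)) :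
    dualEnergy μ b ε Ω τ ξ ≤ dualEnergy μ b ε Ω τ ζ := by
  have := hΩ.finite_volume
  have hτm := hΩ.aestronglyMeasurable hτ
  rw [dualEnergy_eq, dualEnergy_eq, neg_le_neg_iff]
  exact integral_mono_ae (integrable_dualDensity hτm hζ) (integrable_dualDensity hτm hξ) h

/-- The pointwise derivative of the dual density along a line. -/
lemma hasDerivAt_dualDensity {s z h r : ℝ} (hne : s ≠ 0 → z + r * h ≠ 0) :
    HasDerivAt (fun r => dualDensity μ b ε s (z + r * h))
      ((-(s ^ 2 / (4 * (z + r * h) ^ 2)) + cc μ b * (z + r * h) + alpha b ε) * h) r := by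
  have hl : HasDerivAt (fun r => z + r * h) h r := by
    simpa using ((hasDerivAt_id r).mul_const h).const_add z
  have h2 : HasDerivAt (fun r => 1 / 2 * cc μ b * (z + r * h) ^ 2 + alpha b ε * (z + r * h)
      + beta0 μ b) ((cc μ b * (z + r * h) + alpha b ε) * h) r := by
    refine ((((hl.pow 2).const_mul (1 / 2 * cc μ b)).add (hl.const_mul (alpha b ε))).add_const
      (beta0 μ b)).congr_deriv ?_
    norm_num; ring
  by_cases hs : s = 0
  · subst hs
    have : (fun r => dualDensity μ b ε 0 (z + r * h)) = fun r =>
        1 / 2 * cc μ b * (z + r * h) ^ 2 + alpha b ε * (z + r * h) + beta0 μ b := by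
      ext r; unfold dualDensity; simp
    rw [this]
    refine h2.congr_deriv ?_
    simp
  · have h0 := hne hs
    have h1 : HasDerivAt (fun r => s ^ 2 / (4 * (z + r * h)))
        (-(s ^ 2 / (4 * (z + r * h) ^ 2)) * h) r := by
      refine (((hl.const_mul 4).inv (mul_ne_zero four_ne_zero h0)).const_mul (s ^ 2)).congr_deriv ?_
      field_simp
    have : (fun r => dualDensity μ b ε s (z + r * h)) = fun r => s ^ 2 / (4 * (z + r * h)) +
        (1 / 2 * cc μ b * (z + r * h) ^ 2 + alpha b ε * (z + r * h) + beta0 μ b) := by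
      ext r; unfold dualDensity; ring
    rw [this]
    refine (h1.add h2).congr_deriv ?_
    ring

/-- The first variation of the dual energy. -/
lemma hasDerivAt_dualEnergy (hμ : 0 < μ) (hb : 0 < b) (hα : 0 < alpha b ε)
    (hΩ : IsRegion Ω n) (hτ : ContinuousOn τ (closure Ω)) {ζ h : Pt d → ℝ}
    (hζ : ζ ∈ DualDomain Ω τ) (hh : IsVariation Ω τ ζ h) :
    IntegrableOn (fun x =>
      (-(‖τ x‖ ^ 2 / (4 * ζ x ^ 2)) + cc μ b * ζ x + alpha b ε) * h x) Ω ∧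
    HasDerivAt (fun r : ℝ => dualEnergy μ b ε Ω τ (ζ + r • h))
      (-∫ x in Ω, (-(‖τ x‖ ^ 2 / (4 * ζ x ^ 2)) + cc μ b * ζ x + alpha b ε) * h x) 0 := by
  have hc := cc_pos hμ hb
  have := hΩ.finite_volume
  have hτm := hΩ.aestronglyMeasurable hτ
  obtain ⟨h1, h2, h3⟩ := (mem_dualDomain_iff hτm).1 hζ
  obtain ⟨hL, K₀, hK₀⟩ := hh
  obtain ⟨K, hK0, hK⟩ : ∃ K : ℝ, 0 < K ∧ ∀ᵐ x ∂volume.restrict Ω, τ x ≠ 0 → |h x| ≤ K * |ζ x| := by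
    refine ⟨|K₀| + 1, by positivity, hK₀.mono fun x hx hτx => (hx hτx).trans ?_⟩
    exact mul_le_mul_of_nonneg_right (by linarith [le_abs_self K₀]) (abs_nonneg _)
  set ρ : ℝ := min 1 (1 / (2 * K)) with hρ
  have hρ0 : 0 < ρ := by positivity
  have hlow : ∀ᵐ x ∂volume.restrict Ω, ∀ r ∈ Metric.ball (0 : ℝ) ρ, τ x ≠ 0 →
      |ζ x| / 2 ≤ |ζ x + r * h x| := by
    filter_upwards [hK] with x hx r hr hτx
    rw [mem_ball_zero_iff, Real.norm_eq_abs] at hr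
    have h4 : |r * h x| ≤ |ζ x| / 2 := by
      rw [abs_mul]
      calc |r| * |h x| ≤ 1 / (2 * K) * (K * |ζ x|) := by
            gcongr
            · exact hr.le.trans (min_le_right _ _)
            · exact hx hτx
        _ = |ζ x| / 2 := by field_simp
    have h5 := abs_sub_abs_le_abs_sub (ζ x) (-(r * h x))
    rw [sub_neg_eq_add, abs_neg] at h5
    linarith
  set F : ℝ → Pt d → ℝ := fun r x => dualDensity μ b ε ‖τ x‖ (ζ x + r * h x) with hF
  set F' : ℝ → Pt d → ℝ := fun r x =>
    (-(‖τ x‖ ^ 2 / (4 * (ζ x + r * h x) ^ 2)) + cc μ b * (ζ x + r * h x) + alpha b ε) * h x with hF'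
  set bound : Pt d → ℝ := fun x => K * |‖τ x‖ ^ 2 / ζ x| + cc μ b * |ζ x * h x| +
    cc μ b * h x ^ 2 + alpha b ε * |h x| with hbound
  have hsm : AEStronglyMeasurable (fun x => ‖τ x‖ ^ 2) (volume.restrict Ω) := hτm.norm.pow 2
  have hlm : ∀ r : ℝ, AEStronglyMeasurable (fun x => ζ x + r * h x) (volume.restrict Ω) :=
    fun r => h1.1.add (hL.1.const_mul r)
  have hFm : ∀ r, AEStronglyMeasurable (F r) (volume.restrict Ω) := fun r =>
    (((hsm.div₀ ((hlm r).const_mul 4)).add (((hlm r).pow 2).const_mul _)).add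
      ((hlm r).const_mul _)).add aestronglyMeasurable_const
  have hF'm : ∀ r, AEStronglyMeasurable (F' r) (volume.restrict Ω) := fun r =>
    (((hsm.div₀ (((hlm r).pow 2).const_mul 4)).neg.add ((hlm r).const_mul _)).add
      aestronglyMeasurable_const).mul hL.1
  have hbi : Integrable bound (volume.restrict Ω) :=
    (((h3.abs.const_mul K).add ((h1.integrable_mul hL).abs.const_mul _)).add
      (hL.integrable_sq.const_mul _)).add ((hL.integrable (by norm_num)).abs.const_mul _)
  have hFi : Integrable (F 0) (volume.restrict Ω) := by
    simpa [hF] using! integrable_dualDensity (μ := μ) (b := b) (ε := ε) hτm hζ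
  have key := hasDerivAt_integral_of_dominated_loc_of_deriv_le (μ := volume.restrict Ω)
    (F := F) (F' := F') (x₀ := (0 : ℝ)) (bound := bound) (Metric.ball_mem_nhds 0 hρ0)
    (Filter.Eventually.of_forall hFm) hFi (hF'm 0) ?_ hbi ?_
  · refine ⟨by simpa [hF'] using! key.1, ?_⟩
    have e : ∫ x in Ω, F' 0 x =
        ∫ x in Ω, (-(‖τ x‖ ^ 2 / (4 * ζ x ^ 2)) + cc μ b * ζ x + alpha b ε) * h x := by
      simp [hF']
    rw [← e]
    exact key.2.neg
  · filter_upwards [hlow, hK, h2] with x hx hKx hne r hr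
    have hr1 : |r| ≤ 1 := by
      rw [mem_ball_zero_iff, Real.norm_eq_abs] at hr
      exact hr.le.trans (min_le_left _ _)
    have t1 : |‖τ x‖ ^ 2 / (4 * (ζ x + r * h x) ^ 2)| * |h x| ≤ K * |‖τ x‖ ^ 2 / ζ x| := by
      by_cases hτx : τ x = 0
      · simp [hτx]
      have hz := abs_pos.2 (hne hτx)
      have hl := hx r hr hτx
      have hl2 : |ζ x| ^ 2 ≤ 4 * (ζ x + r * h x) ^ 2 := by
        rw [← sq_abs (ζ x + r * h x)]
        have := pow_le_pow_left₀ (by positivity) hl 2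
        linarith [this, (by ring : (|ζ x| / 2) ^ 2 = |ζ x| ^ 2 / 4)]
      rw [abs_div, abs_div, abs_of_nonneg (by positivity : 0 ≤ 4 * (ζ x + r * h x) ^ 2)]
      calc |‖τ x‖ ^ 2| / (4 * (ζ x + r * h x) ^ 2) * |h x|
          ≤ |‖τ x‖ ^ 2| / |ζ x| ^ 2 * (K * |ζ x|) := by
            gcongr
            exact hKx hτx
        _ = K * (|‖τ x‖ ^ 2| / |ζ x|) := by field_simp
    have t2 : |r * h x| ≤ |h x| := by
      rw [abs_mul]; exact mul_le_of_le_one_left (abs_nonneg _) hr1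
    simp only [hF', hbound, Real.norm_eq_abs]
    calc |(-(‖τ x‖ ^ 2 / (4 * (ζ x + r * h x) ^ 2)) + cc μ b * (ζ x + r * h x) + alpha b ε) * h x|
        = |-(‖τ x‖ ^ 2 / (4 * (ζ x + r * h x) ^ 2)) + cc μ b * (ζ x + r * h x) + alpha b ε|
          * |h x| := abs_mul _ _
      _ ≤ (|‖τ x‖ ^ 2 / (4 * (ζ x + r * h x) ^ 2)| + cc μ b * (|ζ x| + |h x|) + alpha b ε)
          * |h x| := by
          refine mul_le_mul_of_nonneg_right ?_ (abs_nonneg _)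
          refine (abs_add_three _ _ _).trans ?_
          rw [abs_neg, abs_mul, abs_of_pos hc, abs_of_pos hα]
          gcongr
          exact (abs_add_le _ _).trans (by gcongr)
      _ = |‖τ x‖ ^ 2 / (4 * (ζ x + r * h x) ^ 2)| * |h x| + cc μ b * |ζ x * h x| +
          cc μ b * h x ^ 2 + alpha b ε * |h x| := by
          rw [abs_mul, ← sq_abs (h x)]; ring
      _ ≤ _ := by gcongr
  · filter_upwards [hlow, h2] with x hx hne r hr
    refine hasDerivAt_dualDensity fun hs h0 => ?_
    have hτx : τ x ≠ 0 := fun h => hs (by rw [h, norm_zero])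
    have h5 := hx r hr hτx
    rw [h0, abs_zero] at h5
    have := abs_pos.2 (hne hτx)
    linarith

/-- The critical points of the dual energy are the solutions of the dual algebraic equation that
vanish almost nowhere. -/
theorem isCriticalDual_iff (hμ : 0 < μ) (hb : 0 < b) (hα : 0 < alpha b ε)
    (hΩ : IsRegion Ω n) (hτ : ContinuousOn τ (closure Ω)) {ζ : Pt d → ℝ}
    (hζm : AEStronglyMeasurable ζ (volume.restrict Ω)) :
    IsCriticalDual μ b ε Ω τ ζ ↔
      ∀ᵐ x ∂volume.restrict Ω, ζ x ≠ 0 ∧ IsDualRoot μ b ε ‖τ x‖ (ζ x) := by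
  have hc := cc_pos hμ hb
  have := hΩ.finite_volume
  have hτm := hΩ.aestronglyMeasurable hτ
  have hroot : ∀ {s z : ℝ}, z ≠ 0 → (-(s ^ 2 / (4 * z ^ 2)) + cc μ b * z + alpha b ε = 0 ↔
      IsDualRoot μ b ε s z) := by
    intro s z hz
    unfold IsDualRoot
    constructor
    · intro h
      field_simp at h
      linarith
    · intro h
      rw [← h]; field_simp; ring
  constructor
  · rintro ⟨hdom, hcrit⟩
    obtain ⟨h1, h2, h3⟩ := (mem_dualDomain_iff hτm).1 hdom
    have hzero : ∀ h, IsVariation Ω τ ζ h →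
        ∫ x in Ω, (-(‖τ x‖ ^ 2 / (4 * ζ x ^ 2)) + cc μ b * ζ x + alpha b ε) * h x = 0 := by
      intro h hh
      have := (hasDerivAt_dualEnergy hμ hb hα hΩ hτ hdom hh).2.unique (hcrit h hh)
      linarith
    obtain ⟨T, hT, hTτ⟩ := exists_continuous_extension isClosed_closure hτ
    have hTΩ : ∀ᵐ x ∂volume.restrict Ω, T x = τ x :=
      ae_restrict_of_forall_mem hΩ.isOpen.measurableSet fun x hx => hTτ (subset_closure hx)
    set E : Pt d → ℝ := fun x => -(‖τ x‖ ^ 2 / (4 * ζ x ^ 2)) + cc μ b * ζ x + alpha b ε with hE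
    -- On `{τ = 0}` every square-integrable variation is admissible, in particular `c ζ + α`.
    have hZm : MeasurableSet {x | T x = 0} := (isClosed_singleton.preimage hT).measurableSet
    set k : Pt d → ℝ := {x | T x = 0}.indicator (fun x => cc μ b * ζ x + alpha b ε) with hk
    have hkv : IsVariation Ω τ ζ k := by
      refine ⟨((h1.const_mul _).add (memLp_const _)).indicator hZm, 0, ?_⟩
      filter_upwards [hTΩ] with x hx hτx
      rw [hk, indicator_of_notMem (by rw [mem_ofPred_eq, hx]; exact hτx)]
      simp
    have hEk : ∀ᵐ x ∂volume.restrict Ω, E x * k x = k x ^ 2 := by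
      filter_upwards [hTΩ] with x hx
      by_cases hτx : τ x = 0
      · have : k x = cc μ b * ζ x + alpha b ε := indicator_of_mem (by rw [mem_ofPred_eq, hx, hτx]) _
        rw [this]; simp only [hE, hτx]; simp; ring
      · have : k x = 0 := indicator_of_notMem (by rw [mem_ofPred_eq, hx]; exact hτx) _
        rw [this]; ring
    have hk0 : ∀ᵐ x ∂volume.restrict Ω, k x = 0 := by
      have i1 := hzero k hkv
      rw [integral_congr_ae hEk, integral_eq_zero_iff_of_nonneg_ae
        (ae_of_all _ fun x => sq_nonneg _) hkv.1.integrable_sq] at i1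
      filter_upwards [i1] with x hx
      exact pow_eq_zero_iff two_ne_zero |>.1 hx
    -- Elsewhere the variation is proportional to `ζ`, with a bounded factor of the sign of `ζ E`.
    set w : Pt d → ℝ := fun x => ζ x * (ζ x * E x / (1 + |ζ x * E x|)) with hw
    have hEm : AEStronglyMeasurable E (volume.restrict Ω) :=
      (((hτm.norm.pow 2).div₀ ((h1.1.pow 2).const_mul 4)).neg.add (h1.1.const_mul _)).add
        aestronglyMeasurable_const
    have hwm : AEStronglyMeasurable w (volume.restrict Ω) :=
      h1.1.mul ((h1.1.mul hEm).div₀ (aestronglyMeasurable_const.add (h1.1.mul hEm).norm))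
    have hwle : ∀ x, |w x| ≤ |ζ x| := fun x => by
      rw [hw]
      simp only [abs_mul, abs_div]
      refine mul_le_of_le_one_right (abs_nonneg _) ?_
      rw [abs_of_nonneg (by positivity : 0 ≤ 1 + |ζ x| * |E x|), div_le_one (by positivity)]
      linarith
    have hwv : IsVariation Ω τ ζ w :=
      ⟨h1.mono hwm (ae_of_all _ hwle), 1, ae_of_all _ fun x _ => by rw [one_mul]; exact hwle x⟩
    have hw0 : ∀ᵐ x ∂volume.restrict Ω, ζ x * E x = 0 := by
      have i1 := hzero w hwv
      have i2 := (hasDerivAt_dualEnergy hμ hb hα hΩ hτ hdom hwv).1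
      have hEw : ∀ x, E x * w x = (ζ x * E x) ^ 2 / (1 + |ζ x * E x|) := fun x => by
        rw [hw]; ring
      change ∫ x in Ω, E x * w x = 0 at i1
      change IntegrableOn (fun x => E x * w x) Ω at i2
      rw [integral_eq_zero_iff_of_nonneg_ae (ae_of_all _ fun x => by
        change 0 ≤ E x * w x
        rw [hEw]; positivity) i2] at i1
      filter_upwards [i1] with x hx
      change E x * w x = 0 at hx
      rw [hEw, div_eq_zero_iff] at hx
      rcases hx with hx | hx
      · exact pow_eq_zero_iff two_ne_zero |>.1 hx
      · have := abs_nonneg (ζ x * E x)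
        linarith
    filter_upwards [hk0, hw0, hTΩ, h2] with x hx1 hx2 hx3 hx4
    by_cases hτx : τ x = 0
    · rw [hk, indicator_of_mem (by rw [mem_ofPred_eq, hx3, hτx])] at hx1
      refine ⟨fun h0 => ?_, ?_⟩
      · rw [h0] at hx1; linarith
      · unfold IsDualRoot
        rw [hx1, hτx]; simp
    · have hz := hx4 hτx
      exact ⟨hz, (hroot hz).1 ((mul_eq_zero.1 hx2).resolve_left hz)⟩
  · intro h
    have hdom := mem_dualDomain_of_root hμ hb hα hΩ hτ hζm (h.mono fun x hx => hx.2)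
    refine ⟨hdom, fun k hk => ?_⟩
    have hd := (hasDerivAt_dualEnergy hμ hb hα hΩ hτ hdom hk).2
    rw [integral_eq_zero_of_ae, neg_zero] at hd
    · exact hd
    · filter_upwards [h] with x hx
      simp only [Pi.zero_apply]
      rw [(hroot hx.1).2 hx.2, zero_mul]

end Dual

/-! ### The displacements given by the dual solutions -/

section Displacement

variable {d : ℕ} {μ b ε : ℝ} {Ω Γu : Set (Pt d)} {n : Pt d → Pt d} {τ : Pt d → Pt d}

/-- The strain `(2 ζ̄ᵢ)⁻¹ τ` associated with the `i`-th root. -/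
noncomputable def strain (μ b ε : ℝ) (τ : Pt d → Pt d) (i : Fin 3) (x : Pt d) : Pt d :=
  (2 * zbar μ b ε τ i x)⁻¹ • τ x

lemma le_eta_on_closure (hτ : ContinuousOn τ (closure Ω))
    (h : ∀ x ∈ Ω, ‖τ x‖ ^ 2 ≤ eta μ b ε) : ∀ x ∈ closure Ω, ‖τ x‖ ^ 2 ≤ eta μ b ε := fun _ hx =>
  le_on_closure h (hτ.norm.pow 2) continuousOn_const hx

lemma continuousOn_zbar (hμ : 0 < μ) (hb : 0 < b) (hα : 0 < alpha b ε)
    (hτ : ContinuousOn τ (closure Ω)) {i : Fin 3}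
    (him : ∀ x ∈ Ω, (cardano μ b ε i ‖τ x‖).im = 0) :
    ContinuousOn (zbar μ b ε τ i) (closure Ω) := by
  by_cases hi : i = 0
  · subst hi
    exact (continuousOn_cardano_zero hμ hb hα).comp hτ.norm fun x _ => norm_nonneg _
  · have hle := le_eta_on_closure hτ fun x hx =>
      le_eta_of_cardano_im hμ hb hα (norm_nonneg _) hi (him x hx)
    exact (continuousOn_cardano_of_le hμ hb hα i).comp hτ.norm fun x hx =>
      ⟨norm_nonneg _, hle x hx⟩

lemma norm_sq_strain (hμ : 0 < μ) (hb : 0 < b) (hα : 0 < alpha b ε) {i : Fin 3} {x : Pt d}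
    (him : (cardano μ b ε i ‖τ x‖).im = 0) (hz : zbar μ b ε τ i x ≠ 0) :
    ‖strain μ b ε τ i x‖ ^ 2 = cc μ b * zbar μ b ε τ i x + alpha b ε := by
  have h := zbar_root hμ hb hα him
  unfold IsDualRoot at h
  rw [strain, norm_smul, mul_pow, ← h, norm_inv, inv_pow, Real.norm_eq_abs, sq_abs]
  field_simp
  norm_num

lemma smul_strain {i : Fin 3} {x : Pt d} (hz : zbar μ b ε τ i x ≠ 0) :
    (2 * zbar μ b ε τ i x) • strain μ b ε τ i x = τ x := by
  rw [strain, smul_smul, mul_inv_cancel₀ (mul_ne_zero two_ne_zero hz), one_smul]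

/-- The strain is bounded, since its squared norm is `c ζ̄ᵢ + α` or, where `ζ̄ᵢ = 0`, zero. -/
lemma exists_strain_bound (hμ : 0 < μ) (hb : 0 < b) (hα : 0 < alpha b ε)
    (hΩ : IsRegion Ω n) (hτ : ContinuousOn τ (closure Ω)) {i : Fin 3}
    (him : ∀ x ∈ Ω, (cardano μ b ε i ‖τ x‖).im = 0) :
    ∃ M : NNReal, ∀ x ∈ Ω, ‖strain μ b ε τ i x‖ ≤ M := by
  have hc := cc_pos hμ hb
  obtain ⟨S, hS0, hS⟩ := hΩ.exists_bound hτ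
  have hB : 0 ≤ cc μ b * (1 + S ^ 2 / (4 * cc μ b)) + alpha b ε := by positivity
  refine ⟨⟨√(cc μ b * (1 + S ^ 2 / (4 * cc μ b)) + alpha b ε), Real.sqrt_nonneg _⟩, fun x hx => ?_⟩
  refine Real.le_sqrt_of_sq_le ?_
  by_cases hz : zbar μ b ε τ i x = 0
  · rw [strain, hz]
    simpa using hB
  · rw [norm_sq_strain hμ hb hα (him x hx) hz]
    have h1 := ((zbar_root hμ hb hα (him x hx)).bounds hμ hb hα).2
    have h2 := hS x (subset_closure hx)
    gcongr
    refine h1.trans ?_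
    gcongr

lemma aestronglyMeasurable_strain (hτ : AEStronglyMeasurable τ (volume.restrict Ω)) (i : Fin 3) :
    AEStronglyMeasurable (strain μ b ε τ i) (volume.restrict Ω) :=
  (((aestronglyMeasurable_zbar hτ i).const_mul 2).aemeasurable.inv.aestronglyMeasurable).smul hτ

lemma memLp_strain (hμ : 0 < μ) (hb : 0 < b) (hα : 0 < alpha b ε)
    (hΩ : IsRegion Ω n) (hτ : ContinuousOn τ (closure Ω)) {i : Fin 3}
    (him : ∀ x ∈ Ω, (cardano μ b ε i ‖τ x‖).im = 0) (p : ENNReal) :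
    MemLp (strain μ b ε τ i) p (volume.restrict Ω) := by
  have := hΩ.finite_volume
  obtain ⟨M, hM⟩ := exists_strain_bound hμ hb hα hΩ hτ him
  exact MemLp.of_bound (aestronglyMeasurable_strain (hΩ.aestronglyMeasurable hτ) i) M
    (ae_restrict_of_forall_mem hΩ.isOpen.measurableSet hM)

variable {u : Pt d → ℝ} {i : Fin 3}

/-- The line integral of the strain has the strain as its weak gradient: the strain is bounded,
and continuous off the null set `{ζ̄ᵢ = 0}`. -/
lemma IsDualDisplacement.hasWeakGradient (hμ : 0 < μ) (hb : 0 < b) (hα : 0 < alpha b ε)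
    (hΩ : IsRegion Ω n) (hτ : ContinuousOn τ (closure Ω))
    (h : IsDualDisplacement μ b ε Ω Γu τ i u) : HasWeakGradient Ω u (strain μ b ε τ i) := by
  have := hΩ.finite_volume
  obtain ⟨him, hz, hl⟩ := h
  obtain ⟨M, hM⟩ := exists_strain_bound hμ hb hα hΩ hτ him
  have hl : IsLineIntegral Ω Γu (strain μ b ε τ i) u := hl
  refine hasWeakGradient_of_lipschitz hΩ.isOpen ?_
    ((memLp_strain hμ hb hα hΩ hτ him 1).integrable le_rfl) ?_
  · intro x hx
    obtain ⟨r, hr, hrΩ⟩ := Metric.isOpen_iff.1 hΩ.isOpen x hx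
    exact ⟨r, hr, M, hrΩ, hl.lipschitzOnWith hM hrΩ⟩
  · have hzc : ContinuousOn (zbar μ b ε τ i) Ω :=
      (continuousOn_zbar hμ hb hα hτ him).mono subset_closure
    have hW : IsOpen (Ω ∩ zbar μ b ε τ i ⁻¹' {0}ᶜ) :=
      hzc.isOpen_inter_preimage hΩ.isOpen (isOpen_compl_singleton (x := (0 : ℝ)))
    have hgc : ContinuousOn (strain μ b ε τ i) (Ω ∩ zbar μ b ε τ i ⁻¹' {0}ᶜ) := by
      have h2 : ContinuousOn (fun x => 2 * zbar μ b ε τ i x) (Ω ∩ zbar μ b ε τ i ⁻¹' {0}ᶜ) :=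
        (continuousOn_const (c := (2 : ℝ))).mul (hzc.mono inter_subset_left)
      exact (h2.inv₀ fun x hx => mul_ne_zero two_ne_zero hx.2).smul
        (hτ.mono (inter_subset_left.trans subset_closure))
    filter_upwards [hz, ae_restrict_mem hΩ.isOpen.measurableSet] with x hx hxΩ
    exact hl.hasGradientAt hW inter_subset_left hgc ⟨hxΩ, hx⟩

lemma IsDualDisplacement.mem_displacements (hμ : 0 < μ) (hb : 0 < b) (hα : 0 < alpha b ε)
    (hΩ : IsRegion Ω n) (hτ : ContinuousOn τ (closure Ω))
    (h : IsDualDisplacement μ b ε Ω Γu τ i u) : u ∈ Displacements Ω Γu :=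
  ⟨h.2.2.1, ⟨_, h.hasWeakGradient hμ hb hα hΩ hτ, memLp_strain hμ hb hα hΩ hτ h.1 4⟩, h.2.2.2.1⟩

lemma IsDualDisplacement.weakGradient_ae (hμ : 0 < μ) (hb : 0 < b) (hα : 0 < alpha b ε)
    (hΩ : IsRegion Ω n) (hτ : ContinuousOn τ (closure Ω))
    (h : IsDualDisplacement μ b ε Ω Γu τ i u) :
    weakGradient Ω u =ᵐ[volume.restrict Ω] strain μ b ε τ i :=
  (h.hasWeakGradient hμ hb hα hΩ hτ).weakGradient.ae_eq hΩ.isOpen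
    (h.hasWeakGradient hμ hb hα hΩ hτ)

end Displacement

/-! ### The potential energy -/

section Primal

variable {d : ℕ} {μ b ε : ℝ} {Ω Γu : Set (Pt d)} {n : Pt d → Pt d} {τ : Pt d → Pt d}
  {t : Pt d → ℝ}

lemma beta_mul_cc (hμ : 0 < μ) (hb : 0 < b) : beta μ b * cc μ b = 1 := by
  unfold beta cc; field_simp

lemma beta_pos (hμ : 0 < μ) (hb : 0 < b) : 0 < beta μ b := by
  unfold beta; positivity

lemma storedEnergy_eq (hb : 0 < b) (γ : Pt d) :
    storedEnergy μ b ε γ = beta μ b / 2 * (‖γ‖ ^ 2 - alpha b ε) ^ 2 - beta0 μ b := by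
  unfold storedEnergy beta alpha beta0
  field_simp
  ring

/-- The density of the potential energy, with the work of the traction moved into the interior. -/
noncomputable def primalDensity (μ b ε : ℝ) (σ γ : Pt d) : ℝ :=
  storedEnergy μ b ε γ - inner ℝ σ γ

lemma integrable_norm_pow [IsFiniteMeasure (volume.restrict Ω)] {g : Pt d → Pt d}
    (hg : MemLp g 4 (volume.restrict Ω)) {k : ℕ} (hk0 : k ≠ 0) (hk : k ≤ 4) :
    IntegrableOn (fun x => ‖g x‖ ^ k) Ω := by
  have h : MemLp g k (volume.restrict Ω) := hg.mono_exponent (by exact_mod_cast hk)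
  exact h.integrable_norm_pow hk0

lemma integrable_storedEnergy (hb : 0 < b) [IsFiniteMeasure (volume.restrict Ω)]
    {g : Pt d → Pt d} (hg : MemLp g 4 (volume.restrict Ω)) :
    IntegrableOn (fun x => storedEnergy μ b ε (g x)) Ω := by
  have h4 := integrable_norm_pow hg (k := 4) (by norm_num) le_rfl
  have h2 := integrable_norm_pow hg (k := 2) (by norm_num) (by norm_num)
  refine (((h4.const_mul (beta μ b / 2)).sub (h2.const_mul (beta μ b * alpha b ε))).add
    (integrable_const (beta μ b / 2 * alpha b ε ^ 2 - beta0 μ b))).congr (ae_of_all _ fun x => ?_)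
  simp only [Pi.add_apply, Pi.sub_apply, storedEnergy_eq hb]
  ring

lemma integrable_inner_of_bounded (hΩ : IsRegion Ω n) {g V : Pt d → Pt d} {C : ℝ}
    (hgm : AEStronglyMeasurable g (volume.restrict Ω)) (hg : ∀ x ∈ Ω, ‖g x‖ ≤ C)
    (hV : IntegrableOn V Ω) : IntegrableOn (fun x => inner ℝ (g x) (V x)) Ω := by
  refine (hV.norm.const_mul C).mono' (hgm.inner hV.1) ?_
  refine ae_restrict_of_forall_mem hΩ.isOpen.measurableSet fun x hx => ?_
  exact (norm_inner_le_norm _ _).trans (mul_le_mul_of_nonneg_right (hg x hx) (norm_nonneg _))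

lemma integrable_primalDensity (hb : 0 < b) (hΩ : IsRegion Ω n)
    (hτ : ContinuousOn τ (closure Ω)) {g : Pt d → Pt d} (hg : MemLp g 4 (volume.restrict Ω)) :
    IntegrableOn (fun x => primalDensity μ b ε (τ x) (g x)) Ω := by
  have := hΩ.finite_volume
  obtain ⟨S, -, hS⟩ := hΩ.exists_bound hτ
  exact (integrable_storedEnergy hb hg).sub (integrable_inner_of_bounded hΩ
    (hΩ.aestronglyMeasurable hτ) (fun x hx => hS x (subset_closure hx))
    (hg.integrable (by norm_num)))

/-- By the principle of virtual work, the potential energy is an integral over `Ω`. -/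
lemma potential_eq (hd : 1 ≤ d) (hb : 0 < b) (hΩ : IsRegion Ω n)
    (hτ : τ ∈ Stresses Ω Γu n t) {v : Pt d → ℝ} (hv : v ∈ Displacements Ω Γu) {g : Pt d → Pt d}
    (hg : weakGradient Ω v =ᵐ[volume.restrict Ω] g) :
    potential μ b ε Ω Γu t v = ∫ x in Ω, primalDensity μ b ε (τ x) (g x) := by
  have := hΩ.finite_volume
  have hL := memLp_weakGradient hΩ.isOpen hv
  have hi : IntegrableOn (weakGradient Ω v) Ω := hL.integrable (by norm_num)
  obtain ⟨S, -, hS⟩ := hΩ.exists_bound hτ.1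
  have hcongr : (fun x => primalDensity μ b ε (τ x) (g x)) =ᵐ[volume.restrict Ω]
      fun x => storedEnergy μ b ε (weakGradient Ω v x) - inner ℝ (τ x) (weakGradient Ω v x) := by
    filter_upwards [hg] with x hx
    rw [primalDensity, hx]
  rw [potential, ← (virtual_work hd hΩ hτ hv.1 hv.2.2 (hasWeakGradient_of_mem hv) hi).2,
    integral_congr_ae hcongr, integral_sub (integrable_storedEnergy hb hL)
      (integrable_inner_of_bounded hΩ (hΩ.aestronglyMeasurable hτ.1)
        (fun x hx => hS x (subset_closure hx)) hi)]

/-- The excess of the potential density over its value at a strain `γ₀` with `2 ζ γ₀ = σ` and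
`|γ₀|² = c ζ + α`. -/
lemma primalDensity_sub (hμ : 0 < μ) (hb : 0 < b) {σ γ₀ : Pt d} {z : ℝ}
    (hσ : (2 * z) • γ₀ = σ) (hγ : ‖γ₀‖ ^ 2 = cc μ b * z + alpha b ε) (γ : Pt d) :
    primalDensity μ b ε σ γ - primalDensity μ b ε σ γ₀ =
      beta μ b / 2 * (‖γ‖ ^ 2 - ‖γ₀‖ ^ 2) ^ 2 + z * ‖γ - γ₀‖ ^ 2 := by
  have hβ := beta_mul_cc hμ hb
  rw [primalDensity, primalDensity, storedEnergy_eq hb, storedEnergy_eq hb, ← hσ,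
    real_inner_smul_left, real_inner_smul_left, norm_sub_sq_real, real_inner_self_eq_norm_sq,
    real_inner_comm γ₀ γ]
  have hα : alpha b ε = ‖γ₀‖ ^ 2 - cc μ b * z := by linarith
  rw [hα]
  linear_combination (z * (‖γ‖ ^ 2 - ‖γ₀‖ ^ 2)) * hβ

/-- At corresponding arguments the primal and dual densities agree up to sign. -/
lemma primalDensity_eq (hμ : 0 < μ) (hb : 0 < b) {σ γ₀ : Pt d} {z : ℝ} (hz : z ≠ 0)
    (hσ : (2 * z) • γ₀ = σ) (hγ : ‖γ₀‖ ^ 2 = cc μ b * z + alpha b ε) :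
    primalDensity μ b ε σ γ₀ = -dualDensity μ b ε ‖σ‖ z := by
  have hβ := beta_mul_cc hμ hb
  have hs : ‖σ‖ ^ 2 = 4 * z ^ 2 * ‖γ₀‖ ^ 2 := by
    rw [← hσ, norm_smul, mul_pow, Real.norm_eq_abs, sq_abs]; ring
  have hin : inner ℝ σ γ₀ = 2 * z * ‖γ₀‖ ^ 2 := by
    rw [← hσ, real_inner_smul_left, real_inner_self_eq_norm_sq]
  have hα : alpha b ε = ‖γ₀‖ ^ 2 - cc μ b * z := by linarith
  rw [primalDensity, dualDensity, storedEnergy_eq hb, hs, hin, hα,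
    show 4 * z ^ 2 * ‖γ₀‖ ^ 2 / (4 * z) = z * ‖γ₀‖ ^ 2 by field_simp]
  linear_combination (cc μ b * z ^ 2 / 2) * hβ

variable {u : Pt d → ℝ} {i : Fin 3}

lemma IsDualDisplacement.potential_eq_dualEnergy (hd : 1 ≤ d) (hμ : 0 < μ) (hb : 0 < b)
    (hα : 0 < alpha b ε) (hΩ : IsRegion Ω n) (hτ : τ ∈ Stresses Ω Γu n t)
    (h : IsDualDisplacement μ b ε Ω Γu τ i u) :
    potential μ b ε Ω Γu t u = dualEnergy μ b ε Ω τ (zbar μ b ε τ i) := by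
  rw [potential_eq hd hb hΩ hτ (h.mem_displacements hμ hb hα hΩ hτ.1)
    (h.weakGradient_ae hμ hb hα hΩ hτ.1), dualEnergy_eq, ← integral_neg]
  refine integral_congr_ae ?_
  filter_upwards [h.2.1, ae_restrict_mem hΩ.isOpen.measurableSet] with x hx hxΩ
  exact primalDensity_eq hμ hb hx (smul_strain hx) (norm_sq_strain hμ hb hα (h.1 x hxΩ) hx)

/-- The excess of the density over that of the displacement `ūᵢ`, almost everywhere. -/
lemma IsDualDisplacement.density_sub (hμ : 0 < μ) (hb : 0 < b) (hα : 0 < alpha b ε)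
    (hΩ : IsRegion Ω n) (h : IsDualDisplacement μ b ε Ω Γu τ i u) :
    ∀ᵐ x ∂volume.restrict Ω, ∀ γ, primalDensity μ b ε (τ x) γ
      - primalDensity μ b ε (τ x) (strain μ b ε τ i x) =
      beta μ b / 2 * (‖γ‖ ^ 2 - ‖strain μ b ε τ i x‖ ^ 2) ^ 2
        + zbar μ b ε τ i x * ‖γ - strain μ b ε τ i x‖ ^ 2 := by
  filter_upwards [h.2.1, ae_restrict_mem hΩ.isOpen.measurableSet] with x hx hxΩ γ
  exact primalDensity_sub hμ hb (smul_strain hx) (norm_sq_strain hμ hb hα (h.1 x hxΩ) hx) γ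

/-- A pointwise lower bound for the excess density gives minimality. -/
lemma IsDualDisplacement.potential_le (hd : 1 ≤ d) (hμ : 0 < μ) (hb : 0 < b)
    (hα : 0 < alpha b ε) (hΩ : IsRegion Ω n) (hτ : τ ∈ Stresses Ω Γu n t)
    (h : IsDualDisplacement μ b ε Ω Γu τ i u) {v : Pt d → ℝ} (hv : v ∈ Displacements Ω Γu)
    (hle : ∀ᵐ x ∂volume.restrict Ω,
      0 ≤ beta μ b / 2 * (‖weakGradient Ω v x‖ ^ 2 - ‖strain μ b ε τ i x‖ ^ 2) ^ 2
        + zbar μ b ε τ i x * ‖weakGradient Ω v x - strain μ b ε τ i x‖ ^ 2) :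
    potential μ b ε Ω Γu t u ≤ potential μ b ε Ω Γu t v := by
  rw [potential_eq hd hb hΩ hτ (h.mem_displacements hμ hb hα hΩ hτ.1)
    (h.weakGradient_ae hμ hb hα hΩ hτ.1), potential_eq hd hb hΩ hτ hv (ae_eq_refl _)]
  refine integral_mono_ae (integrable_primalDensity hb hΩ hτ.1
    (memLp_strain hμ hb hα hΩ hτ.1 h.1 4))
    (integrable_primalDensity hb hΩ hτ.1 (memLp_weakGradient hΩ.isOpen hv)) ?_
  filter_upwards [hle, h.density_sub hμ hb hα hΩ] with x h1 h2
  have := h2 (weakGradient Ω v x)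
  linarith

/-- A pointwise upper bound for the excess density gives maximality. -/
lemma IsDualDisplacement.le_potential (hd : 1 ≤ d) (hμ : 0 < μ) (hb : 0 < b)
    (hα : 0 < alpha b ε) (hΩ : IsRegion Ω n) (hτ : τ ∈ Stresses Ω Γu n t)
    (h : IsDualDisplacement μ b ε Ω Γu τ i u) {v : Pt d → ℝ} (hv : v ∈ Displacements Ω Γu)
    (hle : ∀ᵐ x ∂volume.restrict Ω,
      beta μ b / 2 * (‖weakGradient Ω v x‖ ^ 2 - ‖strain μ b ε τ i x‖ ^ 2) ^ 2
        + zbar μ b ε τ i x * ‖weakGradient Ω v x - strain μ b ε τ i x‖ ^ 2 ≤ 0) :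
    potential μ b ε Ω Γu t v ≤ potential μ b ε Ω Γu t u := by
  rw [potential_eq hd hb hΩ hτ (h.mem_displacements hμ hb hα hΩ hτ.1)
    (h.weakGradient_ae hμ hb hα hΩ hτ.1), potential_eq hd hb hΩ hτ hv (ae_eq_refl _)]
  refine integral_mono_ae
    (integrable_primalDensity hb hΩ hτ.1 (memLp_weakGradient hΩ.isOpen hv))
    (integrable_primalDensity hb hΩ hτ.1 (memLp_strain hμ hb hα hΩ hτ.1 h.1 4)) ?_
  filter_upwards [hle, h.density_sub hμ hb hα hΩ] with x h1 h2
  have := h2 (weakGradient Ω v x)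
  linarith

/-- Every `ūᵢ` is a critical point of the potential energy: along `u + s v` the energy is
`Π₂(u)` plus `s²` times a quadratic polynomial in `s`. -/
theorem IsDualDisplacement.isCriticalPrimal (hd : 1 ≤ d) (hμ : 0 < μ) (hb : 0 < b)
    (hα : 0 < alpha b ε) (hΩ : IsRegion Ω n) (hτ : τ ∈ Stresses Ω Γu n t)
    (h : IsDualDisplacement μ b ε Ω Γu τ i u) : IsCriticalPrimal μ b ε Ω Γu t u := by
  have := hΩ.finite_volume
  have hu := h.mem_displacements hμ hb hα hΩ hτ.1
  refine ⟨hu, fun v hv => ?_⟩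
  have hτm := hΩ.aestronglyMeasurable hτ.1
  have hm := hΩ.isOpen.measurableSet
  set g := strain μ b ε τ i with hg
  set z := zbar μ b ε τ i with hz
  set V := weakGradient Ω v with hV
  have hVL : MemLp V 4 (volume.restrict Ω) := memLp_weakGradient hΩ.isOpen hv
  have hgm : AEStronglyMeasurable g (volume.restrict Ω) := aestronglyMeasurable_strain hτm i
  obtain ⟨M, hM⟩ := exists_strain_bound hμ hb hα hΩ hτ.1 h.1
  obtain ⟨Bz, hBz⟩ := hΩ.isCompact_closure.exists_bound_of_continuousOn
    (continuousOn_zbar hμ hb hα hτ.1 h.1)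
  have hV2 := integrable_norm_pow hVL (k := 2) (by norm_num) (by norm_num)
  have hV3 := integrable_norm_pow hVL (k := 3) (by norm_num) (by norm_num)
  have hV4 := integrable_norm_pow hVL (k := 4) (by norm_num) le_rfl
  have hin : ∀ x ∈ Ω, |inner ℝ (g x) (V x)| ≤ M * ‖V x‖ := fun x hx =>
    (abs_real_inner_le_norm _ _).trans (mul_le_mul_of_nonneg_right (hM x hx) (norm_nonneg _))
  have i1 : IntegrableOn (fun x => inner ℝ (g x) (V x) ^ 2) Ω := by
    refine (hV2.const_mul ((M : ℝ) ^ 2)).mono' ((hgm.inner hVL.1).pow 2) ?_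
    refine ae_restrict_of_forall_mem hm fun x hx => ?_
    rw [Real.norm_eq_abs, abs_pow, ← mul_pow]
    exact pow_le_pow_left₀ (abs_nonneg _) (hin x hx) 2
  have i2 : IntegrableOn (fun x => z x * ‖V x‖ ^ 2) Ω := by
    refine hV2.bdd_mul (c := Bz) (aestronglyMeasurable_zbar hτm i) ?_
    exact ae_restrict_of_forall_mem hm fun x hx => hBz x (subset_closure hx)
  have i3 : IntegrableOn (fun x => inner ℝ (g x) (V x) * ‖V x‖ ^ 2) Ω := by
    refine (hV3.const_mul (M : ℝ)).mono' ((hgm.inner hVL.1).mul (hVL.1.norm.pow 2)) ?_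
    refine ae_restrict_of_forall_mem hm fun x hx => ?_
    rw [Real.norm_eq_abs, abs_mul, abs_pow, abs_norm]
    calc _ ≤ M * ‖V x‖ * ‖V x‖ ^ 2 := mul_le_mul_of_nonneg_right (hin x hx) (by positivity)
      _ = M * ‖V x‖ ^ 3 := by ring
  set A : ℝ := ∫ x in Ω, (2 * beta μ b * inner ℝ (g x) (V x) ^ 2 + z x * ‖V x‖ ^ 2) with hA
  set B : ℝ := ∫ x in Ω, 2 * beta μ b * (inner ℝ (g x) (V x) * ‖V x‖ ^ 2) with hB
  set C : ℝ := ∫ x in Ω, beta μ b / 2 * ‖V x‖ ^ 4 with hC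
  have hexp : ∀ s : ℝ, potential μ b ε Ω Γu t (u + s • v) =
      potential μ b ε Ω Γu t u + (s ^ 2 * A + s ^ 3 * B + s ^ 4 * C) := by
    intro s
    have hgr : weakGradient Ω (u + s • v) =ᵐ[volume.restrict Ω] fun x => g x + s • V x := by
      filter_upwards [weakGradient_add_smul hΩ hu hv s, h.weakGradient_ae hμ hb hα hΩ hτ.1]
        with x h1 h2
      rw [h1, h2]
    have j1 : IntegrableOn (fun x => s ^ 2 *
        (2 * beta μ b * inner ℝ (g x) (V x) ^ 2 + z x * ‖V x‖ ^ 2)) Ω :=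
      ((i1.const_mul _).add i2).const_mul _
    have j2 : IntegrableOn (fun x => s ^ 3 *
        (2 * beta μ b * (inner ℝ (g x) (V x) * ‖V x‖ ^ 2))) Ω := (i3.const_mul _).const_mul _
    have j3 : IntegrableOn (fun x => s ^ 4 * (beta μ b / 2 * ‖V x‖ ^ 4)) Ω :=
      (hV4.const_mul _).const_mul _
    have j0 : IntegrableOn (fun x => primalDensity μ b ε (τ x) (g x)) Ω :=
      integrable_primalDensity hb hΩ hτ.1 (memLp_strain hμ hb hα hΩ hτ.1 h.1 4)
    have j12 : IntegrableOn (fun x => s ^ 2 *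
        (2 * beta μ b * inner ℝ (g x) (V x) ^ 2 + z x * ‖V x‖ ^ 2) + s ^ 3 *
        (2 * beta μ b * (inner ℝ (g x) (V x) * ‖V x‖ ^ 2))) Ω := j1.add j2
    have j123 : IntegrableOn (fun x => s ^ 2 *
        (2 * beta μ b * inner ℝ (g x) (V x) ^ 2 + z x * ‖V x‖ ^ 2) + s ^ 3 *
        (2 * beta μ b * (inner ℝ (g x) (V x) * ‖V x‖ ^ 2))
        + s ^ 4 * (beta μ b / 2 * ‖V x‖ ^ 4)) Ω := j12.add j3
    rw [potential_eq hd hb hΩ hτ (add_smul_mem_displacements hΩ hu hv s) hgr,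
      potential_eq hd hb hΩ hτ hu (h.weakGradient_ae hμ hb hα hΩ hτ.1), hA, hB, hC,
      ← integral_const_mul, ← integral_const_mul, ← integral_const_mul, ← integral_add j1 j2,
      ← integral_add j12 j3, ← integral_add j0 j123]
    refine integral_congr_ae ?_
    filter_upwards [h.density_sub hμ hb hα hΩ] with x hx
    have h1 := hx (g x + s • V x)
    have h2 : ‖g x + s • V x‖ ^ 2 =
        ‖g x‖ ^ 2 + 2 * s * inner ℝ (g x) (V x) + s ^ 2 * ‖V x‖ ^ 2 := by
      rw [norm_add_sq_real, real_inner_smul_right, norm_smul, mul_pow, Real.norm_eq_abs, sq_abs]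
      ring
    have h3 : ‖s • V x‖ ^ 2 = s ^ 2 * ‖V x‖ ^ 2 := by
      rw [norm_smul, mul_pow, Real.norm_eq_abs, sq_abs]
    rw [add_sub_cancel_left, h2, h3] at h1
    linear_combination h1
  have hfun : (fun s : ℝ => potential μ b ε Ω Γu t (u + s • v)) = fun s =>
      potential μ b ε Ω Γu t u + (s ^ 2 * A + s ^ 3 * B + s ^ 4 * C) := funext hexp
  rw [hfun]
  have hder := ((((hasDerivAt_pow 2 (0 : ℝ)).mul_const A).add
    ((hasDerivAt_pow 3 (0 : ℝ)).mul_const B)).add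
    ((hasDerivAt_pow 4 (0 : ℝ)).mul_const C)).const_add (potential μ b ε Ω Γu t u)
  refine hder.congr_deriv ?_
  norm_num

end Primal

/-! ### Extremality -/

section Extremal

variable {d : ℕ} {μ b ε : ℝ} {Ω Γu : Set (Pt d)} {n : Pt d → Pt d} {τ : Pt d → Pt d}
  {t u : Pt d → ℝ}

lemma alpha_mul_beta (hμ : 0 < μ) (hb : 0 < b) :
    alpha b ε * beta μ b = alpha b ε / cc μ b := by
  have hc := cc_pos hμ hb
  rw [eq_div_iff hc.ne', mul_assoc, beta_mul_cc hμ hb, mul_one]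

lemma two_alpha_mul_beta (hμ : 0 < μ) (hb : 0 < b) :
    2 * alpha b ε * beta μ b / 3 = 2 * alpha b ε / (3 * cc μ b) := by
  rw [mul_assoc, alpha_mul_beta hμ hb]
  have hc := cc_pos hμ hb
  field_simp

/-- The double root `-2α/(3c)` occurs exactly at `s² = η`. -/
lemma IsDualRoot.eq_eta (hμ : 0 < μ) (hb : 0 < b) {s : ℝ}
    (h : IsDualRoot μ b ε s (-(2 * alpha b ε / (3 * cc μ b)))) : s ^ 2 = eta μ b ε := by
  have hc := cc_pos hμ hb
  rw [← h]
  unfold eta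
  field_simp
  ring

lemma IsDualRoot.eq_zero_of_left (hμ : 0 < μ) (hb : 0 < b) {s : ℝ}
    (h : IsDualRoot μ b ε s (-(alpha b ε / cc μ b))) : s = 0 := by
  have hc := cc_pos hμ hb
  have : s ^ 2 = 0 := by
    rw [← h]; field_simp; ring
  exact pow_eq_zero_iff two_ne_zero |>.1 this

lemma IsDualRoot.unique_of_pos (hμ : 0 < μ) (hb : 0 < b) (hα : 0 < alpha b ε) {s z w : ℝ}
    (hz : IsDualRoot μ b ε s z) (hw : IsDualRoot μ b ε s w) (hz0 : 0 < z) (hw0 : 0 < w) :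
    z = w := by
  have hc := cc_pos hμ hb
  have h : (z - w) * (cc μ b * (z ^ 2 + z * w + w ^ 2) + alpha b ε * (z + w)) = 0 := by
    unfold IsDualRoot at hz hw
    linear_combination (hz - hw) / 4
  have hpos : 0 < cc μ b * (z ^ 2 + z * w + w ^ 2) + alpha b ε * (z + w) := by positivity
  linarith [(mul_eq_zero.1 h).resolve_right hpos.ne']

lemma zbar_zero_root (hμ : 0 < μ) (hb : 0 < b) (hα : 0 < alpha b ε) (x : Pt d) :
    IsDualRoot μ b ε ‖τ x‖ (zbar μ b ε τ 0 x) :=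
  zbar_root hμ hb hα (cardano_zero_im hμ hb hα (norm_nonneg _))

lemma zbar_zero_nonneg (hμ : 0 < μ) (hb : 0 < b) (hα : 0 < alpha b ε) (x : Pt d) :
    0 ≤ zbar μ b ε τ 0 x :=
  cardano_zero_nonneg hμ hb hα (norm_nonneg _)

lemma zbar_zero_pos (hμ : 0 < μ) (hb : 0 < b) (hα : 0 < alpha b ε) {x : Pt d} (hx : τ x ≠ 0) :
    0 < zbar μ b ε τ 0 x := by
  refine (zbar_zero_nonneg hμ hb hα x).lt_of_ne' fun h0 => hx ?_
  have := zbar_zero_root (τ := τ) hμ hb hα x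
  rw [h0] at this
  exact norm_eq_zero.1 this.eq_zero_of_zero

lemma zbar_zero_eq_zero (hμ : 0 < μ) (hb : 0 < b) (hα : 0 < alpha b ε) {x : Pt d} (hx : τ x = 0) :
    zbar μ b ε τ 0 x = 0 := by
  have h := zbar_zero_root (τ := τ) hμ hb hα x
  have h0 := zbar_zero_nonneg (τ := τ) hμ hb hα x
  have hc := cc_pos hμ hb
  unfold IsDualRoot at h
  rw [hx, norm_zero] at h
  by_contra hne
  have hpos := h0.lt_of_ne' hne
  have : 0 < 4 * zbar μ b ε τ 0 x ^ 2 * (cc μ b * zbar μ b ε τ 0 x + alpha b ε) := by positivity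
  rw [h] at this
  norm_num at this

lemma zbar_zero_mem_dualFeasible (hμ : 0 < μ) (hb : 0 < b) (hα : 0 < alpha b ε)
    (hΩ : IsRegion Ω n) (hτ : ContinuousOn τ (closure Ω)) :
    zbar μ b ε τ 0 ∈ DualFeasible Ω τ :=
  ⟨zbar_mem_dualDomain hμ hb hα hΩ hτ fun _ _ => cardano_zero_im hμ hb hα (norm_nonneg _),
    ae_of_all _ fun x => zbar_zero_nonneg hμ hb hα x⟩

lemma dualDensity_zbar_zero_le (hμ : 0 < μ) (hb : 0 < b) (hα : 0 < alpha b ε) {x : Pt d} {ζ : ℝ}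
    (hζ : 0 ≤ ζ) (hne : τ x ≠ 0 → ζ ≠ 0) :
    dualDensity μ b ε ‖τ x‖ (zbar μ b ε τ 0 x) ≤ dualDensity μ b ε ‖τ x‖ ζ := by
  have hc := cc_pos hμ hb
  by_cases h0 : ζ = 0
  · have hτx : τ x = 0 := by
      by_contra h; exact hne h h0
    rw [h0, zbar_zero_eq_zero hμ hb hα hτx]
  · have h1 := dualDensity_sub (zbar_zero_root (τ := τ) hμ hb hα x) h0
    have h2 := zbar_zero_nonneg (τ := τ) hμ hb hα x
    have h3 : 0 ≤ (ζ - zbar μ b ε τ 0 x) ^ 2 / ζ *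
      (alpha b ε + cc μ b * (ζ + 2 * zbar μ b ε τ 0 x) / 2) := by positivity
    linarith

/-- Global maximality of the first root over the nonnegative dual fields. -/
lemma isMaxOn_zbar_zero (hμ : 0 < μ) (hb : 0 < b) (hα : 0 < alpha b ε)
    (hΩ : IsRegion Ω n) (hτ : ContinuousOn τ (closure Ω)) :
    IsMaxOn (dualEnergy μ b ε Ω τ) (DualFeasible Ω τ) (zbar μ b ε τ 0) := by
  intro ζ hζ
  refine dualEnergy_le_of_density_le hΩ hτ (zbar_zero_mem_dualFeasible hμ hb hα hΩ hτ).1 hζ.1 ?_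
  filter_upwards [hζ.2, ((mem_dualDomain_iff (hΩ.aestronglyMeasurable hτ)).1 hζ.1).2.1]
    with x h1 h2
  exact dualDensity_zbar_zero_le hμ hb hα h1 h2

lemma isMinOn_of_dualDisplacement_zero (hd : 1 ≤ d) (hμ : 0 < μ) (hb : 0 < b)
    (hα : 0 < alpha b ε) (hΩ : IsRegion Ω n) (hτ : τ ∈ Stresses Ω Γu n t)
    (h : IsDualDisplacement μ b ε Ω Γu τ 0 u) :
    IsMinOn (potential μ b ε Ω Γu t) (Displacements Ω Γu) u := by
  intro v hv
  refine h.potential_le hd hμ hb hα hΩ hτ hv (ae_of_all _ fun x => ?_)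
  have h1 := zbar_zero_nonneg (τ := τ) hμ hb hα x
  have h2 := beta_pos hμ hb
  positivity

/-- If `|τ|² ≤ η`, the third root lies in `[-α/c, -2α/(3c)]`, and strictly below the upper end
where `|τ|² < η`. -/
lemma zbar_two_mem (hμ : 0 < μ) (hb : 0 < b) (hα : 0 < alpha b ε) {x : Pt d}
    (hx : ‖τ x‖ ^ 2 ≤ eta μ b ε) :
    zbar μ b ε τ 2 x ∈ Icc (-(alpha b ε / cc μ b)) (-(2 * alpha b ε / (3 * cc μ b))) ∧
      (‖τ x‖ ^ 2 < eta μ b ε → zbar μ b ε τ 2 x < -(2 * alpha b ε / (3 * cc μ b))) := by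
  have hmem := cardano_two_mem hμ hb hα (norm_nonneg (τ x)) hx
  refine ⟨hmem, fun hlt => lt_of_le_of_ne hmem.2 fun he => ?_⟩
  have := zbar_root (τ := τ) hμ hb hα (cardano_im_of_le hμ hb hα (norm_nonneg _) hx 2)
  change zbar μ b ε τ 2 x = _ at he
  rw [he] at this
  exact hlt.ne (this.eq_eta hμ hb)

lemma zbar_one_mem (hμ : 0 < μ) (hb : 0 < b) (hα : 0 < alpha b ε) {x : Pt d} (hτx : τ x ≠ 0)
    (hx : ‖τ x‖ ^ 2 < eta μ b ε) :
    zbar μ b ε τ 1 x ∈ Ioo (-(2 * alpha b ε / (3 * cc μ b))) 0 := by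
  have hmem := cardano_one_mem hμ hb hα (norm_nonneg (τ x)) hx.le
  have hroot := zbar_root (τ := τ) hμ hb hα (cardano_im_of_le hμ hb hα (norm_nonneg _) hx.le 1)
  refine ⟨lt_of_le_of_ne hmem.1 fun he => ?_, lt_of_le_of_ne hmem.2 fun he => ?_⟩
  · change _ = zbar μ b ε τ 1 x at he
    rw [← he] at hroot
    exact hx.ne (hroot.eq_eta hμ hb)
  · change zbar μ b ε τ 1 x = _ at he
    rw [he] at hroot
    exact hτx (norm_eq_zero.1 hroot.eq_zero_of_zero)

lemma dualRange_max (hμ : 0 < μ) (hb : 0 < b) (hα : 0 < alpha b ε)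
    (hΩ : IsRegion Ω n) (hτ : ContinuousOn τ (closure Ω))
    (hη : ∀ x ∈ Ω, ‖τ x‖ ^ 2 < eta μ b ε) :
    zbar μ b ε τ 2 ∈
        DualRange Ω τ (Ico (-(alpha b ε * beta μ b)) (-(2 * alpha b ε * beta μ b / 3))) ∧
      IsMaxOn (dualEnergy μ b ε Ω τ)
        (DualRange Ω τ (Ico (-(alpha b ε * beta μ b)) (-(2 * alpha b ε * beta μ b / 3))))
        (zbar μ b ε τ 2) := by
  have hc := cc_pos hμ hb
  rw [two_alpha_mul_beta hμ hb, alpha_mul_beta hμ hb]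
  have him : ∀ x ∈ Ω, (cardano μ b ε 2 ‖τ x‖).im = 0 := fun x hx =>
    cardano_im_of_le hμ hb hα (norm_nonneg _) (hη x hx).le 2
  have hdom := zbar_mem_dualDomain hμ hb hα hΩ hτ him
  refine ⟨⟨hdom, ae_restrict_of_forall_mem hΩ.isOpen.measurableSet fun x hx => ?_⟩, ?_⟩
  · have := zbar_two_mem (τ := τ) hμ hb hα (hη x hx).le
    exact ⟨this.1.1, this.2 (hη x hx)⟩
  · intro ζ hζ
    refine dualEnergy_le_of_density_le hΩ hτ hdom hζ.1 ?_
    filter_upwards [hζ.2, ae_restrict_mem hΩ.isOpen.measurableSet] with x h1 hx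
    have h2 := (zbar_two_mem (τ := τ) hμ hb hα (hη x hx).le).2 (hη x hx)
    have hm : 0 < 2 * alpha b ε / (3 * cc μ b) := by positivity
    have hm2 : cc μ b * (2 * alpha b ε / (3 * cc μ b)) = 2 * alpha b ε / 3 := by field_simp
    have hζ0 : ζ x < 0 := by linarith [h1.2]
    have h3 := dualDensity_sub (zbar_root (τ := τ) hμ hb hα (him x hx)) hζ0.ne
    have h4 : alpha b ε + cc μ b * (ζ x + 2 * zbar μ b ε τ 2 x) / 2 ≤ 0 := by
      nlinarith [mul_lt_mul_of_pos_left h1.2 hc, mul_lt_mul_of_pos_left h2 hc]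
    have h5 := mul_nonneg_of_nonpos_of_nonpos
      (div_nonpos_of_nonneg_of_nonpos (sq_nonneg (ζ x - zbar μ b ε τ 2 x)) hζ0.le) h4
    linarith

lemma dualRange_min (hμ : 0 < μ) (hb : 0 < b) (hα : 0 < alpha b ε)
    (hΩ : IsRegion Ω n) (hτ : ContinuousOn τ (closure Ω)) (hτ0 : ∀ x ∈ Ω, τ x ≠ 0)
    (hη : ∀ x ∈ Ω, ‖τ x‖ ^ 2 < eta μ b ε) :
    zbar μ b ε τ 1 ∈ DualRange Ω τ (Ioo (-(2 * alpha b ε * beta μ b / 3)) 0) ∧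
      IsMinOn (dualEnergy μ b ε Ω τ)
        (DualRange Ω τ (Ioo (-(2 * alpha b ε * beta μ b / 3)) 0)) (zbar μ b ε τ 1) := by
  have hc := cc_pos hμ hb
  rw [two_alpha_mul_beta hμ hb]
  have him : ∀ x ∈ Ω, (cardano μ b ε 1 ‖τ x‖).im = 0 := fun x hx =>
    cardano_im_of_le hμ hb hα (norm_nonneg _) (hη x hx).le 1
  have hdom := zbar_mem_dualDomain hμ hb hα hΩ hτ him
  refine ⟨⟨hdom, ae_restrict_of_forall_mem hΩ.isOpen.measurableSet fun x hx =>
    zbar_one_mem hμ hb hα (hτ0 x hx) (hη x hx)⟩, ?_⟩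
  intro ζ hζ
  refine dualEnergy_le_of_density_le hΩ hτ hζ.1 hdom ?_
  filter_upwards [hζ.2, ae_restrict_mem hΩ.isOpen.measurableSet] with x h1 hx
  have h2 := zbar_one_mem (τ := τ) hμ hb hα (hτ0 x hx) (hη x hx)
  have hm2 : cc μ b * (2 * alpha b ε / (3 * cc μ b)) = 2 * alpha b ε / 3 := by field_simp
  have h3 := dualDensity_sub (zbar_root (τ := τ) hμ hb hα (him x hx)) h1.2.ne
  have h4 : 0 ≤ alpha b ε + cc μ b * (ζ x + 2 * zbar μ b ε τ 1 x) / 2 := by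
    nlinarith [mul_lt_mul_of_pos_left h1.1 hc, mul_lt_mul_of_pos_left h2.1 hc]
  have h5 := mul_nonpos_of_nonpos_of_nonneg
    (div_nonpos_of_nonneg_of_nonpos (sq_nonneg (ζ x - zbar μ b ε τ 1 x)) h1.2.le) h4
  linarith

/-- Local maximality: the excess density is nonpositive as long as
`2 |∇ū| + |∇v - ∇ū| ≤ √(-2 c ζ̄)`. -/
lemma exists_nbhd_isMaxOn (hd : 1 ≤ d) (hμ : 0 < μ) (hb : 0 < b)
    (hα : 0 < alpha b ε) (hΩ : IsRegion Ω n) (hτ : τ ∈ Stresses Ω Γu n t)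
    (hη : ∀ x ∈ Ω, ‖τ x‖ ^ 2 < eta μ b ε)
    (h : IsDualDisplacement μ b ε Ω Γu τ 2 u) :
    ∃ ρ : Pt d → ℝ, ContinuousOn ρ (closure Ω) ∧
      (∀ x ∈ closure Ω, ‖τ x‖ ^ 2 < eta μ b ε → 0 < ρ x) ∧
      u ∈ Nbhd Ω Γu u ρ ∧ IsMaxOn (potential μ b ε Ω Γu t) (Nbhd Ω Γu u ρ) u := by
  have hc := cc_pos hμ hb
  have hcl := le_eta_on_closure hτ.1 fun x hx => (hη x hx).le
  set z := zbar μ b ε τ 2 with hz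
  set ρ : Pt d → ℝ := fun x => √(-2 * cc μ b * z x) - 2 * √(cc μ b * z x + alpha b ε) with hρ
  have hzc : ContinuousOn z (closure Ω) := continuousOn_zbar hμ hb hα hτ.1 h.1
  have hρpos : ∀ x ∈ closure Ω, ‖τ x‖ ^ 2 < eta μ b ε → 0 < ρ x := by
    intro x hx hlt
    obtain ⟨h1, h2⟩ := zbar_two_mem (τ := τ) hμ hb hα (hcl x hx)
    have hm2 : cc μ b * (2 * alpha b ε / (3 * cc μ b)) = 2 * alpha b ε / 3 := by field_simp
    have h3 := mul_lt_mul_of_pos_left (h2 hlt) hc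
    rw [sub_pos, show (2 : ℝ) = √4 by rw [show (4 : ℝ) = 2 ^ 2 by norm_num]; simp,
      ← Real.sqrt_mul (by norm_num)]
    refine Real.sqrt_lt_sqrt ?_ ?_
    · have h4 := mul_le_mul_of_nonneg_left h1.1 hc.le
      rw [mul_neg, mul_div_cancel₀ _ hc.ne'] at h4
      change 0 ≤ 4 * (cc μ b * zbar μ b ε τ 2 x + alpha b ε)
      linarith
    · change 4 * (cc μ b * zbar μ b ε τ 2 x + alpha b ε) < -√4 * cc μ b * zbar μ b ε τ 2 x
      rw [show √(4 : ℝ) = 2 by rw [show (4 : ℝ) = 2 ^ 2 by norm_num]; simp]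
      linarith
  refine ⟨ρ, ?_, hρpos, ⟨h.mem_displacements hμ hb hα hΩ hτ.1, ?_⟩, ?_⟩
  · exact (continuousOn_const.mul hzc).sqrt.sub
      (continuousOn_const.mul ((continuousOn_const.mul hzc).add continuousOn_const).sqrt)
  · refine ae_restrict_of_forall_mem hΩ.isOpen.measurableSet fun x hx => ?_
    rw [sub_self, norm_zero]
    exact hρpos x (subset_closure hx) (hη x hx)
  · intro v hv
    refine h.le_potential hd hμ hb hα hΩ hτ hv.1 ?_
    filter_upwards [hv.2, h.weakGradient_ae hμ hb hα hΩ hτ.1, h.2.1,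
      ae_restrict_mem hΩ.isOpen.measurableSet] with x h1 h2 h3 hx
    rw [h2] at h1
    have hg := norm_sq_strain hμ hb hα (h.1 x hx) h3
    set g := strain μ b ε τ 2 x
    set γ := weakGradient Ω v x
    have hz0 : z x < 0 := by
      have := (zbar_two_mem (τ := τ) hμ hb hα (hη x hx).le).1.2
      have hm : 0 < 2 * alpha b ε / (3 * cc μ b) := by positivity
      change zbar μ b ε τ 2 x < 0
      linarith
    have hgn : √(cc μ b * z x + alpha b ε) = ‖g‖ := by
      rw [hz, ← hg, Real.sqrt_sq (norm_nonneg _)]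
    have hsum : ‖γ‖ + ‖g‖ ≤ √(-2 * cc μ b * z x) := by
      have h4 : ‖γ‖ ≤ ‖γ - g‖ + ‖g‖ := by
        simpa using norm_add_le (γ - g) g
      simp only [hρ] at h1
      rw [hgn] at h1
      linarith
    have hsq : (‖γ‖ + ‖g‖) ^ 2 ≤ -2 * cc μ b * z x := by
      have := pow_le_pow_left₀ (by positivity) hsum 2
      rwa [Real.sq_sqrt (by nlinarith)] at this
    have hD : (‖γ‖ ^ 2 - ‖g‖ ^ 2) ^ 2 ≤ ‖γ - g‖ ^ 2 * (-2 * cc μ b * z x) := by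
      have h5 : (‖γ‖ - ‖g‖) ^ 2 ≤ ‖γ - g‖ ^ 2 := by
        rw [← sq_abs (‖γ‖ - ‖g‖)]
        exact pow_le_pow_left₀ (abs_nonneg _) (abs_norm_sub_norm_le γ g) 2
      calc (‖γ‖ ^ 2 - ‖g‖ ^ 2) ^ 2 = (‖γ‖ - ‖g‖) ^ 2 * (‖γ‖ + ‖g‖) ^ 2 := by ring
        _ ≤ _ := mul_le_mul h5 hsq (sq_nonneg _) (sq_nonneg _)
    have hβ := beta_mul_cc hμ hb
    have hb2 : 0 ≤ beta μ b / 2 := by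
      have := beta_pos hμ hb
      positivity
    have h6 := mul_le_mul_of_nonneg_left hD hb2
    have h7 : beta μ b / 2 * (‖γ - g‖ ^ 2 * (-2 * cc μ b * z x)) = -(z x * ‖γ - g‖ ^ 2) := by
      linear_combination (-(z x * ‖γ - g‖ ^ 2)) * hβ
    rw [h7] at h6
    linarith

end Extremal

/-! ### Local minimality in dimension one -/

section OneDimensional

variable {μ b ε : ℝ} {Ω Γu : Set (Pt 1)} {n : Pt 1 → Pt 1} {τ : Pt 1 → Pt 1} {t u : Pt 1 → ℝ}

/-- In dimension one a continuous divergence-free field is constant. -/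
lemma divFree_const (hΩ : IsRegion Ω n) (hτ : ContinuousOn τ (closure Ω))
    (hdiv : IsDivFree Ω τ) : ∃ σ, ∀ x ∈ Ω, τ x = σ := by
  obtain ⟨T, hT, hTτ⟩ := exists_continuous_extension isClosed_closure hτ
  obtain ⟨c, hc⟩ := exists_const_of_weak_gradient_zero hΩ.isOpen hΩ.isConnected
    (f := fun x => T x 0) ((EuclideanSpace.proj (𝕜 := ℝ) 0).continuous.comp hT) (by
      intro φ hφ i
      rw [← hdiv φ hφ]
      refine setIntegral_congr_fun hΩ.isOpen.measurableSet fun x hx => ?_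
      obtain rfl : i = 0 := Subsingleton.elim _ _
      have e4 : (gradient φ x) 0 = fderiv ℝ φ x (EuclideanSpace.single 0 1) := by
        rw [← inner_gradient_left, EuclideanSpace.inner_single_right]; simp
      simp only
      rw [← hTτ (subset_closure hx), PiLp.inner_apply]
      simp [e4, mul_comm])
  refine ⟨EuclideanSpace.single 0 c, fun x hx => ?_⟩
  ext i
  obtain rfl : i = 0 := Subsingleton.elim _ _
  rw [← hTτ (subset_closure hx), hc x hx]
  simp

lemma sq_norm_sub_sq_norm_one_dim (x y : Pt 1) :
    (‖x‖ ^ 2 - ‖y‖ ^ 2) ^ 2 = ‖x - y‖ ^ 2 * ‖x + y‖ ^ 2 := by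
  simp only [EuclideanSpace.real_norm_sq_eq]
  simp
  ring

/-- Local minimality in dimension one: the excess density is nonnegative as long as
`2 |ū'| - |v' - ū'| ≥ √(-2 c ζ̄)`. -/
lemma exists_nbhd_isMinOn (hμ : 0 < μ) (hb : 0 < b)
    (hα : 0 < alpha b ε) (hΩ : IsRegion Ω n) (hτ : τ ∈ Stresses Ω Γu n t)
    (hτ0 : ∃ x ∈ Ω, τ x ≠ 0) (hη : ∀ x ∈ Ω, ‖τ x‖ ^ 2 < eta μ b ε)
    (h : IsDualDisplacement μ b ε Ω Γu τ 1 u) :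
    ∃ ρ : ℝ, 0 < ρ ∧ u ∈ Nbhd Ω Γu u (fun _ => ρ) ∧
      IsMinOn (potential μ b ε Ω Γu t) (Nbhd Ω Γu u (fun _ => ρ)) u := by
  have hc := cc_pos hμ hb
  obtain ⟨σ, hσ⟩ := divFree_const hΩ hτ.1 hτ.2.1
  obtain ⟨x₀, hx₀, hτx₀⟩ := hτ0
  have hzx : ∀ x ∈ Ω, zbar μ b ε τ 1 x = zbar μ b ε τ 1 x₀ := fun x hx => by
    unfold zbar; rw [hσ x hx, hσ x₀ hx₀]
  set z := zbar μ b ε τ 1 x₀ with hz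
  have hmem := zbar_one_mem (τ := τ) hμ hb hα hτx₀ (hη x₀ hx₀)
  rw [← hz] at hmem
  have hm2 : cc μ b * (2 * alpha b ε / (3 * cc μ b)) = 2 * alpha b ε / 3 := by field_simp
  set ρ : ℝ := 2 * √(cc μ b * z + alpha b ε) - √(-2 * cc μ b * z) with hρ
  have hρpos : 0 < ρ := by
    have h3 := mul_lt_mul_of_pos_left hmem.1 hc
    have h4 : √(-2 * cc μ b * z) < √(4 * (cc μ b * z + alpha b ε)) := by
      refine Real.sqrt_lt_sqrt ?_ ?_
      · have := mul_neg_of_pos_of_neg hc hmem.2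
        linarith
      · linarith
    rw [Real.sqrt_mul (by norm_num : (0 : ℝ) ≤ 4), show √(4 : ℝ) = 2 by
      rw [show (4 : ℝ) = 2 ^ 2 by norm_num]; simp] at h4
    rw [hρ]; linarith
  refine ⟨ρ, hρpos, ⟨h.mem_displacements hμ hb hα hΩ hτ.1, ?_⟩, ?_⟩
  · refine ae_of_all _ fun x => ?_
    rw [sub_self, norm_zero]
    exact hρpos
  · intro v hv
    refine h.potential_le le_rfl hμ hb hα hΩ hτ hv.1 ?_
    filter_upwards [hv.2, h.weakGradient_ae hμ hb hα hΩ hτ.1, h.2.1,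
      ae_restrict_mem hΩ.isOpen.measurableSet] with x h1 h2 h3 hx
    rw [h2] at h1
    have hg := norm_sq_strain hμ hb hα (h.1 x hx) h3
    rw [hzx x hx] at hg ⊢
    set g := strain μ b ε τ 1 x
    set γ := weakGradient Ω v x
    have hgn : √(cc μ b * z + alpha b ε) = ‖g‖ := by
      rw [← hg, Real.sqrt_sq (norm_nonneg _)]
    have hsum : √(-2 * cc μ b * z) ≤ ‖γ + g‖ := by
      have h4 : ‖g + g‖ ≤ ‖γ + g‖ + ‖γ - g‖ := by
        have := norm_sub_le (γ + g) (γ - g)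
        rwa [add_sub_sub_cancel] at this
      rw [← two_smul ℝ g, norm_smul, Real.norm_of_nonneg two_pos.le] at h4
      simp only [hρ] at h1
      rw [hgn] at h1
      linarith
    have hsq : -2 * cc μ b * z ≤ ‖γ + g‖ ^ 2 := by
      have := pow_le_pow_left₀ (Real.sqrt_nonneg _) hsum 2
      have hneg := mul_neg_of_pos_of_neg hc hmem.2
      rwa [Real.sq_sqrt (by linarith)] at this
    rw [sq_norm_sub_sq_norm_one_dim]
    have hβ := beta_mul_cc hμ hb
    have hb2 : 0 ≤ beta μ b / 2 * ‖γ - g‖ ^ 2 := by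
      have := beta_pos hμ hb
      positivity
    have h6 := mul_le_mul_of_nonneg_left hsq hb2
    have h7 : beta μ b / 2 * ‖γ - g‖ ^ 2 * (-2 * cc μ b * z) = -(z * ‖γ - g‖ ^ 2) := by
      linear_combination (-(z * ‖γ - g‖ ^ 2)) * hβ
    rw [h7] at h6
    linarith

end OneDimensional

/-! ### Uniqueness and smoothness when `|τ|² > η` -/

section Unique

variable {d : ℕ} {μ b ε : ℝ} {Ω Γu : Set (Pt d)} {n : Pt d → Pt d} {τ : Pt d → Pt d}
  {t u : Pt d → ℝ}

lemma ne_zero_of_eta_lt (hμ : 0 < μ) (hb : 0 < b) (hα : 0 < alpha b ε) {x : Pt d}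
    (h : eta μ b ε < ‖τ x‖ ^ 2) : τ x ≠ 0 := by
  rintro h0
  rw [h0, norm_zero] at h
  have := eta_pos hμ hb hα
  norm_num at h
  linarith

lemma IsDualRoot.eq_zbar_zero (hμ : 0 < μ) (hb : 0 < b) (hα : 0 < alpha b ε) {x : Pt d} {ζ : ℝ}
    (hζ : IsDualRoot μ b ε ‖τ x‖ ζ) (h : eta μ b ε < ‖τ x‖ ^ 2) : ζ = zbar μ b ε τ 0 x := by
  refine hζ.unique_of_pos hμ hb hα (zbar_zero_root hμ hb hα x) ?_
    (zbar_zero_pos hμ hb hα (ne_zero_of_eta_lt hμ hb hα h))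
  by_contra! hle
  have h1 := cubic_le_eta hμ hb hα hle
  unfold IsDualRoot at hζ
  linarith

lemma eq_zbar_zero_of_isMaxOn (hμ : 0 < μ) (hb : 0 < b) (hα : 0 < alpha b ε)
    (hΩ : IsRegion Ω n) (hτ : ContinuousOn τ (closure Ω)) {ζ : Pt d → ℝ}
    (hζ : ζ ∈ DualFeasible Ω τ)
    (hmax : IsMaxOn (dualEnergy μ b ε Ω τ) (DualFeasible Ω τ) ζ) (hτ0 : ∀ x ∈ Ω, τ x ≠ 0) :
    ζ =ᵐ[volume.restrict Ω] zbar μ b ε τ 0 := by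
  have := hΩ.finite_volume
  have hc := cc_pos hμ hb
  have hτm := hΩ.aestronglyMeasurable hτ
  have hz := zbar_zero_mem_dualFeasible hμ hb hα hΩ hτ
  have heq : dualEnergy μ b ε Ω τ ζ = dualEnergy μ b ε Ω τ (zbar μ b ε τ 0) :=
    le_antisymm (isMaxOn_zbar_zero hμ hb hα hΩ hτ hζ) (hmax hz)
  have hne := ((mem_dualDomain_iff hτm).1 hζ.1).2.1
  have hle : ∀ᵐ x ∂volume.restrict Ω, dualDensity μ b ε ‖τ x‖ (zbar μ b ε τ 0 x) ≤
      dualDensity μ b ε ‖τ x‖ (ζ x) := by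
    filter_upwards [hζ.2, hne] with x h1 h2
    exact dualDensity_zbar_zero_le hμ hb hα h1 h2
  rw [dualEnergy_eq, dualEnergy_eq, neg_inj] at heq
  have hae := (integral_eq_iff_of_ae_le (integrable_dualDensity hτm hz.1)
    (integrable_dualDensity hτm hζ.1) hle).1 heq.symm
  filter_upwards [hae, hne, hζ.2, ae_restrict_mem hΩ.isOpen.measurableSet] with x h1 h2 h3 hx
  have hζ0 : 0 < ζ x := h3.lt_of_ne' (h2 (hτ0 x hx))
  have h4 := dualDensity_sub (zbar_zero_root (τ := τ) hμ hb hα x) hζ0.ne'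
  rw [← h1, sub_self] at h4
  have hz0 := zbar_zero_nonneg (τ := τ) hμ hb hα x
  have h5 : alpha b ε + cc μ b * (ζ x + 2 * zbar μ b ε τ 0 x) / 2 ≠ 0 := by positivity
  rcases mul_eq_zero.1 h4.symm with h6 | h6
  · rw [div_eq_zero_iff] at h6
    rcases h6 with h6 | h6
    · exact sub_eq_zero.1 (pow_eq_zero_iff two_ne_zero |>.1 h6)
    · exact absurd h6 hζ0.ne'
  · exact absurd h6 h5

/-- Uniqueness of the global minimizer: a minimizer has the same weak gradient, hence differs by a
constant, which vanishes because both functions vanish on `Γu`. -/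
lemma eqOn_of_isMinOn (hd : 1 ≤ d) (hμ : 0 < μ) (hb : 0 < b) (hα : 0 < alpha b ε)
    (hΩ : IsRegion Ω n) (hΓ : Γu ⊆ frontier Ω) (hΓne : Γu.Nonempty)
    (hτ : τ ∈ Stresses Ω Γu n t) (hτ0 : ∀ x ∈ Ω, τ x ≠ 0)
    (h : IsDualDisplacement μ b ε Ω Γu τ 0 u) {v : Pt d → ℝ} (hv : v ∈ Displacements Ω Γu)
    (hmin : IsMinOn (potential μ b ε Ω Γu t) (Displacements Ω Γu) v) : EqOn v u (closure Ω) := by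
  have := hΩ.finite_volume
  have hu := h.mem_displacements hμ hb hα hΩ hτ.1
  have heq : potential μ b ε Ω Γu t u = potential μ b ε Ω Γu t v :=
    le_antisymm (isMinOn_of_dualDisplacement_zero hd hμ hb hα hΩ hτ h hv) (hmin hu)
  rw [potential_eq hd hb hΩ hτ hu (h.weakGradient_ae hμ hb hα hΩ hτ.1),
    potential_eq hd hb hΩ hτ hv (ae_eq_refl _)] at heq
  have hle : ∀ᵐ x ∂volume.restrict Ω, primalDensity μ b ε (τ x) (strain μ b ε τ 0 x) ≤
      primalDensity μ b ε (τ x) (weakGradient Ω v x) := by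
    filter_upwards [h.density_sub hμ hb hα hΩ] with x hx
    have h1 := hx (weakGradient Ω v x)
    have h2 := zbar_zero_nonneg (τ := τ) hμ hb hα x
    have h3 := beta_pos hμ hb
    rw [← sub_nonneg, h1]
    positivity
  have hae := (integral_eq_iff_of_ae_le (integrable_primalDensity hb hΩ hτ.1
    (memLp_strain hμ hb hα hΩ hτ.1 h.1 4))
    (integrable_primalDensity hb hΩ hτ.1 (memLp_weakGradient hΩ.isOpen hv)) hle).1 heq
  have hgrad : weakGradient Ω v =ᵐ[volume.restrict Ω] weakGradient Ω u := by
    filter_upwards [hae, h.density_sub hμ hb hα hΩ, h.weakGradient_ae hμ hb hα hΩ hτ.1,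
      ae_restrict_mem hΩ.isOpen.measurableSet] with x h1 h2 h3 hx
    have h4 := h2 (weakGradient Ω v x)
    rw [← h1, sub_self] at h4
    have hz := zbar_zero_pos hμ hb hα (hτ0 x hx)
    have hβ := beta_pos hμ hb
    have h5 : zbar μ b ε τ 0 x * ‖weakGradient Ω v x - strain μ b ε τ 0 x‖ ^ 2 = 0 := by
      refine le_antisymm ?_ (by positivity)
      have : 0 ≤ beta μ b / 2 * (‖weakGradient Ω v x‖ ^ 2 - ‖strain μ b ε τ 0 x‖ ^ 2) ^ 2 := by
        positivity
      linarith
    have h6 := pow_eq_zero_iff two_ne_zero |>.1 ((mul_eq_zero.1 h5).resolve_left hz.ne')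
    rw [h3]
    exact sub_eq_zero.1 (norm_eq_zero.1 h6)
  have hwc : ContinuousOn (fun x => v x - u x) (closure Ω) := hv.1.sub hu.1
  have hweak : ∀ φ, IsTest Ω φ → ∀ i, ∫ x in Ω, (v x - u x) *
      fderiv ℝ φ x (EuclideanSpace.single i 1) = 0 := by
    intro φ hφ i
    have e1 := (hasWeakGradient_of_mem hv).component hΩ.isBounded hv.1 hφ i
    have e2 := (hasWeakGradient_of_mem hu).component hΩ.isBounded hu.1 hφ i
    have e3 : ∫ x in Ω, φ x * weakGradient Ω v x i = ∫ x in Ω, φ x * weakGradient Ω u x i :=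
      integral_congr_ae (hgrad.mono fun x hx => by simp only [hx])
    have hi : ∀ {f : Pt d → ℝ}, ContinuousOn f (closure Ω) → IntegrableOn
        (fun x => f x * fderiv ℝ φ x (EuclideanSpace.single i 1)) Ω := fun {f} hf =>
      integrable_on_of_continuousOn_closure hΩ.isBounded
        (hf.mul (hφ.continuous_fderiv.clm_apply continuous_const).continuousOn)
    simp_rw [sub_mul]
    rw [integral_sub (hi hv.1) (hi hu.1), e1, e2, e3, sub_self]
  obtain ⟨W, hW, hWw⟩ := exists_continuous_extension isClosed_closure hwc
  obtain ⟨c, hc⟩ := exists_const_of_weak_gradient_zero hΩ.isOpen hΩ.isConnected hW (by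
    intro φ hφ i
    rw [← hweak φ hφ i]
    refine setIntegral_congr_fun hΩ.isOpen.measurableSet fun x hx => ?_
    simp only [hWw (subset_closure hx)])
  have hcl : ∀ x ∈ closure Ω, W x = c := fun x hx =>
    closure_minimal (t := W ⁻¹' {c}) (fun y hy => hc y hy)
      (isClosed_singleton.preimage hW) hx
  obtain ⟨y, hy⟩ := hΓne
  have hyc : y ∈ closure Ω := frontier_subset_closure (hΓ hy)
  have hc0 : c = 0 := by
    rw [← hcl y hyc, hWw hyc]
    simp only [hv.2.2 y hy, hu.2.2 y hy, sub_self]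
  intro x hx
  have := hcl x hx
  rw [hWw hx, hc0] at this
  exact sub_eq_zero.1 this

/-- Where `|τ|² > η`, the strain of the first root is continuous up to the boundary and as smooth
as `τ`, so its line integral is one order smoother. -/
lemma isSmoothSolution (hμ : 0 < μ) (hb : 0 < b) (hα : 0 < alpha b ε)
    (hΩ : IsRegion Ω n) (hτ : ContinuousOn τ (closure Ω))
    (hη : ∀ x ∈ Ω, eta μ b ε < ‖τ x‖ ^ 2) (h : IsDualDisplacement μ b ε Ω Γu τ 0 u) :
    IsSmoothSolution Ω τ u := by
  have hl : IsLineIntegral Ω Γu (strain μ b ε τ 0) u := h.2.2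
  have hcl : ∀ x ∈ closure Ω, eta μ b ε ≤ ‖τ x‖ ^ 2 := fun x hx =>
    le_on_closure (fun y hy => (hη y hy).le) continuousOn_const (hτ.norm.pow 2) hx
  have hz0 : ∀ x ∈ closure Ω, zbar μ b ε τ 0 x ≠ 0 := fun x hx => by
    refine (zbar_zero_pos hμ hb hα fun h0 => ?_).ne'
    have h1 := hcl x hx
    rw [h0, norm_zero] at h1
    have := eta_pos hμ hb hα
    norm_num at h1
    linarith
  have hgc : ContinuousOn (strain μ b ε τ 0) (closure Ω) :=
    ((continuousOn_const.mul (continuousOn_zbar hμ hb hα hτ h.1)).inv₀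
      fun x hx => mul_ne_zero two_ne_zero (hz0 x hx)).smul hτ
  have hgrad : ∀ x ∈ Ω, HasGradientAt u (strain μ b ε τ 0 x) x := fun x hx =>
    hl.hasGradientAt hΩ.isOpen Subset.rfl (hgc.mono subset_closure) hx
  refine ⟨⟨_, hgc, hgrad⟩, fun k hk => ?_⟩
  rw [contDiffOn_succ_iff_fderiv_of_isOpen hΩ.isOpen]
  refine ⟨fun x hx => (hgrad x hx).differentiableAt.differentiableWithinAt, fun hω => ?_, ?_⟩
  · simp at hω
  · have hτ0 : ∀ x ∈ Ω, τ x ≠ 0 := fun x hx => ne_zero_of_eta_lt hμ hb hα (hη x hx)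
    have hn : ContDiffOn ℝ k (fun x => ‖τ x‖) Ω := hk.norm ℝ hτ0
    have hzk : ContDiffOn ℝ k (zbar μ b ε τ 0) Ω := by
      intro x hx
      have h1 : ContDiffAt ℝ k (fun s => (cardano μ b ε 0 s).re) ‖τ x‖ :=
        (contDiffAt_cardano_zero hμ hb hα (norm_pos_iff.2 (hτ0 x hx)) (hη x hx)).of_le
          (by exact_mod_cast le_top)
      exact ContDiffAt.comp_contDiffWithinAt (f := fun x => ‖τ x‖)
        (g := fun s => (cardano μ b ε 0 s).re) x h1 (hn x hx)
    have hgk : ContDiffOn ℝ k (strain μ b ε τ 0) Ω :=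
      ((contDiffOn_const.mul hzk).inv
        fun x hx => mul_ne_zero two_ne_zero (hz0 x (subset_closure hx))).smul hk
    rw [contDiffOn_clm_apply]
    intro y
    refine (hgk.inner ℝ (contDiffOn_const (c := y))).congr fun x hx => ?_
    rw [(hgrad x hx).hasFDerivAt.fderiv, InnerProductSpace.toDual_apply_apply]

end Unique

end AntiPlane

open AntiPlane in
theorem theorem7 {d : ℕ} (hd : d = 1 ∨ d = 2) (Ω Γu : Set (Pt d)) (n : Pt d → Pt d)
    (hΩ : IsRegion Ω n) (hΓ : Γu ⊆ frontier Ω) (hΓm : MeasurableSet Γu) (hΓne : Γu.Nonempty)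
    (μ b ε : ℝ) (hμ : 0 < μ) (hb : 0 < b) (hα : 0 < alpha b ε)
    (t : Pt d → ℝ) (τ : Pt d → Pt d) (hτ : τ ∈ Stresses Ω Γu n t) (hτ0 : ∃ x ∈ Ω, τ x ≠ 0) :
    -- critical points of the dual energy
    (∀ ζ : Pt d → ℝ, AEStronglyMeasurable ζ (volume.restrict Ω) →
      (IsCriticalDual μ b ε Ω τ ζ ↔
        ∀ᵐ x ∂volume.restrict Ω, ζ x ≠ 0 ∧ ∃ i, (ζ x : ℂ) = cardano μ b ε i ‖τ x‖)) ∧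
    -- critical points of the potential energy
    (∀ i u, IsDualDisplacement μ b ε Ω Γu τ i u → IsCriticalPrimal μ b ε Ω Γu t u) ∧
    -- global extrema
    ((∀ x ∈ Ω, (cardano μ b ε 0 ‖τ x‖).im = 0 ∧ (τ x ≠ 0 → 0 < zbar μ b ε τ 0 x)) ∧
      zbar μ b ε τ 0 ∈ DualFeasible Ω τ ∧
      IsMaxOn (dualEnergy μ b ε Ω τ) (DualFeasible Ω τ) (zbar μ b ε τ 0) ∧
      ∀ u, IsDualDisplacement μ b ε Ω Γu τ 0 u →
        u ∈ Displacements Ω Γu ∧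
        IsMinOn (potential μ b ε Ω Γu t) (Displacements Ω Γu) u ∧
        potential μ b ε Ω Γu t u = dualEnergy μ b ε Ω τ (zbar μ b ε τ 0)) ∧
    -- local maximum
    ((∀ x ∈ Ω, ‖τ x‖ ^ 2 < eta μ b ε) →
      (∀ x ∈ Ω, (cardano μ b ε 2 ‖τ x‖).im = 0 ∧
        (τ x ≠ 0 → -(alpha b ε * beta μ b) < zbar μ b ε τ 2 x)) ∧
      zbar μ b ε τ 2 ∈
        DualRange Ω τ (Ico (-(alpha b ε * beta μ b)) (-(2 * alpha b ε * beta μ b / 3))) ∧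
      IsMaxOn (dualEnergy μ b ε Ω τ)
        (DualRange Ω τ (Ico (-(alpha b ε * beta μ b)) (-(2 * alpha b ε * beta μ b / 3))))
        (zbar μ b ε τ 2) ∧
      ∀ u, IsDualDisplacement μ b ε Ω Γu τ 2 u →
        (∃ ρ : Pt d → ℝ, ContinuousOn ρ (closure Ω) ∧
          (∀ x ∈ closure Ω, ‖τ x‖ ^ 2 < eta μ b ε → 0 < ρ x) ∧
          u ∈ Nbhd Ω Γu u ρ ∧
          IsMaxOn (potential μ b ε Ω Γu t) (Nbhd Ω Γu u ρ) u) ∧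
        potential μ b ε Ω Γu t u = dualEnergy μ b ε Ω τ (zbar μ b ε τ 2)) ∧
    -- local minimum in dimension one
    (d = 1 → (∀ x ∈ Ω, ‖τ x‖ ^ 2 < eta μ b ε) →
      (∀ x ∈ Ω, (cardano μ b ε 1 ‖τ x‖).im = 0) ∧
      zbar μ b ε τ 1 ∈ DualRange Ω τ (Ioo (-(2 * alpha b ε * beta μ b / 3)) 0) ∧
      IsMinOn (dualEnergy μ b ε Ω τ)
        (DualRange Ω τ (Ioo (-(2 * alpha b ε * beta μ b / 3)) 0)) (zbar μ b ε τ 1) ∧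
      ∀ u, IsDualDisplacement μ b ε Ω Γu τ 1 u →
        (∃ ρ : ℝ, 0 < ρ ∧ u ∈ Nbhd Ω Γu u (fun _ => ρ) ∧
          IsMinOn (potential μ b ε Ω Γu t) (Nbhd Ω Γu u (fun _ => ρ)) u) ∧
        potential μ b ε Ω Γu t u = dualEnergy μ b ε Ω τ (zbar μ b ε τ 1)) ∧
    -- uniqueness and smoothness
    ((∀ x ∈ Ω, eta μ b ε < ‖τ x‖ ^ 2) →
      IsCriticalDual μ b ε Ω τ (zbar μ b ε τ 0) ∧
      (∀ ζ, IsCriticalDual μ b ε Ω τ ζ → ζ =ᵐ[volume.restrict Ω] zbar μ b ε τ 0) ∧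
      (∀ ζ ∈ DualFeasible Ω τ, IsMaxOn (dualEnergy μ b ε Ω τ) (DualFeasible Ω τ) ζ →
        ζ =ᵐ[volume.restrict Ω] zbar μ b ε τ 0) ∧
      ∀ u, IsDualDisplacement μ b ε Ω Γu τ 0 u →
        IsMinOn (potential μ b ε Ω Γu t) (Displacements Ω Γu) u ∧
        (∀ v ∈ Displacements Ω Γu,
          IsMinOn (potential μ b ε Ω Γu t) (Displacements Ω Γu) v → EqOn v u (closure Ω)) ∧
        IsSmoothSolution Ω τ u) := by
  have hd1 : 1 ≤ d := by omega
  have hτc := hτ.1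
  have hτm := hΩ.aestronglyMeasurable hτc
  have hm := hΩ.isOpen.measurableSet
  have him0 : ∀ x, (cardano μ b ε 0 ‖τ x‖).im = 0 := fun x =>
    cardano_zero_im hμ hb hα (norm_nonneg _)
  refine ⟨fun ζ hζ => ?_, fun i u h => h.isCriticalPrimal hd1 hμ hb hα hΩ hτ,
    ⟨fun x _ => ⟨him0 x, fun hx => zbar_zero_pos hμ hb hα hx⟩,
      zbar_zero_mem_dualFeasible hμ hb hα hΩ hτc, isMaxOn_zbar_zero hμ hb hα hΩ hτc,
      fun u h => ⟨h.mem_displacements hμ hb hα hΩ hτc,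
        isMinOn_of_dualDisplacement_zero hd1 hμ hb hα hΩ hτ h,
        h.potential_eq_dualEnergy hd1 hμ hb hα hΩ hτ⟩⟩, fun hη => ?_, fun hd' hη => ?_,
    fun hη => ?_⟩
  · simp only [eq_cardano_iff hμ hb hα]
    exact isCriticalDual_iff hμ hb hα hΩ hτc hζ
  · have him : ∀ x ∈ Ω, (cardano μ b ε 2 ‖τ x‖).im = 0 := fun x hx =>
      cardano_im_of_le hμ hb hα (norm_nonneg _) (hη x hx).le 2
    obtain ⟨hmem, hmax⟩ := dualRange_max hμ hb hα hΩ hτc hη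
    refine ⟨fun x hx => ⟨him x hx, fun hx0 => ?_⟩, hmem, hmax, fun u h =>
      ⟨exists_nbhd_isMaxOn hd1 hμ hb hα hΩ hτ hη h,
        h.potential_eq_dualEnergy hd1 hμ hb hα hΩ hτ⟩⟩
    rw [alpha_mul_beta hμ hb]
    refine (zbar_two_mem hμ hb hα (hη x hx).le).1.1.lt_of_ne fun he => hx0 ?_
    have hroot := zbar_root (τ := τ) hμ hb hα (him x hx)
    rw [← he] at hroot
    exact norm_eq_zero.1 (hroot.eq_zero_of_left hμ hb)
  · subst hd'
    obtain ⟨σ, hσ⟩ := divFree_const hΩ hτc hτ.2.1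
    have hτne : ∀ x ∈ Ω, τ x ≠ 0 := by
      obtain ⟨x₀, hx₀, hne⟩ := hτ0
      intro x hx
      rwa [hσ x hx, ← hσ x₀ hx₀]
    obtain ⟨hmem, hmin⟩ := dualRange_min hμ hb hα hΩ hτc hτne hη
    exact ⟨fun x hx => cardano_im_of_le hμ hb hα (norm_nonneg _) (hη x hx).le 1, hmem, hmin,
      fun u h => ⟨exists_nbhd_isMinOn hμ hb hα hΩ hτ hτ0 hη h,
        h.potential_eq_dualEnergy hd1 hμ hb hα hΩ hτ⟩⟩
  · have hτne : ∀ x ∈ Ω, τ x ≠ 0 := fun x hx => ne_zero_of_eta_lt hμ hb hα (hη x hx)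
    refine ⟨(isCriticalDual_iff hμ hb hα hΩ hτc (aestronglyMeasurable_zbar hτm 0)).2
      (ae_restrict_of_forall_mem hm fun x hx =>
        ⟨(zbar_zero_pos hμ hb hα (hτne x hx)).ne', zbar_zero_root hμ hb hα x⟩), fun ζ hζ => ?_,
      fun ζ hζ hmax => eq_zbar_zero_of_isMaxOn hμ hb hα hΩ hτc hζ hmax hτne, fun u h =>
      ⟨isMinOn_of_dualDisplacement_zero hd1 hμ hb hα hΩ hτ h, fun v hv hmin =>
        eqOn_of_isMinOn hd1 hμ hb hα hΩ hΓ hΓne hτ hτne h hv hmin,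
        isSmoothSolution hμ hb hα hΩ hτc hη h⟩⟩
    filter_upwards [(isCriticalDual_iff hμ hb hα hΩ hτc hζ.1.1.1).1 hζ, ae_restrict_mem hm]
      with x hx hxΩ
    exact hx.2.eq_zbar_zero hμ hb hα (hη x hxΩ)
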